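/- Let $\Sigma$ be a finite set and let $I\subseteq\Sigma\times\Sigma$ be an irreflexive symmetric relation (that is, $(\Sigma,I)$ is a finite undirected graph). Let $$G(\Sigma,I)=\langle \Sigma \mid ab=ba \text{ for } (a,b)\in I\rangle$$ be the associated graph group (right-angled Artin group), and let $$C(\Sigma,I)=\langle \Sigma \mid a^2=1 \text{ for } a\in\Sigma,\ ab=ba \text{ for } (a,b)\in I\rangle$$ be the associated right-angled Coxeter group; equivalently, the latter is the Coxeter group of a Coxeter matrix over $\Sigma$ all of whose entries lie in $\{1,2,\infty\}$. For a finite linearly ordered alphabet $\Gamma$ and a surjective monoid homomorphism $\pi\colon\Gamma^*\to G$ onto a group $G$, the *shortlex normal form* of $g\in G$ is the lexicographically first word among the words of minimal length in $\pi^{-1}(g)$. For $G(\Sigma,I)$ take $\Gamma=\Sigma\cup\overline\Sigma$, where $\overline\Sigma$ is a disjoint copy of $\Sigma$ and $\pi(\overline a)=\pi(a)^{-1}$, and for $C(\Sigma,I)$ take $\Gamma=\Sigma$; in both cases with an arbitrary fixed linear order on $\Gamma$. **Theorem.** Let $G$ be a fixed graph group or a fixed right-angled Coxeter group, with $\Gamma$,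 its linear order and $\pi$ as above. Then shortlex normal forms in $G$ can be computed in logspace: there is a deterministic logspace transducer (a deterministic Turing machine with a read-only input tape, a read/write work tape of which it uses $O(\log n)$ cells on inputs of length $n$, and a write-only output tape that is written from left to right) which, on every input word $w\in\Gamma^*$, halts with the shortlex normal form of $\pi(w)$ on its output tape. -/

import Mathlib

/-! ### Deterministic logspace transducers -/

/-- A movement of a tape head by at most one cell. -/
inductive HeadMove where
  | left
  | stay
  | right

/-- The head position after a move on a tape whose cells are numbered `0, 1, 2, …`; a head on the
leftmost cell does not leave the tape. -/
def HeadMove.apply : HeadMove → ℕ → ℕ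
  | .left, p => p - 1
  | .stay, p => p
  | .right, p => p + 1

/-- The symbols on the input tape: the letters of the input, between two end markers. -/
inductive InputSymbol (α : Type*) where
  | leftEnd
  | letter (a : α)
  | rightEnd

/-- What a transducer does in one step: the new state, the move of the input head, the symbol
written on the work tape, the move of the work head, and at most one letter that is appended to
the output. -/
structure TransducerAction (State Work : Type) (β : Type*) where
  next : State
  inputMove : HeadMove
  write : Work
  workMove : HeadMove
  emit : Option β

/-- A deterministic Turing machine with a read-only input tape (alphabet `α`), one read/write work
tape, which is infinite to the right, and a write-only output tape (alphabet `β`). The next action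
depends on the state and on the symbols under the input head and the work head; the machine halts
when `trans` gives `none`. -/
structure Transducer (α β : Type*) where
  State : Type
  Work : Type
  finite_state : Finite State
  finite_work : Finite Work
  start : State
  blank : Work
  trans : State → InputSymbol α → Work → Option (TransducerAction State Work β)

namespace Transducer

variable {α β : Type*}

/-- A configuration of `T`: the state, the position of the input head (`0` is the left end marker
and `i + 1` is the `i`-th letter, counted from zero), the content and the head position of the work
tape, and the output so far. -/
structure Config (T : Transducer α β) where
  state : T.State
  inputPos : ℕ
  work : ℕ → T.Work
  workPos : ℕ
  out : List β

/-- The symbol of the input tape, with content `w`, at a given position. -/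
def readInput (w : List α) : ℕ → InputSymbol α
  | 0 => .leftEnd
  | i + 1 => match w[i]? with
    | some a => .letter a
    | none => .rightEnd

/-- The initial configuration: blank work tape, both heads at the left end, empty output. -/
def init (T : Transducer α β) : T.Config where
  state := T.start
  inputPos := 0
  work := fun _ => T.blank
  workPos := 0
  out := []

/-- One step of `T` on the input `w`; the value is `none` when `T` has halted. The input head stays
between the end markers, at the positions `0` and `w.length + 1`. -/
def step (T : Transducer α β) (w : List α) (c : T.Config) : Option T.Config :=
  (T.trans c.state (readInput w c.inputPos) (c.work c.workPos)).map fun A =>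
    { state := A.next
      inputPos := min (A.inputMove.apply c.inputPos) (w.length + 1)
      work := Function.update c.work c.workPos A.write
      workPos := A.workMove.apply c.workPos
      out := c.out ++ A.emit.toList }

/-- `T` reaches the configuration `c` on the input `w`. -/
def Reaches (T : Transducer α β) (w : List α) (c : T.Config) : Prop :=
  StateTransition.Reaches (T.step w) T.init c

/-- On every input `w`, the machine `T` halts with output `f w`. -/
def Computes (T : Transducer α β) (f : List α → List β) : Prop :=
  ∀ w, ∃ c, T.Reaches w c ∧ T.step w c = none ∧ c.out = f w

/-- `T` visits only `O(log n)` cells of its work tape on inputs of length `n`. -/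
def IsLogspace (T : Transducer α β) : Prop :=
  ∃ C : ℕ, ∀ w c, T.Reaches w c → c.workPos < C * (Nat.log 2 w.length + 1)

end Transducer

/-- The word function `f` is computed by a deterministic logspace transducer. -/
def LogspaceComputable {α β : Type*} (f : List α → List β) : Prop :=
  ∃ T : Transducer α β, T.IsLogspace ∧ T.Computes f

/-! ### Geodesics and shortlex normal forms -/

/-- The element of the monoid `M` that a word over `Γ` represents, where the letter `a` stands for
`π a`. -/
def wordValue {Γ M : Type*} [Monoid M] (π : Γ → M) (u : List Γ) : M :=
  (u.map π).prod

/-- `u` is a geodesic for `g`: a shortest word representing `g`. -/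
def IsGeodesicWord {Γ M : Type*} [Monoid M] (π : Γ → M) (g : M) (u : List Γ) : Prop :=
  wordValue π u = g ∧ ∀ v : List Γ, wordValue π v = g → u.length ≤ v.length

/-- `u` is the shortlex normal form of `g`: the lexicographically first geodesic for `g`. -/
def IsShortlexNormalForm {Γ M : Type*} [Monoid M] [LinearOrder Γ] (π : Γ → M) (g : M)
    (u : List Γ) : Prop :=
  IsGeodesicWord π g u ∧ ∀ v : List Γ, IsGeodesicWord π g v → u ≤ v

/-- Shortlex normal forms for the letters `π : Γ → M` can be computed in logspace: some
deterministic logspace transducer maps every word `w` over `Γ` to the shortlex normal form of the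
element that `w` represents. -/
def ShortlexInLogspace {Γ M : Type*} [Monoid M] [LinearOrder Γ] (π : Γ → M) : Prop :=
  ∃ f : List Γ → List Γ, LogspaceComputable f ∧
    ∀ w : List Γ, IsShortlexNormalForm π (wordValue π w) (f w)

/-! ### Graph groups and right-angled Coxeter groups -/

/-- The relators of the graph group of `I`: the commutators of adjacent letters. -/
def graphGroupRels {S : Type*} (I : SimpleGraph S) : Set (FreeGroup S) :=
  {x | ∃ a b : S, I.Adj a b ∧
    x = FreeGroup.of a * FreeGroup.of b * (FreeGroup.of a)⁻¹ * (FreeGroup.of b)⁻¹}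

/-- The graph group (right-angled Artin group) `G(S, I)`: generators `S`, and relations `ab = ba`
for all edges `ab` of `I`. -/
abbrev GraphGroup {S : Type*} (I : SimpleGraph S) : Type _ :=
  PresentedGroup (graphGroupRels I)

/-- The meaning in the graph group of the letters of the doubled alphabet: `(a, true)` stands for
the generator `a`, and `(a, false)` for its inverse. -/
def GraphGroup.letter {S : Type*} (I : SimpleGraph S) (x : S × Bool) : GraphGroup I :=
  if x.2 then PresentedGroup.of x.1 else (PresentedGroup.of x.1)⁻¹

/-- A Coxeter matrix is right-angled if its entries are `0` (which stands for `∞`), `1` and `2`. -/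
def CoxeterMatrix.IsRightAngled {S : Type*} (M : CoxeterMatrix S) : Prop :=
  ∀ a b : S, M a b = 0 ∨ M a b = 1 ∨ M a b = 2

/-! Call a word reduced if no letter can be moved, through letters that commute with it, until it
meets its inverse. The difficulty is that cancelling letter by letter stores a whole reduced word.
Instead, it is decided for each input position separately, with counters only, whether its letter
survives the reduction.

The tool is an action on integer vectors indexed by the letters. Firing `b` negates the entry at `b`
and adds twice this entry to the entries at the letters that do not commute with `b`; this is the
numbers game of the right-angled Coxeter group. In a graph group the letter `c` acts by firing its
inverse and then `c`, which realizes the graph group inside the Coxeter group on the doubled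
alphabet. If a reduced word acts on the constant vector `-1`, the positive entries mark exactly the
letters that can be moved to its front (`Reduced.front_iff`). So the group element determines these
letters, reduced words are the geodesics, and always taking the least front letter yields the
shortlex normal form (`Faithful.isShortlexNormalForm`).

The step from `g` to `c * g` crosses a hyperplane. It is recorded by the pair of `c` and its inverse
together with the cosets of the two end points modulo the subgroup generated by the letters that
commute with `c`. A coset becomes the vector `g⁻¹ (linkVec c)`, because the reduced words that fix
`linkVec c` are those whose letters all commute with `c` (`Reduced.comm_of_linkVec`). A new letter
cancels exactly when its hyperplane has already been crossed, so reduction toggles hyperplanes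
(`crossings_reduce`). Hence a position survives if and only if it is the first one on its hyperplane
and the number of later ones is even (`foldr_toggle_range'`).

The vectors have entries of absolute value at most `9 ^ n`, too long to be stored, but they can be
compared modulo all small `m`: a number below `2 ^ t` divisible by every `m` from `2` to `2 * t` is
divisible by the central binomial coefficient of `t`, which is at least `2 ^ t`, so it is zero.
Residues fit into counters (`logPred_cosetVec_eq`).

For the output, one threshold per letter records what has been used, since equal letters never
overtake each other (`remainingWord_erase`). All of this is written as register programs with
polynomially bounded registers, which compile to transducers that keep the registers in binary on
tracks of the work tape (`logspaceComputable_of_run`). -/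

/-! ### Register programs -/

/-- The tests of register programs: equality of two registers, and a property of the symbol under
the input head. -/
inductive RegTest (Γ : Type*) where
  | eq (r r' : ℕ)
  | read (φ : InputSymbol Γ → Bool)

/-- Register programs with a two-way input head; registers hold natural numbers. -/
inductive RegProg (Γ : Type*) where
  | inc (r : ℕ)
  | clear (r : ℕ)
  | emit (a : Γ)
  | move (m : HeadMove)
  | seq (p q : RegProg Γ)
  | ite (t : RegTest Γ) (p q : RegProg Γ)
  | untilLoop (t : RegTest Γ) (p : RegProg Γ)

/-- The states of register programs. -/
structure RegState (Γ : Type*) where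
  reg : ℕ → ℕ
  head : ℕ
  out : List Γ

section RegisterPrograms

variable {Γ : Type*}

/-- The value of a test in a state. -/
def RegTest.eval (w : List Γ) (x : RegState Γ) : RegTest Γ → Bool
  | .eq r r' => decide (x.reg r = x.reg r')
  | .read φ => φ (Transducer.readInput w x.head)

/-- All registers of the test are below `K`. -/
def RegTest.Below (K : ℕ) : RegTest Γ → Prop
  | .eq r r' => r < K ∧ r' < K
  | .read _ => True

namespace RegProg

/-- All registers of the program are below `K`. -/
def Below (K : ℕ) : RegProg Γ → Prop
  | .inc r => r < K
  | .clear r => r < K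
  | .emit _ => True
  | .move _ => True
  | .seq p q => p.Below K ∧ q.Below K
  | .ite t p q => t.Below K ∧ p.Below K ∧ q.Below K
  | .untilLoop t p => t.Below K ∧ p.Below K

theorem _root_.RegTest.Below.mono {K K' : ℕ} (h : K ≤ K') {t : RegTest Γ} (ht : t.Below K) :
    t.Below K' := by
  cases t with
  | eq r r' => exact ⟨ht.1.trans_le h, ht.2.trans_le h⟩
  | read φ => trivial

theorem Below.mono {K K' : ℕ} (h : K ≤ K') {p : RegProg Γ} (hp : p.Below K) : p.Below K' := by
  induction p with
  | inc r => exact lt_of_lt_of_le hp h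
  | clear r => exact lt_of_lt_of_le hp h
  | emit a => trivial
  | move m => trivial
  | seq p q ihp ihq => exact ⟨ihp hp.1, ihq hp.2⟩
  | ite t p q ihp ihq => exact ⟨hp.1.mono h, ihp hp.2.1, ihq hp.2.2⟩
  | untilLoop t p ih => exact ⟨hp.1.mono h, ih hp.2⟩

theorem _root_.RegTest.exists_below (t : RegTest Γ) : ∃ K, t.Below K := by
  cases t with
  | eq r r' => exact ⟨max r r' + 1, by simp only [RegTest.Below]; omega⟩
  | read φ => exact ⟨0, trivial⟩

theorem exists_below (p : RegProg Γ) : ∃ K, p.Below K := by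
  induction p with
  | inc r => exact ⟨r + 1, Nat.lt_succ_self r⟩
  | clear r => exact ⟨r + 1, Nat.lt_succ_self r⟩
  | emit a => exact ⟨0, trivial⟩
  | move m => exact ⟨0, trivial⟩
  | seq p q ihp ihq =>
    obtain ⟨K, hK⟩ := ihp
    obtain ⟨K', hK'⟩ := ihq
    exact ⟨max K K', hK.mono (le_max_left _ _), hK'.mono (le_max_right _ _)⟩
  | ite t p q ihp ihq =>
    obtain ⟨K, hK⟩ := ihp
    obtain ⟨K', hK'⟩ := ihq
    obtain ⟨L, hL⟩ := t.exists_below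
    exact ⟨max L (max K K'), hL.mono (by simp), hK.mono (by simp), hK'.mono (by simp)⟩
  | untilLoop t p ih =>
    obtain ⟨K, hK⟩ := ih
    obtain ⟨L, hL⟩ := t.exists_below
    exact ⟨max L K, hL.mono (by simp), hK.mono (by simp)⟩

/-- The big-step semantics on the input `w`, for runs in which all registers stay at most `B`. -/
inductive Run (w : List Γ) (B : ℕ) : RegProg Γ → RegState Γ → RegState Γ → Prop
  | inc (r : ℕ) (x : RegState Γ) (h : x.reg r < B) :
      Run w B (.inc r) x { x with reg := Function.update x.reg r (x.reg r + 1) }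
  | clear (r : ℕ) (x : RegState Γ) :
      Run w B (.clear r) x { x with reg := Function.update x.reg r 0 }
  | emit (a : Γ) (x : RegState Γ) : Run w B (.emit a) x { x with out := x.out ++ [a] }
  | move (m : HeadMove) (x : RegState Γ) :
      Run w B (.move m) x { x with head := min (m.apply x.head) (w.length + 1) }
  | seq {p q : RegProg Γ} {x y z : RegState Γ} (hp : Run w B p x y) (hq : Run w B q y z) :
      Run w B (.seq p q) x z
  | ite_true {t : RegTest Γ} {p q : RegProg Γ} {x y : RegState Γ} (ht : t.eval w x = true)
      (hp : Run w B p x y) : Run w B (.ite t p q) x y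
  | ite_false {t : RegTest Γ} {p q : RegProg Γ} {x y : RegState Γ} (ht : t.eval w x = false)
      (hq : Run w B q x y) : Run w B (.ite t p q) x y
  | until_true {t : RegTest Γ} {p : RegProg Γ} {x : RegState Γ} (ht : t.eval w x = true) :
      Run w B (.untilLoop t p) x x
  | until_false {t : RegTest Γ} {p : RegProg Γ} {x y z : RegState Γ} (ht : t.eval w x = false)
      (hp : Run w B p x y) (hq : Run w B (.untilLoop t p) y z) : Run w B (.untilLoop t p) x z

/-- The bound is built into the rule for `inc`, so the mere existence of a run bounds every value it
computes; `LogFunDeg.le` relies on this. -/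
theorem Run.reg_le {w : List Γ} {B : ℕ} {p : RegProg Γ} {x y : RegState Γ} (h : Run w B p x y)
    (hx : ∀ r, x.reg r ≤ B) : ∀ r, y.reg r ≤ B := by
  induction h with
  | inc r x h =>
    intro r'
    rcases eq_or_ne r' r with rfl | hr
    · simpa using h
    · simpa [hr] using hx r'
  | clear r x =>
    intro r'
    rcases eq_or_ne r' r with rfl | hr
    · simp
    · simpa [hr] using hx r'
  | emit a x => exact hx
  | move m x => exact hx
  | seq _ _ ihp ihq => exact ihq (ihp hx)
  | ite_true _ _ ih => exact ih hx
  | ite_false _ _ ih => exact ih hx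
  | until_true _ => exact hx
  | until_false _ _ _ ihp ihq => exact ihq (ihp hx)

end RegProg

end RegisterPrograms

/-! ### Fragments of transducers -/

/-- The cells of a work tape with `K` binary tracks; the flag marks the leftmost cell. -/
abbrev TrackCell (K : ℕ) : Type := Bool × (Fin K → Option Bool)

/-- A fragment of a transducer, which is left with a truth value. -/
structure MachineFragment (Γ : Type*) (K : ℕ) where
  State : Type
  finite_state : Finite State
  start : State
  trans : State → InputSymbol Γ → TrackCell K → TransducerAction (State ⊕ Bool) (TrackCell K) Γ

/-- The data on which fragments operate: the position of the input head, the work tape with the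
position of its head, and the output. -/
@[ext] structure TapeData (Γ : Type*) (K : ℕ) where
  inputPos : ℕ
  work : ℕ → TrackCell K
  workPos : ℕ
  out : List Γ

/-- Changing the successor state of an action. -/
def TransducerAction.mapNext {σ τ W : Type} {β : Type*} (f : σ → τ) (A : TransducerAction σ W β) :
    TransducerAction τ W β :=
  ⟨f A.next, A.inputMove, A.write, A.workMove, A.emit⟩

section Fragments

variable {Γ : Type*} {K : ℕ}

/-- The effect of an action on the data. -/
def TapeData.apply {σ : Type} (w : List Γ) (x : TapeData Γ K)
    (A : TransducerAction σ (TrackCell K) Γ) : TapeData Γ K where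
  inputPos := min (A.inputMove.apply x.inputPos) (w.length + 1)
  work := Function.update x.work x.workPos A.write
  workPos := A.workMove.apply x.workPos
  out := x.out ++ A.emit.toList

namespace MachineFragment

/-- The action of `F` in the state `q` on the data `x`. -/
def action (F : MachineFragment Γ K) (w : List Γ) (q : F.State) (x : TapeData Γ K) :
    TransducerAction (F.State ⊕ Bool) (TrackCell K) Γ :=
  F.trans q (Transducer.readInput w x.inputPos) (x.work x.workPos)

/-- Runs of fragments up to their exit, with the work head at positions at most `D`. -/
inductive Exec (F : MachineFragment Γ K) (w : List Γ) (D : ℕ) :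
    F.State ⊕ Bool → TapeData Γ K → Bool → TapeData Γ K → Prop
  | done (b : Bool) (x : TapeData Γ K) : Exec F w D (.inr b) x b x
  | step {q : F.State} {x : TapeData Γ K} {b : Bool} {y : TapeData Γ K} (hx : x.workPos ≤ D)
      (h : Exec F w D (F.action w q x).next (x.apply w (F.action w q x)) b y) :
      Exec F w D (.inl q) x b y

/-- The common principle behind branching and loops: `F` sits inside `G` along `e`, its exits are
redirected by `k`, and a run of `F` is continued by a run of `G`. -/
theorem Exec.embed {F G : MachineFragment Γ K} {w : List Γ} {D : ℕ} (e : F.State → G.State)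
    (k : Bool → G.State ⊕ Bool)
    (h : ∀ q s c, G.trans (e q) s c = (F.trans q s c).mapNext (Sum.elim (Sum.inl ∘ e) k))
    {p : F.State ⊕ Bool} {x y z : TapeData Γ K} {b b' : Bool} (hF : F.Exec w D p x b y)
    (hG : G.Exec w D (k b) y b' z) : G.Exec w D (Sum.elim (Sum.inl ∘ e) k p) x b' z := by
  induction hF with
  | done b x => exact hG
  | step hx _ ih =>
    refine .step hx ?_
    simp only [action, h]
    exact ih hG

/-- Run `F`, and then `G` or `H`. -/
def ite (F G H : MachineFragment Γ K) : MachineFragment Γ K where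
  State := F.State ⊕ (G.State ⊕ H.State)
  finite_state := by
    have := F.finite_state
    have := G.finite_state
    have := H.finite_state
    infer_instance
  start := .inl F.start
  trans
    | .inl q, s, c => (F.trans q s c).mapNext (Sum.elim (Sum.inl ∘ Sum.inl)
        fun b => .inl (.inr (bif b then .inl G.start else .inr H.start)))
    | .inr (.inl q), s, c =>
        (G.trans q s c).mapNext (Sum.elim (Sum.inl ∘ fun q => .inr (.inl q)) Sum.inr)
    | .inr (.inr q), s, c =>
        (H.trans q s c).mapNext (Sum.elim (Sum.inl ∘ fun q => .inr (.inr q)) Sum.inr)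

theorem exec_ite_true {F G H : MachineFragment Γ K} {w : List Γ} {D : ℕ} {x y z : TapeData Γ K}
    {b : Bool} (hF : F.Exec w D (.inl F.start) x true y)
    (hG : G.Exec w D (.inl G.start) y b z) :
    (ite F G H).Exec w D (.inl (ite F G H).start) x b z :=
  hF.embed (G := ite F G H) Sum.inl _ (fun _ _ _ => rfl)
    (hG.embed (G := ite F G H) (fun q => .inr (.inl q)) Sum.inr (fun _ _ _ => rfl) (.done b z))

theorem exec_ite_false {F G H : MachineFragment Γ K} {w : List Γ} {D : ℕ} {x y z : TapeData Γ K}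
    {b : Bool} (hF : F.Exec w D (.inl F.start) x false y)
    (hH : H.Exec w D (.inl H.start) y b z) :
    (ite F G H).Exec w D (.inl (ite F G H).start) x b z :=
  hF.embed (G := ite F G H) Sum.inl _ (fun _ _ _ => rfl)
    (hH.embed (G := ite F G H) (fun q => .inr (.inr q)) Sum.inr (fun _ _ _ => rfl) (.done b z))

/-- Run `G` until `F` gives `true`. -/
def untilLoop (F G : MachineFragment Γ K) : MachineFragment Γ K where
  State := F.State ⊕ G.State
  finite_state := by
    have := F.finite_state
    have := G.finite_state
    infer_instance
  start := .inl F.start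
  trans
    | .inl q, s, c => (F.trans q s c).mapNext (Sum.elim (Sum.inl ∘ Sum.inl)
        fun b => bif b then .inr true else .inl (.inr G.start))
    | .inr q, s, c => (G.trans q s c).mapNext (Sum.elim (Sum.inl ∘ Sum.inr)
        fun _ => .inl (.inl F.start))

theorem exec_untilLoop_true {F G : MachineFragment Γ K} {w : List Γ} {D : ℕ}
    {x y : TapeData Γ K} (hF : F.Exec w D (.inl F.start) x true y) :
    (untilLoop F G).Exec w D (.inl (untilLoop F G).start) x true y :=
  hF.embed (G := untilLoop F G) Sum.inl _ (fun _ _ _ => rfl) (.done true y)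

theorem exec_untilLoop_false {F G : MachineFragment Γ K} {w : List Γ} {D : ℕ}
    {x y z z' : TapeData Γ K} {b b' : Bool} (hF : F.Exec w D (.inl F.start) x false y)
    (hG : G.Exec w D (.inl G.start) y b z)
    (h : (untilLoop F G).Exec w D (.inl (untilLoop F G).start) z b' z') :
    (untilLoop F G).Exec w D (.inl (untilLoop F G).start) x b' z' :=
  hF.embed (G := untilLoop F G) Sum.inl _ (fun _ _ _ => rfl)
    (hG.embed (G := untilLoop F G) Sum.inr _ (fun _ _ _ => rfl) h)

/-! #### Elementary fragments -/

/-- The action that moves the work head to the leftmost cell and leaves the fragment there. -/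
def returnAction {σ : Type} (q : σ) (b : Bool) (c : TrackCell K) :
    TransducerAction (σ ⊕ Bool) (TrackCell K) Γ :=
  bif c.1 then ⟨.inr b, .stay, c, .stay, none⟩ else ⟨.inl q, .stay, c, .left, none⟩

theorem exec_return {F : MachineFragment Γ K} {w : List Γ} {D : ℕ} {q : F.State} {b : Bool}
    (h : ∀ s c, F.trans q s c = returnAction q b c) {i : ℕ} {t : ℕ → TrackCell K}
    (ht : ∀ j, (t j).1 = decide (j = 0)) {p : ℕ} (hp : p ≤ D) (hi : i ≤ w.length + 1)
    (o : List Γ) : F.Exec w D (.inl q) ⟨i, t, p, o⟩ b ⟨i, t, 0, o⟩ := by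
  induction p with
  | zero =>
    have h0 := ht 0
    refine .step hp ?_
    simp only [action, h, returnAction, h0, decide_true, cond_true, TapeData.apply,
      HeadMove.apply, Function.update_eq_self, Option.toList_none, List.append_nil, min_eq_left hi]
    exact .done b _
  | succ p ih =>
    have h0 := ht (p + 1)
    refine .step hp ?_
    simp only [action, h, returnAction, h0, Nat.add_eq_zero_iff, one_ne_zero, and_false,
      decide_false, cond_false, TapeData.apply,
      HeadMove.apply, Function.update_eq_self, Option.toList_none, List.append_nil, min_eq_left hi,
      Nat.add_sub_cancel]
    exact ih (by omega)

/-- The work tape `t` with the content of the track `r` replaced by `g`. -/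
def setTrack (r : Fin K) (g : ℕ → Option Bool) (t : ℕ → TrackCell K) (j : ℕ) : TrackCell K :=
  ((t j).1, Function.update (t j).2 r (g j))

theorem setTrack_update (r : Fin K) (g : ℕ → Option Bool) (t : ℕ → TrackCell K) (i : ℕ)
    (v : Option Bool) :
    Function.update (setTrack r g t) i
      ((setTrack r g t i).1, Function.update (setTrack r g t i).2 r v) =
      setTrack r (Function.update g i v) t := by
  funext j
  rcases eq_or_ne j i with rfl | h
  · simp [setTrack]
  · simp [setTrack, h]

theorem setTrack_snd (r : Fin K) (g : ℕ → Option Bool) (t : ℕ → TrackCell K) (i : ℕ) :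
    (setTrack r g t i).2 r = g i := by
  simp [setTrack]

/-- Binary increment on the track `r`. -/
def incr (r : Fin K) : MachineFragment Γ K where
  State := Bool
  finite_state := inferInstance
  start := true
  trans
    | true, _, c => match c.2 r with
      | some true => ⟨.inl true, .stay, (c.1, Function.update c.2 r (some false)), .right, none⟩
      | _ => ⟨.inl false, .stay, (c.1, Function.update c.2 r (some true)), .stay, none⟩
    | false, _, c => returnAction false true c

/-- The binary expansion, least significant bit first, of the successor. -/
def incBits : List Bool → List Bool
  | [] => [true]
  | false :: l => true :: l
  | true :: l => false :: incBits l

theorem incBits_bits (n : ℕ) : incBits n.bits = (n + 1).bits := by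
  induction n using Nat.binaryRec' with
  | zero => simp [incBits]
  | bit b n h ih =>
    rw [Nat.bits_append_bit n b h]
    cases b with
    | false =>
      have : Nat.bit false n + 1 = Nat.bit true n := by simp [Nat.bit_val]
      rw [this, Nat.bits_append_bit n true (by simp)]
      rfl
    | true =>
      have : Nat.bit true n + 1 = Nat.bit false (n + 1) := by simp [Nat.bit_val]; ring
      rw [this, Nat.bits_append_bit (n + 1) false (by simp)]
      simp [incBits, ih]

theorem update_getElem?_append (pre l : List Bool) (b : Bool) :
    Function.update (fun j => (pre ++ l)[j]?) pre.length (some b) =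
      fun j => (pre ++ b :: l.tail)[j]? := by
  funext j
  rcases lt_trichotomy j pre.length with h | rfl | h
  · simp [h.ne, List.getElem?_append_left h]
  · simp
  · rw [Function.update_of_ne h.ne', List.getElem?_append_right h.le,
      List.getElem?_append_right h.le]
    obtain ⟨k, hk⟩ : ∃ k, j - pre.length = k + 1 := ⟨j - pre.length - 1, by omega⟩
    simp [hk]

/-- The carry has passed the digits `pre` and the head stands on the first digit of `l`; the
induction is on the digits that remain. -/
theorem exec_incr_carry {r : Fin K} {w : List Γ} {D i : ℕ} {t : ℕ → TrackCell K}
    (ht : ∀ j, (t j).1 = decide (j = 0)) (hi : i ≤ w.length + 1) (o : List Γ)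
    (l pre : List Bool) (hD : pre.length + l.length ≤ D) :
    (incr r).Exec w D (.inl true) ⟨i, setTrack r (fun j => (pre ++ l)[j]?) t, pre.length, o⟩ true
      ⟨i, setTrack r (fun j => (pre ++ incBits l)[j]?) t, 0, o⟩ := by
  have ht' : ∀ g : ℕ → Option Bool, ∀ j, (setTrack r g t j).1 = decide (j = 0) := fun g j => ht j
  induction l generalizing pre with
  | nil =>
    refine .step (by simpa using hD) ?_
    simp only [action, incr, setTrack_snd, List.append_nil, List.getElem?_length, TapeData.apply,
      HeadMove.apply, Option.toList_none, min_eq_left hi]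
    rw [setTrack_update]
    have := update_getElem?_append pre [] true
    simp only [List.append_nil, List.tail_nil] at this
    rw [this]
    exact exec_return (F := incr r) (fun _ _ => rfl) (ht' _) (by simpa using hD) hi o
  | cons b l ih =>
    refine .step (by simp at hD ⊢; omega) ?_
    cases b with
    | false =>
      simp only [action, incr, setTrack_snd, TapeData.apply, List.getElem?_append_right le_rfl,
        Nat.sub_self, List.getElem?_cons_zero,
        HeadMove.apply, Option.toList_none, min_eq_left hi, List.append_nil]
      rw [setTrack_update, update_getElem?_append pre (false :: l) true]
      exact exec_return (F := incr r) (fun _ _ => rfl) (ht' _) (by simp at hD ⊢; omega) hi o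
    | true =>
      simp only [action, incr, setTrack_snd, TapeData.apply, List.getElem?_append_right le_rfl,
        Nat.sub_self, List.getElem?_cons_zero,
        HeadMove.apply, Option.toList_none, min_eq_left hi, List.append_nil]
      rw [setTrack_update, update_getElem?_append pre (true :: l) false]
      have := ih (pre ++ [false]) (by simp at hD ⊢; omega)
      simp only [List.append_assoc, List.singleton_append, List.length_append,
        List.length_singleton] at this
      exact this

/-- Erasing the track `r`. -/
def clear (r : Fin K) : MachineFragment Γ K where
  State := Bool
  finite_state := inferInstance
  start := true
  trans
    | true, _, c => match c.2 r with
      | some _ => ⟨.inl true, .stay, (c.1, Function.update c.2 r none), .right, none⟩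
      | none => ⟨.inl false, .stay, c, .stay, none⟩
    | false, _, c => returnAction false true c

/-- Erasing stops at the first blank cell, which suffices because the digits occupy an initial
segment of the track. Below `p` everything is blank already. -/
theorem exec_clear_scan {r : Fin K} {w : List Γ} {D i : ℕ} {t : ℕ → TrackCell K}
    (ht : ∀ j, (t j).1 = decide (j = 0)) (hi : i ≤ w.length + 1) (o : List Γ)
    (l : List Bool) (p : ℕ) (hD : p + l.length ≤ D) :
    (clear r).Exec w D (.inl true)
      ⟨i, setTrack r (fun j => if j < p then none else l[j - p]?) t, p, o⟩ true
      ⟨i, setTrack r (fun _ => none) t, 0, o⟩ := by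
  have ht' : ∀ g : ℕ → Option Bool, ∀ j, (setTrack r g t j).1 = decide (j = 0) := fun g j => ht j
  induction l generalizing p with
  | nil =>
    refine .step (by simpa using hD) ?_
    simp only [action, clear, setTrack_snd, List.getElem?_nil, TapeData.apply, ite_self,
      HeadMove.apply, Option.toList_none, min_eq_left hi, Function.update_eq_self, List.append_nil]
    exact exec_return (F := clear r) (fun _ _ => rfl) (ht' _) (by simpa using hD) hi o
  | cons b l ih =>
    refine .step (by simp at hD ⊢; omega) ?_
    simp only [action, clear, setTrack_snd, TapeData.apply, lt_irrefl, if_false,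
      Nat.sub_self, List.getElem?_cons_zero,
      HeadMove.apply, Option.toList_none, min_eq_left hi, List.append_nil]
    rw [setTrack_update]
    have : Function.update (fun j => if j < p then none else (b :: l)[j - p]?) p none =
        fun j => if j < p + 1 then none else l[j - (p + 1)]? := by
      funext j
      rcases lt_trichotomy j p with h | rfl | h
      · simp [h.ne, h, Nat.lt_succ_of_lt h]
      · simp
      · obtain ⟨k, rfl⟩ : ∃ k, j = p + 1 + k := ⟨j - (p + 1), by omega⟩
        have e : p + 1 + k - p = k + 1 := by omega
        rw [Function.update_of_ne h.ne', if_neg (by omega), if_neg (by omega), e]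
        simp
    rw [this]
    exact ih (p + 1) (by simp at hD ⊢; omega)

/-- Comparing the tracks `r` and `r'`. -/
def compare (r r' : Fin K) : MachineFragment Γ K where
  State := Option Bool
  finite_state := inferInstance
  start := none
  trans
    | none, _, c =>
      if c.2 r = c.2 r' then
        match c.2 r with
        | none => ⟨.inl (some true), .stay, c, .stay, none⟩
        | some _ => ⟨.inl none, .stay, c, .right, none⟩
      else ⟨.inl (some false), .stay, c, .stay, none⟩
    | some b, _, c => returnAction (some b) b c

/-- The scan ends at the first difference or at a common end, so the length of one of the two
numbers already bounds the head. -/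
theorem exec_compare_scan {r r' : Fin K} {w : List Γ} {D i : ℕ} {t : ℕ → TrackCell K}
    (ht : ∀ j, (t j).1 = decide (j = 0)) (hi : i ≤ w.length + 1) (o : List Γ)
    (l l' : List Bool) (p : ℕ) (hl : ∀ j, (t (p + j)).2 r = l[j]?)
    (hl' : ∀ j, (t (p + j)).2 r' = l'[j]?) (hD : p + l.length ≤ D) :
    (compare r r').Exec w D (.inl none) ⟨i, t, p, o⟩ (decide (l = l')) ⟨i, t, 0, o⟩ := by
  induction l generalizing l' p with
  | nil =>
    have h0 := hl 0
    have h0' := hl' 0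
    simp only [add_zero] at h0 h0'
    refine .step (by simpa using hD) ?_
    cases l' with
    | nil =>
      simp only [action, compare, TapeData.apply, h0, h0', List.getElem?_nil, if_true, decide_true,
        HeadMove.apply, Option.toList_none, min_eq_left hi, Function.update_eq_self,
        List.append_nil]
      exact exec_return (F := compare r r') (fun _ _ => rfl) ht (by simpa using hD) hi o
    | cons b' l' =>
      simp only [action, compare, TapeData.apply, h0, h0', List.getElem?_nil,
        List.getElem?_cons_zero, reduceCtorEq, if_false, decide_false,
        HeadMove.apply, Option.toList_none, min_eq_left hi, Function.update_eq_self,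
        List.append_nil]
      exact exec_return (F := compare r r') (fun _ _ => rfl) ht (by simpa using hD) hi o
  | cons b l ih =>
    have h0 := hl 0
    have h0' := hl' 0
    simp only [add_zero] at h0 h0'
    refine .step (by simp at hD ⊢; omega) ?_
    cases l' with
    | nil =>
      simp only [action, compare, TapeData.apply, h0, h0', List.getElem?_nil,
        List.getElem?_cons_zero, reduceCtorEq, if_false, decide_false,
        HeadMove.apply, Option.toList_none, min_eq_left hi, Function.update_eq_self,
        List.append_nil]
      exact exec_return (F := compare r r') (fun _ _ => rfl) ht (by simp at hD ⊢; omega) hi o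
    | cons b' l' =>
      by_cases hb : b = b'
      · subst hb
        simp only [action, compare, TapeData.apply, h0, h0',
          List.getElem?_cons_zero, if_true, List.cons.injEq, true_and,
          HeadMove.apply, Option.toList_none, min_eq_left hi, Function.update_eq_self,
          List.append_nil]
        refine ih l' (p + 1) (fun j => ?_) (fun j => ?_) (by simp at hD ⊢; omega)
        · rw [add_right_comm, add_assoc, hl (j + 1)]; simp
        · rw [add_right_comm, add_assoc, hl' (j + 1)]; simp
      · simp only [action, compare, TapeData.apply, h0, h0', hb, Option.some.injEq,
          List.getElem?_cons_zero, if_false, List.cons.injEq, false_and, decide_false,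
          HeadMove.apply, Option.toList_none, min_eq_left hi, Function.update_eq_self,
          List.append_nil]
        exact exec_return (F := compare r r') (fun _ _ => rfl) ht (by simp at hD ⊢; omega) hi o

/-- A single step that moves the input head and appends to the output. -/
def single (m : HeadMove) (e : Option Γ) (φ : InputSymbol Γ → Bool) : MachineFragment Γ K where
  State := Unit
  finite_state := inferInstance
  start := ()
  trans _ s c := ⟨.inr (φ s), m, c, .stay, e⟩

theorem exec_single (m : HeadMove) (e : Option Γ) (φ : InputSymbol Γ → Bool) {w : List Γ} {D : ℕ}
    (x : TapeData Γ K) (hx : x.workPos ≤ D) :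
    (single m e φ).Exec w D (.inl ()) x (φ (Transducer.readInput w x.inputPos))
      { x with inputPos := min (m.apply x.inputPos) (w.length + 1), out := x.out ++ e.toList } := by
  refine .step hx ?_
  simp only [action, single, TapeData.apply, Function.update_eq_self, HeadMove.apply]
  exact .done _ _

end MachineFragment

end Fragments

/-! ### Compilation of register programs -/

section Compilation

variable {Γ : Type*}

/-- The data that represent the state `x`: the registers stand in binary on the tracks. -/
def RegState.encode (K : ℕ) (x : RegState Γ) : TapeData Γ K where
  inputPos := x.head
  work i := (decide (i = 0), fun r => (x.reg r).bits[i]?)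
  workPos := 0
  out := x.out

open MachineFragment in
/-- The fragment for a test. -/
def RegTest.compile (K : ℕ) : RegTest Γ → MachineFragment Γ (K + 1)
  | .eq r r' => compare (Fin.ofNat (K + 1) r) (Fin.ofNat (K + 1) r')
  | .read φ => single .stay none φ

open MachineFragment in
/-- The fragment for a register program. -/
def RegProg.compile (K : ℕ) : RegProg Γ → MachineFragment Γ (K + 1)
  | .inc r => incr (Fin.ofNat (K + 1) r)
  | .clear r => MachineFragment.clear (Fin.ofNat (K + 1) r)
  | .emit a => single .stay (some a) fun _ => true
  | .move m => single m none fun _ => true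
  | .seq p q => MachineFragment.ite (p.compile K) (q.compile K) (q.compile K)
  | .ite t p q => MachineFragment.ite (t.compile K) (p.compile K) (q.compile K)
  | .untilLoop t p => MachineFragment.untilLoop (t.compile K) (p.compile K)

theorem RegState.encode_update_reg {K r : ℕ} (hr : r < K + 1) (x : RegState Γ) (v : ℕ) :
    RegState.encode (K + 1) { x with reg := Function.update x.reg r v } =
      { x.encode (K + 1) with
        work := MachineFragment.setTrack (Fin.ofNat (K + 1) r) (fun j => v.bits[j]?)
          (x.encode (K + 1)).work } := by
  -- `Fin.ofNat` reduces modulo `K + 1`; the bound on `r` excludes that two registers share a track.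
  have e : Fin.ofNat (K + 1) r = ⟨r, hr⟩ := Fin.ext (Nat.mod_eq_of_lt hr)
  ext : 1
  · rfl
  · funext j
    refine Prod.ext rfl (funext fun i => ?_)
    simp only [RegState.encode, MachineFragment.setTrack, e]
    rcases eq_or_ne i ⟨r, hr⟩ with rfl | h
    · simp
    · have : (i : ℕ) ≠ r := fun h' => h (Fin.ext h')
      simp [h, this]
  · rfl
  · rfl

theorem RegState.setTrack_encode {K r : ℕ} (hr : r < K + 1) (x : RegState Γ) :
    MachineFragment.setTrack (Fin.ofNat (K + 1) r) (fun j => (x.reg r).bits[j]?)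
      (x.encode (K + 1)).work = (x.encode (K + 1)).work := by
  have := x.encode_update_reg hr (x.reg r)
  rw [Function.update_eq_self] at this
  exact (congrArg TapeData.work this).symm

theorem length_bits_le {v B : ℕ} (h : v ≤ B) : v.bits.length ≤ B.size := by
  rw [Nat.size_eq_bits_len]
  exact Nat.size_le_size h

theorem bits_injective {m n : ℕ} (h : m.bits = n.bits) : m = n := by
  apply Nat.eq_of_testBit_eq
  intro i
  rw [Nat.testBit_eq_inth, Nat.testBit_eq_inth, h]

theorem RegTest.exec_compile {K : ℕ} {w : List Γ} {B : ℕ} {t : RegTest Γ} (ht : t.Below (K + 1))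
    {x : RegState Γ} (hx : ∀ r, x.reg r ≤ B) (hi : x.head ≤ w.length + 1) :
    (t.compile K).Exec w B.size (.inl (t.compile K).start) (x.encode (K + 1)) (t.eval w x)
      (x.encode (K + 1)) := by
  cases t with
  | eq r r' =>
    have e : ∀ {r}, r < K + 1 → (Fin.ofNat (K + 1) r : ℕ) = r := fun h => Nat.mod_eq_of_lt h
    have := MachineFragment.exec_compare_scan (r := Fin.ofNat (K + 1) r)
      (r' := Fin.ofNat (K + 1) r') (w := w) (D := B.size) (t := (x.encode (K + 1)).work)
      (fun _ => rfl) hi x.out (x.reg r).bits (x.reg r').bits 0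
      (fun j => by simp only [RegState.encode, e ht.1, zero_add])
      (fun j => by simp only [RegState.encode, e ht.2, zero_add])
      (by simpa using length_bits_le (hx r))
    have h : RegTest.eval w x (.eq r r') = decide ((x.reg r).bits = (x.reg r').bits) := by
      simp only [RegTest.eval, decide_eq_decide]
      exact ⟨fun h => by rw [h], bits_injective⟩
    rw [h]
    exact this
  | read φ =>
    have := MachineFragment.exec_single (D := B.size) .stay none φ (w := w) (x.encode (K + 1))
      (Nat.zero_le _)
    simp only [HeadMove.apply, RegState.encode, min_eq_left hi, Option.toList_none,
      List.append_nil] at this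
    exact this

theorem RegProg.Run.head_le {w : List Γ} {B : ℕ} {p : RegProg Γ} {x y : RegState Γ}
    (h : Run w B p x y) (hx : x.head ≤ w.length + 1) : y.head ≤ w.length + 1 := by
  induction h with
  | inc r x h => exact hx
  | clear r x => exact hx
  | emit a x => exact hx
  | move m x => exact min_le_right _ _
  | seq _ _ ihp ihq => exact ihq (ihp hx)
  | ite_true _ _ ih => exact ih hx
  | ite_false _ _ ih => exact ih hx
  | until_true _ => exact hx
  | until_false _ _ _ ihp ihq => exact ihq (ihp hx)

theorem RegProg.Run.exec_compile {K : ℕ} {w : List Γ} {B : ℕ} {p : RegProg Γ} {x y : RegState Γ}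
    (h : Run w B p x y) (hp : p.Below (K + 1)) (hx : ∀ r, x.reg r ≤ B)
    (hi : x.head ≤ w.length + 1) :
    ∃ b, (p.compile K).Exec w B.size (.inl (p.compile K).start) (x.encode (K + 1)) b
      (y.encode (K + 1)) := by
  induction h with
  | inc r x h =>
    refine ⟨true, ?_⟩
    rw [x.encode_update_reg hp, ← MachineFragment.incBits_bits]
    have := MachineFragment.exec_incr_carry (r := Fin.ofNat (K + 1) r) (w := w) (D := B.size)
      (t := (x.encode (K + 1)).work) (fun _ => rfl) hi x.out (x.reg r).bits []
      (by simpa using length_bits_le h.le)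
    simp only [List.nil_append, x.setTrack_encode hp] at this
    exact this
  | clear r x =>
    refine ⟨true, ?_⟩
    rw [x.encode_update_reg hp]
    have := MachineFragment.exec_clear_scan (r := Fin.ofNat (K + 1) r) (w := w) (D := B.size)
      (t := (x.encode (K + 1)).work) (fun _ => rfl) hi x.out (x.reg r).bits 0
      (by simpa using length_bits_le (hx r))
    simp only [not_lt_zero, if_false, Nat.sub_zero, x.setTrack_encode hp] at this
    simp only [Nat.zero_bits, List.getElem?_nil]
    exact this
  | emit a x =>
    refine ⟨true, ?_⟩
    have := MachineFragment.exec_single (D := B.size) .stay (some a) (fun _ => true) (w := w)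
      (x.encode (K + 1)) (Nat.zero_le _)
    simp only [HeadMove.apply, RegState.encode, min_eq_left hi, Option.toList_some] at this
    exact this
  | move m x =>
    refine ⟨true, ?_⟩
    have := MachineFragment.exec_single (D := B.size) m none (fun _ => true) (w := w)
      (x.encode (K + 1)) (Nat.zero_le _)
    simp only [RegState.encode, Option.toList_none, List.append_nil] at this
    exact this
  | seq h h' ihp ihq =>
    obtain ⟨b, hb⟩ := ihp hp.1 hx hi
    obtain ⟨b', hb'⟩ := ihq hp.2 (h.reg_le hx) (h.head_le hi)
    refine ⟨b', ?_⟩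
    cases b with
    | true => exact MachineFragment.exec_ite_true hb hb'
    | false => exact MachineFragment.exec_ite_false hb hb'
  | ite_true ht h ih =>
    obtain ⟨b, hb⟩ := ih hp.2.1 hx hi
    have := RegTest.exec_compile hp.1 hx hi
    rw [ht] at this
    exact ⟨b, MachineFragment.exec_ite_true this hb⟩
  | ite_false ht h ih =>
    obtain ⟨b, hb⟩ := ih hp.2.2 hx hi
    have := RegTest.exec_compile hp.1 hx hi
    rw [ht] at this
    exact ⟨b, MachineFragment.exec_ite_false this hb⟩
  | until_true ht =>
    have := RegTest.exec_compile hp.1 hx hi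
    rw [ht] at this
    exact ⟨true, MachineFragment.exec_untilLoop_true this⟩
  | until_false ht h h' ih ih' =>
    obtain ⟨b, hb⟩ := ih hp.2 hx hi
    obtain ⟨b', hb'⟩ := ih' hp (h.reg_le hx) (h.head_le hi)
    have := RegTest.exec_compile hp.1 hx hi
    rw [ht] at this
    exact ⟨b', MachineFragment.exec_untilLoop_false this hb hb'⟩

/-- The transducer that marks the leftmost cell of its work tape, runs the fragment `F`, and
halts. -/
def MachineFragment.toTransducer {K : ℕ} (F : MachineFragment Γ K) : Transducer Γ Γ where
  State := Option (F.State ⊕ Bool)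
  Work := TrackCell K
  finite_state := by
    have := F.finite_state
    infer_instance
  finite_work := inferInstance
  start := none
  blank := (false, fun _ => none)
  trans
    | none, _, _ => some ⟨some (.inl F.start), .stay, (true, fun _ => none), .stay, none⟩
    | some (.inl q), s, c => some ((F.trans q s c).mapNext some)
    | some (.inr _), _, _ => none

/-- The configuration with the given state and data. -/
def TapeData.toConfig {K : ℕ} {F : MachineFragment Γ K} (q : F.State ⊕ Bool) (x : TapeData Γ K) :
    F.toTransducer.Config :=
  ⟨some q, x.inputPos, x.work, x.workPos, x.out⟩

/-- The machine is deterministic, so every reachable configuration lies on the one run that `Exec`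
describes, and the bound along this run is a bound for all of them. -/
theorem MachineFragment.Exec.reaches {K : ℕ} {F : MachineFragment Γ K} {w : List Γ} {D : ℕ}
    {p : F.State ⊕ Bool} {x y : TapeData Γ K} {b : Bool} (h : F.Exec w D p x b y)
    (hy : y.workPos ≤ D) :
    StateTransition.Reaches (F.toTransducer.step w) (x.toConfig p) (y.toConfig (.inr b)) ∧
      ∀ c, StateTransition.Reaches (F.toTransducer.step w) (x.toConfig p) c → c.workPos ≤ D := by
  induction h with
  | done b x =>
    refine ⟨.refl, fun c hc => ?_⟩
    rcases hc.cases_head with rfl | ⟨d, hd, -⟩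
    · exact hy
    · exact absurd hd (Option.not_mem_none d)
  | @step q x b y hx h ih =>
    have hs : F.toTransducer.step w (x.toConfig (.inl q)) =
        some ((x.apply w (F.action w q x)).toConfig (F.action w q x).next) := rfl
    refine ⟨.head (by rw [hs]; rfl) (ih hy).1, fun c hc => ?_⟩
    rcases hc.cases_head with rfl | ⟨d, hd, hc⟩
    · exact hx
    · rw [hs, Option.mem_def, Option.some_inj] at hd
      subst hd
      exact (ih hy).2 c hc

/-- A polynomially bounded register has logarithmically many digits, by `n + 2 ≤ 2 ^ (log n + 2)`.
The summand `2` also covers short inputs. -/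
theorem size_pow_le (d n : ℕ) : ((n + 2) ^ d).size < (2 * d + 2) * (Nat.log 2 n + 1) := by
  have h1 : n + 2 ≤ 2 ^ (Nat.log 2 n + 2) := by
    have h := Nat.lt_pow_succ_log_self (b := 2) one_lt_two n
    have : 1 ≤ 2 ^ Nat.log 2 n := Nat.one_le_two_pow
    have e : 2 ^ (Nat.log 2 n + 2) = 2 ^ (Nat.log 2 n + 1) + 2 * 2 ^ Nat.log 2 n := by ring
    simp only [Nat.succ_eq_add_one] at h
    omega
  have h2 : (n + 2) ^ d < 2 ^ ((Nat.log 2 n + 2) * d + 1) := by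
    calc (n + 2) ^ d ≤ (2 ^ (Nat.log 2 n + 2)) ^ d := Nat.pow_le_pow_left h1 d
      _ = 2 ^ ((Nat.log 2 n + 2) * d) := (pow_mul _ _ _).symm
      _ < _ := Nat.pow_lt_pow_right one_lt_two (Nat.lt_succ_self _)
  have h3 := Nat.size_le.2 h2
  nlinarith [Nat.zero_le (Nat.log 2 n), Nat.zero_le (Nat.log 2 n * d)]

/-- A function that is computed by a register program whose registers are bounded by a polynomial
in the length of the input is logspace computable. -/
theorem logspaceComputable_of_run (f : List Γ → List Γ) (p : RegProg Γ) (d : ℕ)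
    (h : ∀ w : List Γ, ∃ y, p.Run w ((w.length + 2) ^ d) ⟨fun _ => 0, 0, []⟩ y ∧ y.out = f w) :
    LogspaceComputable f := by
  obtain ⟨K, hK⟩ := p.exists_below
  have hK := hK.mono (Nat.le_succ K)
  have key : ∀ w : List Γ, ∃ c, (p.compile K).toTransducer.Reaches w c ∧
      (p.compile K).toTransducer.step w c = none ∧ c.out = f w ∧
      ∀ c', (p.compile K).toTransducer.Reaches w c' → c'.workPos ≤ ((w.length + 2) ^ d).size := by
    intro w
    obtain ⟨y, hy, hf⟩ := h w
    obtain ⟨b, hb⟩ := hy.exec_compile hK (fun _ => Nat.zero_le _) (Nat.zero_le _)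
    obtain ⟨h1, h2⟩ := hb.reaches (Nat.zero_le _)
    have hs : (p.compile K).toTransducer.step w (p.compile K).toTransducer.init =
        some ((RegState.encode (K + 1) ⟨fun _ => 0, 0, []⟩).toConfig
          (.inl (p.compile K).start)) := by
      simp only [Transducer.step, Transducer.init, MachineFragment.toTransducer, TapeData.toConfig,
        RegState.encode, Option.map_some, HeadMove.apply, Option.toList_none, List.append_nil,
        Nat.zero_min, Nat.zero_bits, List.getElem?_nil]
      congr 2
      funext i
      rcases eq_or_ne i 0 with rfl | hi
      · simp
      · simp [hi]
    refine ⟨_, .head (by rw [hs]; rfl) h1, rfl, hf, fun c' hc' => ?_⟩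
    rcases hc'.cases_head with rfl | ⟨e, he, hc'⟩
    · exact Nat.zero_le _
    · rw [hs, Option.mem_def, Option.some_inj] at he
      subst he
      exact h2 c' hc'
  refine ⟨(p.compile K).toTransducer, ⟨2 * d + 2, fun w c hc => ?_⟩, fun w => ?_⟩
  · obtain ⟨-, -, -, -, h⟩ := key w
    exact (h c hc).trans_lt (size_pow_le d w.length)
  · obtain ⟨c, h1, h2, h3, -⟩ := key w
    exact ⟨c, h1, h2, h3⟩

end Compilation

/-! ### Number functions computed in logarithmic space -/

section NumberFunctions

variable {Γ : Type*} {P Q : Type*}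

/-- The number function `h`, which depends on the input word and on parameters, is computed by
register programs that exceed the parameters by at most `(n + 2) ^ d`. The parameters are read from
registers `p i`, the value is written to the register `t`, and the registers from `k` on are used as
scratch space. -/
def LogFunDeg (d : ℕ) (h : List Γ → (P → ℕ) → ℕ) : Prop :=
  ∀ (k : ℕ) (p : P → ℕ) (t : ℕ), (∀ i, p i < k) → t < k → (∀ i, p i ≠ t) → ∃ c : RegProg Γ,
    ∀ (w : List Γ) (B b : ℕ) (x : RegState Γ), (∀ r, x.reg r ≤ B) → (∀ i, x.reg (p i) ≤ b) →
      b + (w.length + 2) ^ d ≤ B → ∃ y, c.Run w B x y ∧ y.reg t = h w (x.reg ∘ p) ∧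
        (∀ r < k, r ≠ t → y.reg r = x.reg r) ∧ y.out = x.out

/-- The number function `h` is computed in logarithmic space. -/
def LogFun (h : List Γ → (P → ℕ) → ℕ) : Prop := ∃ d, LogFunDeg d h

open Classical in
/-- The predicate `h` on words and parameters is decided in logarithmic space. -/
def LogPred (h : List Γ → (P → ℕ) → Prop) : Prop :=
  LogFun fun w v => if h w v then 1 else 0

/-- Simultaneous computation of several number functions. -/
def LogVecDeg (d : ℕ) (h : List Γ → (P → ℕ) → Q → ℕ) : Prop :=
  ∀ (k : ℕ) (p : P → ℕ) (t : Q → ℕ), (∀ i, p i < k) → (∀ q, t q < k) → Function.Injective t →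
    (∀ i q, p i ≠ t q) → ∃ c : RegProg Γ,
    ∀ (w : List Γ) (B b : ℕ) (x : RegState Γ), (∀ r, x.reg r ≤ B) → (∀ i, x.reg (p i) ≤ b) →
      b + (w.length + 2) ^ d ≤ B → ∃ y, c.Run w B x y ∧ (∀ q, y.reg (t q) = h w (x.reg ∘ p) q) ∧
        (∀ r < k, (∀ q, r ≠ t q) → y.reg r = x.reg r) ∧ y.out = x.out

theorem length_pow_mono (w : List Γ) {d d' : ℕ} (h : d ≤ d') :
    (w.length + 2) ^ d ≤ (w.length + 2) ^ d' :=
  Nat.pow_le_pow_right (by omega) h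

theorem LogFunDeg.mono {d d' : ℕ} (hd : d ≤ d') {h : List Γ → (P → ℕ) → ℕ}
    (hh : LogFunDeg d h) : LogFunDeg d' h := by
  intro k p t hp ht hpt
  obtain ⟨c, hc⟩ := hh k p t hp ht hpt
  exact ⟨c, fun w B b x hx hb hB => hc w B b x hx hb
    ((Nat.add_le_add_left (length_pow_mono w hd) b).trans hB)⟩

/-- The program itself proves the bound, since it must run within `b + (n + 2) ^ d`. That the growth
over the parameters is additive is essential: linearly many iterations then stay polynomial, whereas
growth by a constant factor would not. -/
theorem LogFunDeg.le [Finite P] {d : ℕ} {h : List Γ → (P → ℕ) → ℕ} (hh : LogFunDeg d h)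
    (w : List Γ) {v : P → ℕ} {b : ℕ} (hv : ∀ i, v i ≤ b) : h w v ≤ b + (w.length + 2) ^ d := by
  obtain ⟨m, ⟨e⟩⟩ := Finite.exists_equiv_fin P
  obtain ⟨c, hc⟩ := hh (m + 1) (fun i => e i) m (fun i => by omega) (by omega)
    (fun i => (e i).isLt.ne)
  let x : RegState Γ := ⟨fun r => if hr : r < m then v (e.symm ⟨r, hr⟩) else 0, 0, []⟩
  have hxb : ∀ r, x.reg r ≤ b := by
    intro r
    simp only [x]
    split_ifs
    · exact hv _
    · exact Nat.zero_le _
  have hxv : (x.reg ∘ fun i => (e i : ℕ)) = v := by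
    funext i
    simp [x]
  obtain ⟨y, hy, ht, -, -⟩ := hc w (b + (w.length + 2) ^ d) b x
    (fun r => (hxb r).trans (Nat.le_add_right _ _)) (fun i => hxb _) le_rfl
  rw [hxv] at ht
  rw [← ht]
  exact hy.reg_le (fun r => (hxb r).trans (Nat.le_add_right _ _)) m

/-- The components are computed one after the other with the same scratch space. No target is a
parameter, so later components still see the original parameters. -/
theorem LogVecDeg.of_components [Finite Q] {h : List Γ → (P → ℕ) → Q → ℕ}
    (hh : ∀ q, LogFun fun w v => h w v q) :
    ∃ d, LogVecDeg d h ∧ ∀ q, LogFunDeg d fun w v => h w v q := by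
  choose d hd using hh
  obtain ⟨D, hD⟩ := (Set.finite_range d).bddAbove
  have hD : ∀ q, LogFunDeg D fun w v => h w v q := fun q => (hd q).mono (hD ⟨q, rfl⟩)
  refine ⟨D, ?_, hD⟩
  intro k p t hp ht hinj hpt
  have key : ∀ l : List Q, ∃ c : RegProg Γ,
      ∀ (w : List Γ) (B b : ℕ) (x : RegState Γ), (∀ r, x.reg r ≤ B) → (∀ i, x.reg (p i) ≤ b) →
      b + (w.length + 2) ^ D ≤ B → ∃ y, c.Run w B x y ∧
        (∀ q ∈ l, y.reg (t q) = h w (x.reg ∘ p) q) ∧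
        (∀ r < k, (∀ q, r ≠ t q) → y.reg r = x.reg r) ∧ y.out = x.out := by
    intro l
    induction l with
    | nil =>
      refine ⟨.clear k, fun w B b x _ _ _ => ⟨_, .clear k x, by simp, ?_, rfl⟩⟩
      intro r hr _
      simp [hr.ne]
    | cons q l ih =>
      obtain ⟨c, hc⟩ := ih
      obtain ⟨c', hc'⟩ := hD q k p (t q) hp (ht q) fun i => hpt i q
      refine ⟨.seq c c', fun w B b x hx hb hB => ?_⟩
      obtain ⟨y, hy, h1, h2, h3⟩ := hc w B b x hx hb hB
      have hpy : y.reg ∘ p = x.reg ∘ p := funext fun i => h2 (p i) (hp i) (hpt i)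
      obtain ⟨z, hz, g1, g2, g3⟩ := hc' w B b y (hy.reg_le hx)
        (fun i => (congrFun hpy i).trans_le (hb i)) hB
      rw [hpy] at g1
      refine ⟨z, .seq hy hz, fun q' hq' => ?_, fun r hr hrt => ?_, g3.trans h3⟩
      · by_cases e : q' = q
        · rw [e, g1]
        · rw [g2 _ (ht q') (hinj.ne e)]
          exact h1 q' ((List.mem_cons.1 hq').resolve_left e)
      · rw [g2 r hr (hrt q), h2 r hr hrt]
  have := Fintype.ofFinite Q
  obtain ⟨c, hc⟩ := key Finset.univ.toList
  refine ⟨c, fun w B b x hx hb hB => ?_⟩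
  obtain ⟨y, hy, h1, h2⟩ := hc w B b x hx hb hB
  exact ⟨y, hy, fun q => h1 q (by simp), h2⟩

/-- The loop rule for a number `N` of rounds known in advance, by induction on the number `j` of
rounds still to come; termination and correctness come together. -/
theorem RegProg.Run.untilLoop_of_inv {w : List Γ} {B : ℕ} {t : RegTest Γ} {p : RegProg Γ} (N : ℕ)
    (Inv : ℕ → RegState Γ → Prop)
    (h : ∀ i < N, ∀ x, Inv i x → t.eval w x = false ∧ ∃ y, p.Run w B x y ∧ Inv (i + 1) y)
    (hN : ∀ x, Inv N x → t.eval w x = true) (x : RegState Γ) (hx : Inv 0 x) :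
    ∃ y, (RegProg.untilLoop t p).Run w B x y ∧ Inv N y := by
  suffices H : ∀ j ≤ N, ∀ x, Inv (N - j) x → ∃ y, (RegProg.untilLoop t p).Run w B x y ∧ Inv N y from
    H N le_rfl x (by simpa using hx)
  intro j
  induction j with
  | zero => exact fun _ x hx => ⟨x, .until_true (hN x hx), hx⟩
  | succ j ih =>
    intro hj x hx
    obtain ⟨ht, y, hy, hy'⟩ := h (N - (j + 1)) (by omega) x hx
    rw [show N - (j + 1) + 1 = N - j by omega] at hy'
    obtain ⟨z, hz, hz'⟩ := ih (by omega) y hy'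
    exact ⟨z, .until_false ht hy hz, hz'⟩

/-- Copying by counting up from zero until the source is met, so no register exceeds the value that
is copied. -/
theorem LogFunDeg.proj (i : P) : LogFunDeg 0 fun (_ : List Γ) (v : P → ℕ) => v i := by
  intro k p t hp ht hpt
  refine ⟨.seq (.clear t) (.untilLoop (.eq t (p i)) (.inc t)), fun w B b x hx hb hB => ?_⟩
  obtain ⟨y, hy, hy'⟩ := RegProg.Run.untilLoop_of_inv (w := w) (B := B) (t := .eq t (p i))
    (p := .inc t) (x.reg (p i))
    (fun j y => y = { x with reg := Function.update x.reg t j })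
    (by
      rintro j hj _ rfl
      refine ⟨?_, _, .inc t _ ?_, ?_⟩
      · simpa [RegTest.eval, hpt i] using hj.ne
      · simpa using hj.trans_le (hx (p i))
      · simp)
    (by
      rintro _ rfl
      simp [RegTest.eval, hpt i]) _ rfl
  refine ⟨y, .seq (.clear t x) hy, ?_⟩
  subst hy'
  simp only [Function.update_self, Function.comp_apply, and_true, true_and]
  exact fun r _ hr => Function.update_of_ne hr _ _

theorem LogFun.proj (i : P) : LogFun fun (_ : List Γ) (v : P → ℕ) => v i :=
  ⟨0, .proj i⟩

theorem LogFun.congr {h h' : List Γ → (P → ℕ) → ℕ} (hh : LogFun h) (e : ∀ w v, h w v = h' w v) :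
    LogFun h' := by
  have : h = h' := funext fun w => funext fun v => e w v
  rwa [← this]

theorem LogPred.congr {h h' : List Γ → (P → ℕ) → Prop} (hh : LogPred h)
    (e : ∀ w v, h w v ↔ h' w v) : LogPred h' := by
  have : h = h' := funext fun w => funext fun v => propext (e w v)
  rwa [← this]

theorem LogFun.zero : LogFun fun (_ : List Γ) (_ : P → ℕ) => 0 :=
  ⟨0, fun _ _ t _ _ _ => ⟨.clear t, fun _ _ _ x _ _ _ => ⟨_, .clear t x, by simp,
    fun _ _ hr => Function.update_of_ne hr _ _, rfl⟩⟩⟩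

theorem LogFun.comp [Finite P] [Finite Q] {g : List Γ → (Q → ℕ) → ℕ}
    {h : List Γ → (P → ℕ) → Q → ℕ} (hg : LogFun g) (hh : ∀ q, LogFun fun w v => h w v q) :
    LogFun fun w v => g w (h w v) := by
  obtain ⟨d, hd, hd'⟩ := LogVecDeg.of_components hh
  obtain ⟨d', hg⟩ := hg
  obtain ⟨m, ⟨e⟩⟩ := Finite.exists_equiv_fin Q
  refine ⟨max d d' + 1, fun k p t hp ht hpt => ?_⟩
  obtain ⟨c, hc⟩ := hd (k + m) p (fun q => k + e q) (fun i => (hp i).trans_le (by omega))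
    (fun q => by omega) (fun q q' hq => e.injective (Fin.ext (by simpa using hq)))
    (fun i q => by have := hp i; omega)
  obtain ⟨c', hc'⟩ := hg (k + m) (fun q => k + e q) t (fun q => by omega) (by omega)
    (fun q => by omega)
  refine ⟨.seq c c', fun w B b x hx hb hB => ?_⟩
  have e1 := length_pow_mono w (le_max_left d d')
  have e2 := length_pow_mono w (le_max_right d d')
  -- The inner and the outer function each add at most the power with exponent `max d d'`; doubling
  -- it costs one more exponent because the base is at least `2`.
  have e3 : 2 * (w.length + 2) ^ max d d' ≤ (w.length + 2) ^ (max d d' + 1) := by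
    rw [pow_succ, mul_comm]
    exact Nat.mul_le_mul_left _ (by omega)
  obtain ⟨y, hy, h1, h2, h3⟩ := hc w B b x hx hb (by omega)
  obtain ⟨z, hz, g1, g2, g3⟩ := hc' w B (b + (w.length + 2) ^ d) y (hy.reg_le hx)
    (fun q => (h1 q).trans_le ((hd' q).le w (fun i => hb i))) (by omega)
  refine ⟨z, .seq hy hz, ?_, fun r hr hrt => ?_, g3.trans h3⟩
  · rw [g1]
    congr 1
    funext q
    exact h1 q
  · rw [g2 r (by omega) hrt, h2 r (by omega) fun q => by omega]

theorem LogFun.succ [Finite P] {h : List Γ → (P → ℕ) → ℕ} (hh : LogFun h) :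
    LogFun fun w v => h w v + 1 := by
  have : LogFun fun (_ : List Γ) (v : Unit → ℕ) => v () + 1 := by
    refine ⟨0, fun k p t hp ht hpt => ?_⟩
    obtain ⟨c, hc⟩ := LogFunDeg.proj (Γ := Γ) () k p t hp ht hpt
    refine ⟨.seq c (.inc t), fun w B b x hx hb hB => ?_⟩
    obtain ⟨y, hy, h1, h2, h3⟩ := hc w B b x hx hb hB
    refine ⟨_, .seq hy (.inc t y ?_), ?_, fun r hr hrt => ?_, h3⟩
    · have := hb ()
      simp only [h1, Function.comp_apply]
      simp only [pow_zero] at hB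
      omega
    · simp [h1]
    · simpa [hrt] using h2 r hr hrt
  exact this.comp (h := fun w v _ => h w v) fun _ => hh

theorem LogFun.ite [Finite P] {q : List Γ → (P → ℕ) → Prop} {f g : List Γ → (P → ℕ) → ℕ}
    [∀ w v, Decidable (q w v)] (hq : LogPred q) (hf : LogFun f) (hg : LogFun g) :
    LogFun fun w v => if q w v then f w v else g w v := by
  obtain ⟨d1, hq⟩ := hq
  obtain ⟨d2, hf⟩ := hf
  obtain ⟨d3, hg⟩ := hg
  have hq := hq.mono (d' := max d1 (max d2 d3)) (by simp)
  have hf := hf.mono (d' := max d1 (max d2 d3)) (by simp)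
  have hg := hg.mono (d' := max d1 (max d2 d3)) (by simp)
  refine ⟨max d1 (max d2 d3), fun k p t hp ht hpt => ?_⟩
  obtain ⟨c1, hc1⟩ := hq (k + 1) p k (fun i => (hp i).trans (by omega)) (by omega)
    (fun i => (hp i).ne)
  obtain ⟨c2, hc2⟩ := hf k p t hp ht hpt
  obtain ⟨c3, hc3⟩ := hg k p t hp ht hpt
  -- Register `k` holds the truth value and `k + 1` holds zero, so equality of the two selects the
  -- negative branch.
  refine ⟨.seq c1 (.seq (.clear (k + 1)) (.ite (.eq k (k + 1)) c3 c2)),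
    fun w B b x hx hb hB => ?_⟩
  obtain ⟨y, hy, h1, h2, h3⟩ := hc1 w B b x hx hb hB
  set y' : RegState Γ := { y with reg := Function.update y.reg (k + 1) 0 } with hy'
  have hr' : ∀ r < k, y'.reg r = x.reg r := by
    intro r hr
    have : r ≠ k + 1 := by omega
    simp only [hy', Function.update_of_ne this]
    exact h2 r (by omega) hr.ne
  have hp' : y'.reg ∘ p = x.reg ∘ p := funext fun i => hr' _ (hp i)
  have hxy' : ∀ r, y'.reg r ≤ B := (RegProg.Run.clear (w := w) (k + 1) y).reg_le (hy.reg_le hx)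
  have hev : RegTest.eval w y' (.eq k (k + 1)) = decide (¬ q w (x.reg ∘ p)) := by
    simp only [RegTest.eval, hy', Function.update_self, h1,
      Function.update_of_ne (show k ≠ k + 1 by omega)]
    by_cases hq : q w (x.reg ∘ p) <;> simp [hq]
  by_cases hqx : q w (x.reg ∘ p)
  · obtain ⟨z, hz, g1, g2, g3⟩ := hc2 w B b y' hxy' (fun i => (hr' _ (hp i)).trans_le (hb i)) hB
    refine ⟨z, .seq hy (.seq (.clear _ _) (.ite_false (hev.trans (by simp [hqx])) hz)), ?_,
      fun r hr hrt => (g2 r hr hrt).trans (hr' r hr), g3.trans h3⟩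
    rw [g1, hp']
    exact (if_pos hqx).symm
  · obtain ⟨z, hz, g1, g2, g3⟩ := hc3 w B b y' hxy' (fun i => (hr' _ (hp i)).trans_le (hb i)) hB
    refine ⟨z, .seq hy (.seq (.clear _ _) (.ite_true (hev.trans (by simp [hqx])) hz)), ?_,
      fun r hr hrt => (g2 r hr hrt).trans (hr' r hr), g3.trans h3⟩
    rw [g1, hp']
    exact (if_neg hqx).symm

theorem LogFun.one [Finite P] : LogFun fun (_ : List Γ) (_ : P → ℕ) => 1 :=
  LogFun.zero.succ

theorem LogPred.comp [Finite P] [Finite Q] {g : List Γ → (Q → ℕ) → Prop}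
    {h : List Γ → (P → ℕ) → Q → ℕ} (hg : LogPred g) (hh : ∀ q, LogFun fun w v => h w v q) :
    LogPred fun w v => g w (h w v) :=
  LogFun.comp hg hh

theorem LogPred.const [Finite P] (c : Prop) : LogPred fun (_ : List Γ) (_ : P → ℕ) => c := by
  by_cases h : c
  · simpa [LogPred, h] using LogFun.one
  · simpa [LogPred, h] using LogFun.zero

theorem LogPred.not [Finite P] {q : List Γ → (P → ℕ) → Prop} (hq : LogPred q) :
    LogPred fun w v => ¬ q w v := by
  classical
  refine (LogFun.ite hq LogFun.zero LogFun.one).congr fun w v => ?_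
  by_cases h : q w v <;> simp [h]

theorem LogPred.and [Finite P] {q q' : List Γ → (P → ℕ) → Prop} (hq : LogPred q)
    (hq' : LogPred q') : LogPred fun w v => q w v ∧ q' w v := by
  classical
  refine (LogFun.ite hq hq' LogFun.zero).congr fun w v => ?_
  by_cases h : q w v <;> simp [h]

theorem LogPred.or [Finite P] {q q' : List Γ → (P → ℕ) → Prop} (hq : LogPred q)
    (hq' : LogPred q') : LogPred fun w v => q w v ∨ q' w v := by
  classical
  refine (LogFun.ite hq LogFun.one hq').congr fun w v => ?_
  by_cases h : q w v <;> simp [h]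

end NumberFunctions

/-! ### Equality of numbers and access to the input -/

section NumberFunctions

variable {Γ : Type*} {P Q : Type*}

theorem LogPred.eq_params (i j : P) : LogPred fun (_ : List Γ) (v : P → ℕ) => v i = v j := by
  classical
  refine ⟨0, fun k p t hp ht hpt => ?_⟩
  refine ⟨.seq (.clear t) (.ite (.eq (p i) (p j)) (.inc t) (.clear k)), fun w B b x hx hb hB => ?_⟩
  simp only [pow_zero] at hB
  by_cases h : x.reg (p i) = x.reg (p j)
  · refine ⟨_, .seq (.clear t x) (.ite_true ?_ (.inc t _ ?_)), ?_, fun r hr hrt => ?_, rfl⟩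
    · simp [RegTest.eval, hpt, h]
    · simp; omega
    · simp [h]
    · simp [hrt]
  · refine ⟨_, .seq (.clear t x) (.ite_false ?_ (.clear k _)), ?_, fun r hr hrt => ?_, rfl⟩
    · simp [RegTest.eval, hpt, h]
    · simp [h, ht.ne]
    · simp [hrt, hr.ne]

theorem LogPred.eq [Finite P] {f g : List Γ → (P → ℕ) → ℕ} (hf : LogFun f) (hg : LogFun g) :
    LogPred fun w v => f w v = g w v :=
  (LogPred.eq_params (Γ := Γ) false true).comp (h := fun w v b => bif b then g w v else f w v)
    fun b => by cases b <;> assumption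

/-- Recognition of the left end marker. -/
def InputSymbol.isLeftEnd : InputSymbol Γ → Bool
  | .leftEnd => true
  | _ => false

theorem Transducer.readInput_min (w : List Γ) (j : ℕ) :
    readInput w (min (j + 1) (w.length + 1)) = readInput w (j + 1) := by
  rcases le_total j w.length with h | h
  · rw [min_eq_left (by omega)]
  · rw [min_eq_right (by omega)]
    simp [readInput, List.getElem?_eq_none h]

/-- Strong induction is used because the state is arbitrary: from a position beyond the right end
marker the clamped move may jump over many cells. -/
theorem RegProg.run_rewind (w : List Γ) (B h : ℕ) (x : RegState Γ) (hx : x.head = h) :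
    (RegProg.untilLoop (.read InputSymbol.isLeftEnd) (.move .left)).Run w B x
      { x with head := 0 } := by
  induction h using Nat.strong_induction_on generalizing x with
  | _ h ih =>
    obtain ⟨reg, head, out⟩ := x
    simp only at hx
    subst hx
    cases head with
    | zero => exact .until_true rfl
    | succ h =>
      refine .until_false ?_ (.move _ _) (ih _ (?_ : min h (w.length + 1) < h + 1) _ rfl)
      · simp only [RegTest.eval, Transducer.readInput]
        cases w[h]? <;> rfl
      · omega

/-- The head position is not part of the specification of number functions, so each access rewinds
to the left end marker and counts forward. Counting past the end is harmless by `readInput_min`. -/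
theorem LogPred.read_param (φ : InputSymbol Γ → Bool) (i : P) :
    LogPred fun (w : List Γ) (v : P → ℕ) => φ (Transducer.readInput w (v i + 1)) = true := by
  classical
  refine ⟨0, fun k p t hp ht hpt => ?_⟩
  let rewind : RegProg Γ := .untilLoop (.read InputSymbol.isLeftEnd) (.move .left)
  let advance : RegProg Γ := .untilLoop (.eq k (p i)) (.seq (.move .right) (.inc k))
  refine ⟨.seq rewind (.seq (.move .right) (.seq (.clear k) (.seq advance
    (.seq (.clear t) (.ite (.read φ) (.inc t) (.clear k)))))), fun w B b x hx hb hB => ?_⟩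
  simp only [pow_zero] at hB
  have hpk : ∀ i, p i ≠ k := fun i => (hp i).ne
  obtain ⟨x1, h1, e1⟩ := RegProg.Run.untilLoop_of_inv (w := w) (B := B)
    (t := .eq k (p i)) (p := .seq (.move .right) (.inc k)) (x.reg (p i))
    (fun j y => y = ⟨Function.update x.reg k j, min (j + 1) (w.length + 1), x.out⟩)
    (by
      rintro j hj _ rfl
      refine ⟨?_, _, .seq (.move _ _) (.inc k _ ?_), ?_⟩
      · simpa [RegTest.eval, hpk i] using hj.ne
      · simpa using hj.trans_le (hx (p i))
      · simp only [Function.update_idem, Function.update_self, HeadMove.apply]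
        congr 1
        omega)
    (by
      rintro _ rfl
      simp [RegTest.eval, hpk i]) ⟨Function.update x.reg k 0, min 1 (w.length + 1), x.out⟩ rfl
  have hread : Transducer.readInput w x1.head = Transducer.readInput w (x.reg (p i) + 1) := by
    rw [e1]
    exact Transducer.readInput_min w _
  have hrun : ∀ y, (RegProg.ite (.read φ) (.inc t) (.clear k)).Run w B
      { x1 with reg := Function.update x1.reg t 0 } y → (RegProg.seq rewind (.seq (.move .right)
        (.seq (.clear k) (.seq advance (.seq (.clear t)
          (.ite (.read φ) (.inc t) (.clear k))))))).Run w B x y := fun y hy =>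
    .seq (RegProg.run_rewind w B _ x rfl) (.seq (.move _ _) (.seq (.clear k _) (.seq
      (by simpa [HeadMove.apply] using h1) (.seq (.clear t _) hy))))
  have hreg : x1.reg = Function.update x.reg k (x.reg (p i)) := by rw [e1]
  have hout : x1.out = x.out := by rw [e1]
  by_cases hφ : φ (Transducer.readInput w (x.reg (p i) + 1)) = true
  · refine ⟨_, hrun _ (.ite_true ?_ (.inc t _ ?_)), ?_, fun r hr hrt => ?_, hout⟩
    · simpa only [RegTest.eval, hread] using hφ
    · simp; omega
    · simp [hφ]
    · simp [hrt, hr.ne, hreg]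
  · refine ⟨_, hrun _ (.ite_false ?_ (.clear k _)), ?_, fun r hr hrt => ?_, hout⟩
    · simpa only [RegTest.eval, hread, Bool.not_eq_true] using hφ
    · simp [hφ, ht.ne]
    · simp [hrt, hr.ne, hreg]

theorem LogPred.letter [Finite P] {f : List Γ → (P → ℕ) → ℕ} (hf : LogFun f) (a : Γ) :
    LogPred fun w v => w[f w v]? = some a := by
  classical
  let φ : InputSymbol Γ → Bool
    | .letter b => decide (b = a)
    | _ => false
  refine ((LogPred.read_param φ ()).comp (h := fun w v _ => f w v) fun _ => hf).congr
    fun w v => ?_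
  simp only [Transducer.readInput]
  cases w[f w v]? <;> simp [φ]

theorem LogPred.lt_length [Finite P] {f : List Γ → (P → ℕ) → ℕ} (hf : LogFun f) :
    LogPred fun w v => f w v < w.length := by
  let φ : InputSymbol Γ → Bool
    | .letter _ => true
    | _ => false
  refine ((LogPred.read_param φ ()).comp (h := fun w v _ => f w v) fun _ => hf).congr
    fun w v => ?_
  rcases lt_or_ge (f w v) w.length with h | h
  · simp [Transducer.readInput, h, φ]
  · simp [Transducer.readInput, φ, h]

end NumberFunctions

/-! ### Iteration and output -/

section NumberFunctions

variable {Γ : Type*} {P Q : Type*}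

/-- The successive states of an iteration with the parameters `v`. -/
def iterState (init : List Γ → (P → ℕ) → Q → ℕ) (step : List Γ → (P ⊕ Q → ℕ) → Q → ℕ)
    (w : List Γ) (v : P → ℕ) (t : ℕ) : Q → ℕ :=
  (fun s => step w (Sum.elim v s))^[t] (init w v)

theorem iterState_succ (init : List Γ → (P → ℕ) → Q → ℕ) (step : List Γ → (P ⊕ Q → ℕ) → Q → ℕ)
    (w : List Γ) (v : P → ℕ) (t : ℕ) :
    iterState init step w v (t + 1) = step w (Sum.elim v (iterState init step w v t)) :=
  Function.iterate_succ_apply' _ _ _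

open Classical in
/-- The program that emits those letters of a list that satisfy a predicate. -/
theorem exists_emit_filter {em : Γ → List Γ → (P → ℕ) → Prop} (l : List Γ)
    (hem : ∀ a, LogPred (em a)) : ∃ d, ∀ (k : ℕ) (p : P → ℕ) (u z : ℕ), (∀ i, p i < k) → u < k →
      z < k → (∀ i, p i ≠ u) → z ≠ u → ∃ c : RegProg Γ,
      ∀ (w : List Γ) (B b : ℕ) (x : RegState Γ), (∀ r, x.reg r ≤ B) → (∀ i, x.reg (p i) ≤ b) →
        b + (w.length + 2) ^ d ≤ B → x.reg z = 0 → ∃ y, c.Run w B x y ∧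
          (∀ r < k, r ≠ u → y.reg r = x.reg r) ∧
          y.out = x.out ++ l.filter fun a => em a w (x.reg ∘ p) := by
  induction l with
  | nil =>
    exact ⟨0, fun k p u z _ _ _ _ _ => ⟨.clear k, fun w B b x _ _ _ _ => ⟨_, .clear k x,
      fun r hr _ => Function.update_of_ne hr.ne _ _, by simp⟩⟩⟩
  | cons a l ih =>
    obtain ⟨d, ih⟩ := ih
    obtain ⟨d', ha⟩ := hem a
    have ha := ha.mono (le_max_right d d')
    refine ⟨max d d', fun k p u z hp hu hz hpu hzu => ?_⟩
    obtain ⟨c, hc⟩ := ih k p u z hp hu hz hpu hzu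
    obtain ⟨c', hc'⟩ := ha k p u hp hu hpu
    refine ⟨.seq c' (.seq (.ite (.eq u z) (.clear k) (.emit a)) c),
      fun w B b x hx hb hB hxz => ?_⟩
    have hd := length_pow_mono w (le_max_left d d')
    obtain ⟨y, hy, h1, h2, h3⟩ := hc' w B b x hx hb hB
    have hyz : y.reg z = 0 := (h2 z hz hzu).trans hxz
    obtain ⟨y', hy', h1', h2'⟩ : ∃ y', (RegProg.ite (.eq u z) (.clear k) (.emit a)).Run w B y y' ∧
        (∀ r < k, y'.reg r = y.reg r) ∧
        y'.out = y.out ++ if em a w (x.reg ∘ p) then [a] else [] := by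
      by_cases he : em a w (x.reg ∘ p)
      · exact ⟨_, .ite_false (by simp [RegTest.eval, h1, hyz, he]) (.emit a y), fun _ _ => rfl,
          by simp [he]⟩
      · exact ⟨_, .ite_true (by simp [RegTest.eval, h1, hyz, he]) (.clear k y),
          fun r hr => Function.update_of_ne hr.ne _ _, by simp [he]⟩
    have hpy : y'.reg ∘ p = x.reg ∘ p :=
      funext fun i => (h1' _ (hp i)).trans (h2 _ (hp i) (hpu i))
    obtain ⟨y'', hy'', h1'', h2''⟩ := hc w B b y' (hy'.reg_le (hy.reg_le hx))
      (fun i => (congrFun hpy i).trans_le (hb i)) (by omega) ((h1' z hz).trans hyz)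
    refine ⟨y'', .seq hy (.seq hy' hy''), fun r hr hru => ?_, ?_⟩
    · rw [h1'' r hr hru, h1' r hr, h2 r hr hru]
    · rw [h2'', h2', h3, hpy, List.append_assoc, List.filter_cons]
      by_cases he : em a w (x.reg ∘ p) <;> simp [he]

open Classical in
/-- The program that runs through an iteration, once for each letter of the input, and emits
letters on its way. -/
theorem exists_loop [Finite P] [Finite Q] {init : List Γ → (P → ℕ) → Q → ℕ}
    {step : List Γ → (P ⊕ Q → ℕ) → Q → ℕ} {em : Γ → List Γ → (P ⊕ Q → ℕ) → Prop} (l : List Γ)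
    (hinit : ∀ q, LogFun fun w v => init w v q) (hstep : ∀ q, LogFun fun w v => step w v q)
    (hem : ∀ a, LogPred (em a)) : ∃ d, ∀ (k : ℕ) (p : P → ℕ), (∀ i, p i < k) →
      ∃ (K : ℕ) (cur : Q → ℕ) (c : RegProg Γ), k ≤ K ∧ (∀ q, cur q < K) ∧ (∀ q, k ≤ cur q) ∧
      ∀ (w : List Γ) (B b : ℕ) (x : RegState Γ), (∀ r, x.reg r ≤ B) → (∀ i, x.reg (p i) ≤ b) →
        b + (w.length + 2) ^ d ≤ B → ∃ y, c.Run w B x y ∧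
          (∀ r < k, y.reg r = x.reg r) ∧
          (∀ q, y.reg (cur q) = iterState init step w (x.reg ∘ p) w.length q) ∧
          (∀ q, y.reg (cur q) + 1 ≤ b + (w.length + 2) ^ d) ∧
          y.out = x.out ++ (List.range w.length).flatMap fun t => l.filter fun a =>
            em a w (Sum.elim (x.reg ∘ p) (iterState init step w (x.reg ∘ p) t)) := by
  obtain ⟨d1, hi, hi'⟩ := LogVecDeg.of_components hinit
  obtain ⟨d2, hs, hs'⟩ := LogVecDeg.of_components hstep
  obtain ⟨d3, hcopy, -⟩ := LogVecDeg.of_components (Γ := Γ) (h := fun _ (v : Q → ℕ) q => v q)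
    fun q => LogFun.proj q
  obtain ⟨d4, hlen⟩ := LogPred.lt_length (Γ := Γ) (LogFun.proj ())
  obtain ⟨d5, hemit⟩ := exists_emit_filter l hem
  obtain ⟨m, ⟨e⟩⟩ := Finite.exists_equiv_fin Q
  obtain ⟨D, hD1, hD2, hD3, hD4, hD5⟩ : ∃ D, d1 ≤ D ∧ d2 ≤ D ∧ d3 ≤ D ∧ d4 ≤ D ∧ d5 ≤ D :=
    ⟨d1 + d2 + d3 + d4 + d5, by omega, by omega, by omega, by omega, by omega⟩
  refine ⟨D + 2, fun k p hp => ?_⟩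
  set K := k + 2 * m + 3 with hK
  set cur : Q → ℕ := fun q => k + e q with hcur
  set new : Q → ℕ := fun q => k + m + e q with hnew
  set cnt := k + 2 * m with hcnt
  set u := k + 2 * m + 1 with hu
  set z := k + 2 * m + 2 with hz
  have hcurK : ∀ q, cur q < k + m := fun q => by simp only [hcur]; omega
  have hnewK : ∀ q, k + m ≤ new q ∧ new q < k + 2 * m := fun q => by simp only [hnew]; omega
  have hcur_inj : Function.Injective cur := fun q q' h =>
    e.injective (Fin.ext (by simpa [hcur] using h))
  have hnew_inj : Function.Injective new := fun q q' h =>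
    e.injective (Fin.ext (by simpa [hnew] using h))
  have hpc : ∀ i, Sum.elim p cur i < k + m := by
    rintro (i | q)
    · exact (hp i).trans_le (by omega)
    · exact hcurK q
  obtain ⟨c1, hc1⟩ := hi K p cur (fun i => (hp i).trans_le (by omega))
    (fun q => (hcurK q).trans_le (by omega)) hcur_inj
    (fun i q => by have := hp i; simp only [hcur]; omega)
  obtain ⟨c2, hc2⟩ := hs K (Sum.elim p cur) new (fun i => (hpc i).trans_le (by omega))
    (fun q => (hnewK q).2.trans_le (by omega)) hnew_inj
    (fun i q => ((hpc i).trans_le (hnewK q).1).ne)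
  obtain ⟨c3, hc3⟩ := hcopy K new cur (fun q => (hnewK q).2.trans_le (by omega))
    (fun q => (hcurK q).trans_le (by omega)) hcur_inj
    (fun q q' => ((hcurK q').trans_le (hnewK q).1).ne')
  obtain ⟨c4, hc4⟩ := hlen K (fun _ => cnt) u (fun _ => by omega) (by omega) (fun _ => by omega)
  obtain ⟨c5, hc5⟩ := hemit K (Sum.elim p cur) u z (fun i => (hpc i).trans_le (by omega))
    (by omega) (by omega) (fun i => by have := hpc i; omega) (by omega)
  refine ⟨K, cur, .seq c1 (.seq (.clear cnt) (.seq (.clear z) (.seq c4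
    (.untilLoop (.eq u z) (.seq c5 (.seq c2 (.seq c3 (.seq (.inc cnt) c4)))))))), by omega,
    fun q => (hcurK q).trans_le (by omega), fun q => Nat.le_add_right _ _,
    fun w B b x hx hb hB => ?_⟩
  set v := x.reg ∘ p with hv
  set N := (w.length + 2) ^ D with hN
  have hN1 : (w.length + 2) ^ d1 ≤ N := length_pow_mono w hD1
  have hN2 : (w.length + 2) ^ d2 ≤ N := length_pow_mono w hD2
  have hN3 : (w.length + 2) ^ d3 ≤ N := length_pow_mono w hD3
  have hN4 : (w.length + 2) ^ d4 ≤ N := length_pow_mono w hD4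
  have hN5 : (w.length + 2) ^ d5 ≤ N := length_pow_mono w hD5
  have hN0 : 1 ≤ N := Nat.one_le_pow _ _ (by omega)
  -- Initialization and each of the `n` rounds raise the values by at most `N`; the remaining
  -- multiples of `N` are working space for a step and for copying its result, and the linear term
  -- serves the counter and the spare unit in the bound.
  have hNB : b + (w.length + 3) * N + w.length + 1 ≤ b + (w.length + 2) ^ (D + 2) := by
    rw [pow_add, ← hN]
    have e : N * (w.length + 2) ^ 2 =
        (w.length + 3) * N + (w.length + 1) * N + (w.length ^ 2 + 2 * w.length) * N := by ring
    have := Nat.le_mul_of_pos_right (w.length + 1) hN0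
    omega
  have hNB' : b + (w.length + 3) * N + w.length + 1 ≤ B := hNB.trans hB
  have hmulN : ∀ t ≤ w.length + 3, t * N ≤ (w.length + 3) * N := fun t ht => Nat.mul_le_mul_right N ht
  -- the values in the iteration
  have hval : ∀ t ≤ w.length, ∀ q, iterState init step w v t q ≤ b + (t + 1) * N := by
    intro t
    induction t with
    | zero =>
      intro _ q
      have := (hi' q).le w hb
      simp only [iterState, Function.iterate_zero, id]
      simp only [zero_add, one_mul]
      exact this.trans (by omega)
    | succ t ih =>
      intro ht q
      rw [iterState_succ]
      have := (hs' q).le w (v := Sum.elim v (iterState init step w v t)) (b := b + (t + 1) * N) (by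
        rintro (i | q)
        · exact (hb i).trans (Nat.le_add_right _ _)
        · exact ih (by omega) q)
      have e : (t + 1 + 1) * N = (t + 1) * N + N := by ring
      omega
  -- the length test
  have hlt : ∀ y : RegState Γ, (∀ r, y.reg r ≤ B) → y.reg cnt ≤ w.length → ∃ y', c4.Run w B y y' ∧
      y'.reg u = (if y.reg cnt < w.length then 1 else 0) ∧ (∀ r < K, r ≠ u → y'.reg r = y.reg r) ∧
      y'.out = y.out := by
    intro y hy hyc
    obtain ⟨y', h1, h2, h3, h4⟩ := hc4 w B w.length y hy (fun _ => hyc) (by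
      have := hmulN 1 (by omega)
      omega)
    exact ⟨y', h1, by convert h2; rfl, h3, h4⟩
  let Inv : ℕ → RegState Γ → Prop := fun t y => (∀ r, y.reg r ≤ B) ∧ (∀ r < k, y.reg r = x.reg r) ∧
    (∀ q, y.reg (cur q) = iterState init step w v t q) ∧ y.reg cnt = t ∧ y.reg z = 0 ∧
    y.reg u = (if t < w.length then 1 else 0) ∧
    y.out = x.out ++ (List.range t).flatMap fun t => l.filter fun a =>
      em a w (Sum.elim v (iterState init step w v t))
  have hbody : ∀ t < w.length, ∀ y, Inv t y → (RegTest.eq u z).eval w y = false ∧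
      ∃ y', (RegProg.seq c5 (.seq c2 (.seq c3 (.seq (.inc cnt) c4)))).Run w B y y' ∧
        Inv (t + 1) y' := by
    rintro t ht y ⟨hyB, hyk, hyq, hyc, hyz, hyu, hyo⟩
    refine ⟨by simp [RegTest.eval, hyu, hyz, ht], ?_⟩
    have hpar : y.reg ∘ Sum.elim p cur = Sum.elim v (iterState init step w v t) := by
      funext i
      rcases i with i | q
      · exact hyk _ (hp i)
      · exact hyq q
    have hparb : ∀ i, y.reg (Sum.elim p cur i) ≤ b + (t + 1) * N := by
      rintro (i | q)
      · exact (congrFun hpar (.inl i)).trans_le ((hb i).trans (Nat.le_add_right _ _))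
      · exact (congrFun hpar (.inr q)).trans_le (hval t ht.le q)
    have hroom : b + (t + 1) * N + N ≤ B := by
      have := hmulN (t + 2) (by omega)
      have e : (t + 2) * N = (t + 1) * N + N := by ring
      omega
    obtain ⟨y1, r1, a1, o1⟩ := hc5 w B (b + (t + 1) * N) y hyB hparb (by omega) hyz
    have hpar1 : y1.reg ∘ Sum.elim p cur = Sum.elim v (iterState init step w v t) := by
      rw [← hpar]
      exact funext fun i => a1 _ ((hpc i).trans_le (by omega)) (by have := hpc i; omega)
    obtain ⟨y2, r2, n2, a2, o2⟩ := hc2 w B (b + (t + 1) * N) y1 (r1.reg_le hyB)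
      (fun i => (congrFun (hpar1.trans hpar.symm) i).trans_le (hparb i)) (by omega)
    have hnew2 : ∀ q, y2.reg (new q) = iterState init step w v (t + 1) q := by
      intro q
      rw [n2, hpar1, iterState_succ]
    obtain ⟨y3, r3, n3, a3, o3⟩ := hc3 w B (b + (t + 2) * N) y2 (r2.reg_le (r1.reg_le hyB))
      (fun q => (hnew2 q).trans_le (hval (t + 1) ht q)) (by
        have := hmulN (t + 3) (by omega)
        have e : (t + 3) * N = (t + 2) * N + N := by ring
        omega)
    have hcnt3 : y3.reg cnt = t := by
      rw [a3 cnt (by omega) (fun q => by have := hcurK q; omega),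
        a2 cnt (by omega) (fun q => by have := hnewK q; omega), a1 cnt (by omega) (by omega), hyc]
    have r4 : (RegProg.inc cnt).Run w B y3 _ := .inc cnt y3 (by rw [hcnt3]; omega)
    have hB4 := r4.reg_le (r3.reg_le (r2.reg_le (r1.reg_le hyB)))
    obtain ⟨y5, r5, n5, a5, o5⟩ := hlt _ hB4 (by simp [hcnt3]; omega)
    simp only [Function.update_self, hcnt3] at n5
    refine ⟨y5, .seq r1 (.seq r2 (.seq r3 (.seq r4 r5))), r5.reg_le hB4, fun r hr => ?_,
      fun q => ?_, ?_, ?_, n5, ?_⟩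
    · rw [a5 r (by omega) (by omega)]
      simp only [Function.update_of_ne (show r ≠ cnt by omega)]
      rw [a3 r (by omega) (fun q => by simp only [hcur]; omega),
        a2 r (by omega) (fun q => by have := hnewK q; omega), a1 r (by omega) (by omega), hyk r hr]
    · have := hcurK q
      rw [a5 _ (by omega) (by omega)]
      simp only [Function.update_of_ne (show cur q ≠ cnt by omega)]
      rw [n3]
      exact hnew2 q
    · rw [a5 _ (by omega) (by omega)]
      simp [hcnt3]
    · rw [a5 _ (by omega) (by omega)]
      simp only [Function.update_of_ne (show z ≠ cnt by omega)]
      rw [a3 z (by omega) (fun q => by have := hcurK q; omega),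
        a2 z (by omega) (fun q => by have := hnewK q; omega), a1 z (by omega) (by omega), hyz]
    · rw [o5, o3, o2, o1, hyo, hpar, List.range_succ, List.flatMap_append, List.append_assoc]
      simp
  obtain ⟨x1, r1, n1, a1, o1⟩ := hc1 w B b x hx hb (by have := hmulN 1 (by omega); omega)
  have r2 : (RegProg.clear cnt).Run w B x1 _ := .clear cnt x1
  have r3 := RegProg.Run.clear (w := w) (B := B) z
    { x1 with reg := Function.update x1.reg cnt 0 }
  have hB3 := r3.reg_le (r2.reg_le (r1.reg_le hx))
  obtain ⟨x4, r4, n4, a4, o4⟩ := hlt _ hB3 (by simp [show cnt ≠ z by omega])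
  simp only [Function.update_of_ne (show cnt ≠ z by omega), Function.update_self] at n4
  have hinv0 : Inv 0 x4 := by
    refine ⟨r4.reg_le hB3, fun r hr => ?_, fun q => ?_, ?_, ?_, n4, ?_⟩
    · rw [a4 r (by omega) (by omega)]
      simp only [Function.update_of_ne (show r ≠ z by omega),
        Function.update_of_ne (show r ≠ cnt by omega)]
      exact a1 r (by omega) (fun q => by simp only [hcur]; omega)
    · have := hcurK q
      rw [a4 _ (by omega) (by omega)]
      simp only [Function.update_of_ne (show cur q ≠ z by omega),
        Function.update_of_ne (show cur q ≠ cnt by omega)]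
      exact n1 q
    · rw [a4 _ (by omega) (by omega)]
      simp [show cnt ≠ z by omega]
    · rw [a4 _ (by omega) (by omega)]
      simp
    · simp [o4, o1]
  obtain ⟨y, ry, -, hyk, hyq, -, -, -, hyo⟩ := RegProg.Run.untilLoop_of_inv (w := w) (B := B) w.length
    Inv hbody (by
      rintro y ⟨-, -, -, -, hyz, hyu, -⟩
      simp [RegTest.eval, hyz, hyu]) x4 hinv0
  refine ⟨y, .seq r1 (.seq r2 (.seq r3 (.seq r4 ry))), hyk, hyq, fun q => ?_, hyo⟩
  rw [hyq]
  have h1 := hval w.length le_rfl q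
  have h2 := hmulN (w.length + 1) (by omega)
  omega

theorem LogFun.iterate [Finite P] [Finite Q] {init : List Γ → (P → ℕ) → Q → ℕ}
    {step : List Γ → (P ⊕ Q → ℕ) → Q → ℕ} (hinit : ∀ q, LogFun fun w v => init w v q)
    (hstep : ∀ q, LogFun fun w v => step w v q) (q : Q) :
    LogFun fun w v => iterState init step w v w.length q := by
  obtain ⟨d, hd⟩ := exists_loop (em := fun _ _ _ => False) [] hinit hstep
    (fun _ => LogPred.const False)
  refine ⟨d + 1, fun k p t hp ht hpt => ?_⟩
  obtain ⟨K, cur, c, hkK, hcurK, hkcur, hc⟩ := hd k p hp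
  obtain ⟨c', hc'⟩ := LogFunDeg.proj (Γ := Γ) q K cur t hcurK (by omega)
    (fun q => by have := hkcur q; omega)
  refine ⟨.seq c c', fun w B b x hx hb hB => ?_⟩
  have hpow : (w.length + 2) ^ d ≤ (w.length + 2) ^ (d + 1) := length_pow_mono w (Nat.le_succ d)
  obtain ⟨y, hy, h1, h2, h3, h4⟩ := hc w B b x hx hb (by omega)
  obtain ⟨z, hz, g1, g2, g3⟩ := hc' w B (b + (w.length + 2) ^ d - 1) y (hy.reg_le hx)
    (fun q => by have := h3 q; omega) (by
      have : 1 ≤ (w.length + 2) ^ d := Nat.one_le_pow _ _ (by omega)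
      simp only [pow_zero]
      omega)
  refine ⟨z, .seq hy hz, ?_, fun r hr hrt => ?_, ?_⟩
  · rw [g1]
    exact h2 q
  · rw [g2 r (by omega) hrt, h1 r hr]
  · rw [g3, h4]
    simp

theorem iterate_linear_aux (init : List Γ → (P → ℕ) → Q → ℕ)
    (step : List Γ → (P ⊕ Q → ℕ) → Q → ℕ) (w : List Γ) (v : P → ℕ) (s t : ℕ) :
    iterState (fun w v => iterState init step w v s) step w v t =
      iterState init step w v (t + s) :=
  (Function.iterate_add_apply _ t s _).symm

/-- A linear number of iterations. -/
theorem LogFun.iterate_linear [Finite P] [Finite Q] {init : List Γ → (P → ℕ) → Q → ℕ}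
    {step : List Γ → (P ⊕ Q → ℕ) → Q → ℕ} (hinit : ∀ q, LogFun fun w v => init w v q)
    (hstep : ∀ q, LogFun fun w v => step w v q) (K c : ℕ) (q : Q) :
    LogFun fun w v => iterState init step w v (K * w.length + c) q := by
  induction c generalizing q with
  | zero =>
    induction K generalizing q with
    | zero => simpa [iterState] using hinit q
    | succ K ih =>
      refine (LogFun.iterate (init := fun w v => iterState init step w v (K * w.length + 0)) ih hstep
        q).congr fun w v => ?_
      have := iterate_linear_aux init step w v (K * w.length + 0) w.length
      simp only [iterState] at this ⊢
      rw [this]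
      rw [show w.length + (K * w.length + 0) = (K + 1) * w.length + 0 by ring]
  | succ c ih =>
    refine ((hstep q).comp (h := fun w v => Sum.elim v (iterState init step w v (K * w.length + c)))
      ?_).congr fun w v => ?_
    · rintro (i | q)
      · exact LogFun.proj i
      · exact ih q
    · rw [← add_assoc, iterState_succ]

end NumberFunctions

/-! ### Bounded search, bounded quantifiers and parity -/

section NumberFunctions

variable {Γ : Type*} {P Q : Type*}

theorem Function.iterate_map_eq {α β : Type*} {f : α → α} {g : β → β} (φ : α → β)
    (h : ∀ x, φ (f x) = g (φ x)) (n : ℕ) (x : α) : φ (f^[n] x) = g^[n] (φ x) :=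
  (Function.Semiconj.iterate_right (f := φ) h n) x

open Classical in
/-- The least number below `T` with the property `p`, or `T` if there is none. -/
noncomputable def leastBelow (p : ℕ → Prop) (T : ℕ) : ℕ :=
  (fun j => if p j then j else j + 1)^[T] 0

/-- The iteration increases its argument until it gets stuck at the first number with the property.
-/
theorem leastBelow_spec (p : ℕ → Prop) (T : ℕ) :
    leastBelow p T ≤ T ∧ (∀ j < leastBelow p T, ¬ p j) ∧ (leastBelow p T < T → p (leastBelow p T)) := by
  classical
  induction T with
  | zero => simp [leastBelow]
  | succ T ih =>
    obtain ⟨h1, h2, h3⟩ := ih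
    have e : leastBelow p (T + 1) =
        if p (leastBelow p T) then leastBelow p T else leastBelow p T + 1 :=
      Function.iterate_succ_apply' _ _ _
    by_cases hp : p (leastBelow p T)
    · rw [e, if_pos hp]
      exact ⟨by omega, h2, fun _ => hp⟩
    · have hT : ¬ leastBelow p T < T := fun h => hp (h3 h)
      rw [e, if_neg hp]
      refine ⟨by omega, fun j hj => ?_, fun h => by omega⟩
      rcases Nat.lt_succ_iff_lt_or_eq.1 hj with hj | rfl
      · exact h2 j hj
      · exact hp

theorem leastBelow_eq_iff {p : ℕ → Prop} {T : ℕ} : leastBelow p T = T ↔ ∀ j < T, ¬ p j := by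
  obtain ⟨h1, h2, h3⟩ := leastBelow_spec p T
  constructor
  · intro h
    rwa [h] at h2
  · intro h
    by_contra hne
    exact h _ (by omega) (h3 (by omega))

theorem leastBelow_eq {p : ℕ → Prop} {T m : ℕ} (hm : m < T) (hp : p m) (h : ∀ j < m, ¬ p j) :
    leastBelow p T = m := by
  obtain ⟨h1, h2, h3⟩ := leastBelow_spec p T
  rcases lt_trichotomy (leastBelow p T) m with hlt | heq | hgt
  · exact absurd (h3 (by omega)) (h _ hlt)
  · exact heq
  · exact absurd hp (h2 m hgt)

theorem LogFun.leastBelow [Finite P] {p : List Γ → (P → ℕ) → ℕ → Prop}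
    (hp : LogPred fun w (v : P ⊕ Unit → ℕ) => p w (v ∘ Sum.inl) (v (.inr ()))) (K c : ℕ) :
    LogFun fun w v => leastBelow (p w v) (K * w.length + c) := by
  classical
  refine (LogFun.iterate_linear (Q := Unit) (init := fun _ _ _ => 0)
    (step := fun w v _ => if p w (v ∘ Sum.inl) (v (.inr ())) then v (.inr ()) else v (.inr ()) + 1)
    (fun _ => LogFun.zero) (fun _ => LogFun.ite hp (LogFun.proj _) (LogFun.proj _).succ) K c
    ()).congr fun w v => ?_
  refine Function.iterate_map_eq (fun s : Unit → ℕ => s ()) (fun s => ?_) _ _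
  simp only [Sum.elim_inr, Sum.elim_comp_inl]
  congr

theorem LogFun.linear [Finite P] (K c : ℕ) :
    LogFun fun (w : List Γ) (_ : P → ℕ) => K * w.length + c :=
  (LogFun.leastBelow (p := fun _ _ _ => False) (LogPred.const False) K c).congr fun _ _ =>
    leastBelow_eq_iff.2 fun _ _ => not_false

theorem LogPred.exists_lt [Finite P] {p : List Γ → (P → ℕ) → ℕ → Prop}
    (hp : LogPred fun w (v : P ⊕ Unit → ℕ) => p w (v ∘ Sum.inl) (v (.inr ()))) (K c : ℕ) :
    LogPred fun w v => ∃ j < K * w.length + c, p w v j :=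
  ((LogPred.eq (LogFun.leastBelow hp K c) (LogFun.linear K c)).not).congr fun w v => by
    rw [leastBelow_eq_iff]
    push Not
    rfl

theorem LogPred.forall_lt [Finite P] {p : List Γ → (P → ℕ) → ℕ → Prop}
    (hp : LogPred fun w (v : P ⊕ Unit → ℕ) => p w (v ∘ Sum.inl) (v (.inr ()))) (K c : ℕ) :
    LogPred fun w v => ∀ j < K * w.length + c, p w v j :=
  ((LogPred.exists_lt (p := fun w v j => ¬ p w v j) hp.not K c).not).congr fun w v => by
    push Not
    rfl

/-- Registers can only be compared for equality, so the order is found by counting up until `f` or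
`g` is met. This search has a linear bound, hence the first conjunct. -/
theorem LogPred.lt [Finite P] {f g : List Γ → (P → ℕ) → ℕ} (hf : LogFun f) (hg : LogFun g)
    (K c : ℕ) : LogPred fun w v => f w v < K * w.length + c ∧ f w v < g w v := by
  have hl : ∀ {h : List Γ → (P → ℕ) → ℕ}, LogFun h →
      LogFun fun w (v : P ⊕ Unit → ℕ) => h w (v ∘ Sum.inl) := fun hh =>
    hh.comp (h := fun _ v => v ∘ Sum.inl) fun i => LogFun.proj _
  have := LogFun.leastBelow (p := fun w v j => j = f w v ∨ j = g w v)
    ((LogPred.eq (LogFun.proj _) (hl hf)).or (LogPred.eq (LogFun.proj _) (hl hg))) K c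
  refine (((LogPred.eq this (LogFun.linear K c)).not.and (LogPred.eq this hf)).and
    (LogPred.eq hf hg).not).congr fun w v => ?_
  obtain ⟨h1, h2, h3⟩ := leastBelow_spec (fun j => j = f w v ∨ j = g w v) (K * w.length + c)
  constructor
  · rintro ⟨⟨h, e⟩, hne⟩
    rw [e] at h h1 h2
    refine ⟨by omega, lt_of_le_of_ne ?_ hne⟩
    by_contra hlt
    exact h2 (g w v) (by omega) (Or.inr rfl)
  · rintro ⟨h, hlt⟩
    have := leastBelow_eq (p := fun j => j = f w v ∨ j = g w v) h (Or.inl rfl)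
      (fun j hj => by omega)
    omega

open Classical in
theorem LogPred.even_count [Finite P] {p : List Γ → (P → ℕ) → ℕ → Prop}
    (hp : LogPred fun w (v : P ⊕ Unit → ℕ) => p w (v ∘ Sum.inl) (v (.inr ()))) (K c : ℕ) :
    LogPred fun w v => Even (Nat.count (p w v) (K * w.length + c)) := by
  have hp' : LogPred fun w (v : P ⊕ Bool → ℕ) => p w (v ∘ Sum.inl) (v (.inr false)) :=
    hp.comp (h := fun _ v => Sum.elim (v ∘ Sum.inl) fun _ => v (.inr false)) (by
      rintro (i | _) <;> exact LogFun.proj _)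
  -- Component `false` is the current position, component `true` the parity of the hits so far.
  let step : List Γ → (P ⊕ Bool → ℕ) → Bool → ℕ := fun w v b =>
    bif b then
      if p w (v ∘ Sum.inl) (v (.inr false)) then
        if v (.inr true) = 0 then 1 else 0
      else v (.inr true)
    else v (.inr false) + 1
  have hstep : ∀ b, LogFun fun w v => step w v b := by
    intro b
    cases b
    · exact (LogFun.proj _).succ
    · exact LogFun.ite hp' (LogFun.ite (LogPred.eq (LogFun.proj _) LogFun.zero) LogFun.one
        LogFun.zero) (LogFun.proj _)
  have key : ∀ w v t, iterState (fun _ _ _ => 0) step w v t false = t ∧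
      iterState (fun _ _ _ => 0) step w v t true = Nat.count (p w v) t % 2 := by
    intro w v t
    induction t with
    | zero => simp [iterState]
    | succ t ih =>
      rw [iterState_succ]
      simp only [step, cond_false, cond_true, Sum.elim_inr, Sum.elim_comp_inl, ih, true_and,
        Nat.count_succ]
      by_cases h : p w v t
      · simp only [h, if_true]
        split_ifs <;> omega
      · simp [h]
  refine (LogPred.eq (LogFun.iterate_linear (init := fun _ _ _ => 0) (fun _ => LogFun.zero) hstep
    K c true) LogFun.zero).congr fun w v => ?_
  rw [(key w v _).2, Nat.even_iff]

theorem LogPred.exists_finite [Finite P] {ι : Type*} [Finite ι]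
    {q : ι → List Γ → (P → ℕ) → Prop} (hq : ∀ a, LogPred (q a)) :
    LogPred fun w v => ∃ a, q a w v := by
  have := Fintype.ofFinite ι
  have key : ∀ l : List ι, LogPred fun w v => ∃ a ∈ l, q a w v := by
    intro l
    induction l with
    | nil => exact (LogPred.const False).congr (by simp)
    | cons a l ih => exact ((hq a).or ih).congr (by simp)
  exact (key Finset.univ.toList).congr (by simp)

theorem LogPred.forall_finite [Finite P] {ι : Type*} [Finite ι]
    {q : ι → List Γ → (P → ℕ) → Prop} (hq : ∀ a, LogPred (q a)) :
    LogPred fun w v => ∀ a, q a w v :=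
  (LogPred.exists_finite fun a => (hq a).not).not.congr fun w v => by
    push Not
    rfl

theorem LogPred.imp [Finite P] {q q' : List Γ → (P → ℕ) → Prop} (hq : LogPred q)
    (hq' : LogPred q') : LogPred fun w v => q w v → q' w v :=
  (hq.not.or hq').congr fun _ _ => imp_iff_not_or.symm

open Classical in
/-- A function is logspace computable if it is given by an iteration with logspace computable
steps, in which letters are emitted under logspace decidable conditions. -/
theorem logspaceComputable_of_iterate [Finite Q] (l : List Γ) {init : List Γ → Q → ℕ}
    {step : List Γ → (Q → ℕ) → Q → ℕ} {em : Γ → List Γ → (Q → ℕ) → Prop}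
    (hinit : ∀ q, LogFun fun w (_ : Empty → ℕ) => init w q)
    (hstep : ∀ q, LogFun fun w v => step w v q) (hem : ∀ a, LogPred (em a)) :
    LogspaceComputable fun w : List Γ => (List.range w.length).flatMap fun t =>
      l.filter fun a => em a w ((step w)^[t] (init w)) := by
  have hr : ∀ q : Q, LogFun fun (_ : List Γ) (v : Empty ⊕ Q → ℕ) => (v ∘ Sum.inr) q :=
    fun q => LogFun.proj _
  obtain ⟨d, hd⟩ := exists_loop (P := Empty) (init := fun w _ => init w)
    (step := fun w v => step w (v ∘ Sum.inr)) (em := fun a w v => em a w (v ∘ Sum.inr)) l hinit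
    (fun q => (hstep q).comp hr) (fun a => (hem a).comp hr)
  obtain ⟨K, cur, c, -, -, -, hc⟩ := hd 0 Empty.elim (fun i => i.elim)
  refine logspaceComputable_of_run _ c d fun w => ?_
  obtain ⟨y, hy, -, -, -, ho⟩ := hc w ((w.length + 2) ^ d) 0 ⟨fun _ => 0, 0, []⟩
    (fun _ => Nat.zero_le _) (fun _ => le_rfl) (by simp)
  refine ⟨y, hy, ho.trans ?_⟩
  simp only [List.nil_append, Sum.elim_comp_inr, iterState]
  rfl

end NumberFunctions

/-! ### Words over an alphabet with an involution and a commutation relation -/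

section WordValue

variable {Γ G : Type*} [Monoid G] {π : Γ → G}

theorem wordValue_nil : wordValue π [] = 1 := rfl

theorem wordValue_cons (a : Γ) (l : List Γ) :
    wordValue π (a :: l) = π a * wordValue π l := by
  simp [wordValue]

theorem wordValue_append (l l' : List Γ) :
    wordValue π (l ++ l') = wordValue π l * wordValue π l' := by
  simp [wordValue]

end WordValue

/-- An involution and a compatible commutation relation on an alphabet. -/
structure CommAlphabet (Γ : Type*) where
  inv : Γ → Γ
  inv_inv : ∀ a, inv (inv a) = a
  Comm : Γ → Γ → Prop
  symm : ∀ {a b}, Comm a b → Comm b a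
  irrefl : ∀ a, ¬ Comm a a
  inv_left : ∀ {a b}, Comm a b → Comm (inv a) b

namespace CommAlphabet

variable {Γ : Type*} (A : CommAlphabet Γ)

theorem inv_right {a b : Γ} (h : A.Comm a b) : A.Comm a (A.inv b) :=
  A.symm (A.inv_left (A.symm h))

theorem comm_inv_iff {a b : Γ} : A.Comm a (A.inv b) ↔ A.Comm a b :=
  ⟨fun h => by simpa only [A.inv_inv] using A.inv_right h, A.inv_right⟩

theorem not_comm_inv (a : Γ) : ¬ A.Comm a (A.inv a) := fun h => A.irrefl a (A.comm_inv_iff.1 h)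

theorem ne_of_comm {a b : Γ} (h : A.Comm a b) : a ≠ b := by
  rintro rfl
  exact A.irrefl a h

/-- The letter `c` can be moved to the front of the word. -/
def Front (c : Γ) : List Γ → Prop
  | [] => False
  | a :: l => a = c ∨ A.Comm a c ∧ Front c l

/-- Reduced words: no letter can be moved to the right until it meets its inverse. -/
def Reduced : List Γ → Prop
  | [] => True
  | c :: l => ¬ A.Front (A.inv c) l ∧ Reduced l

theorem Front.mem {A : CommAlphabet Γ} {c : Γ} {l : List Γ} (h : A.Front c l) : c ∈ l := by
  induction l with
  | nil => exact h.elim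
  | cons a l ih =>
    rcases h with rfl | ⟨-, h⟩
    · exact List.mem_cons_self
    · exact List.mem_cons_of_mem _ (ih h)

theorem Front.append {A : CommAlphabet Γ} {c : Γ} {l : List Γ} (h : A.Front c l) (l' : List Γ) :
    A.Front c (l ++ l') := by
  induction l with
  | nil => exact h.elim
  | cons a l ih => exact h.imp_right fun h => ⟨h.1, ih h.2⟩

theorem Reduced.of_append {A : CommAlphabet Γ} {l l' : List Γ} (h : A.Reduced (l ++ l')) :
    A.Reduced l := by
  induction l with
  | nil => trivial
  | cons a l ih => exact ⟨fun h' => h.1 (h'.append l'), ih h.2⟩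

theorem front_append_cons {c : Γ} {l : List Γ} (h : ∀ a ∈ l, A.Comm a c) (l' : List Γ) :
    A.Front c (l ++ c :: l') := by
  induction l with
  | nil => exact Or.inl rfl
  | cons a l ih =>
    exact Or.inr ⟨h a List.mem_cons_self, ih fun b hb => h b (List.mem_cons_of_mem _ hb)⟩

/-- The letters `π` of a group satisfy the relations that belong to `A`. -/
structure Relations {G : Type*} [Group G] (π : Γ → G) : Prop where
  mul_inv : ∀ a, π a * π (A.inv a) = 1
  comm : ∀ {a b}, A.Comm a b → π a * π b = π b * π a

theorem Relations.wordValue_comm {A : CommAlphabet Γ} {G : Type*} [Group G] {π : Γ → G}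
    (hπ : A.Relations π) {c : Γ} {l : List Γ}
    (h : ∀ a ∈ l, A.Comm a c) : π c * wordValue π l = wordValue π l * π c := by
  induction l with
  | nil => simp [wordValue_nil]
  | cons a l ih =>
    rw [wordValue_cons, ← mul_assoc, ← hπ.comm (h a List.mem_cons_self), mul_assoc,
      ih fun b hb => h b (List.mem_cons_of_mem _ hb), mul_assoc]

variable [DecidableEq Γ]

theorem Front.of_erase {A : CommAlphabet Γ} {b c : Γ} {l : List Γ} (hbc : A.Comm b c)
    (hb : A.Front b (l.erase c)) : A.Front b l := by
  induction l with
  | nil => exact hb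
  | cons a l ih =>
    by_cases hac : a = c
    · subst hac
      rw [List.erase_cons_head] at hb
      exact Or.inr ⟨A.symm hbc, hb⟩
    · rw [List.erase_cons_tail (by simpa using hac)] at hb
      exact hb.imp_right fun h => ⟨h.1, ih h.2⟩

/-- A letter `a` that stands before `c` commutes with `c`, and so does its inverse; erasing `c` thus
cannot open a way to the front for the inverse of `a`. -/
theorem Reduced.erase {A : CommAlphabet Γ} {c : Γ} {l : List Γ} (hl : A.Reduced l)
    (hc : A.Front c l) : A.Reduced (l.erase c) := by
  induction l with
  | nil => exact hl
  | cons a l ih =>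
    by_cases hac : a = c
    · subst hac
      rw [List.erase_cons_head]
      exact hl.2
    · rw [List.erase_cons_tail (by simpa using hac)]
      obtain ⟨hac', hc⟩ := hc.resolve_left hac
      exact ⟨fun h => hl.1 (h.of_erase (A.inv_left hac')), ih hl.2 hc⟩

open Classical in
/-- Multiplication of a reduced word by a letter. -/
noncomputable def push (c : Γ) (l : List Γ) : List Γ :=
  if A.Front (A.inv c) l then l.erase (A.inv c) else c :: l

/-- The reduced word obtained from a word by successive cancellations. -/
noncomputable def reduce (w : List Γ) : List Γ :=
  w.foldr A.push []

theorem reduced_reduce (w : List Γ) : A.Reduced (A.reduce w) := by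
  induction w with
  | nil => trivial
  | cons c w ih =>
    simp only [reduce, List.foldr_cons, push] at ih ⊢
    split_ifs with h
    · exact ih.erase h
    · exact ⟨h, ih⟩

theorem length_push_le (c : Γ) (l : List Γ) : (A.push c l).length ≤ l.length + 1 := by
  unfold push
  split_ifs with h
  · exact (List.length_erase_le).trans (Nat.le_succ _)
  · exact le_rfl

theorem length_reduce_le (w : List Γ) : (A.reduce w).length ≤ w.length := by
  induction w with
  | nil => exact le_rfl
  | cons c w ih => exact (A.length_push_le c _).trans (Nat.succ_le_succ ih)

theorem reduced_of_length_reduce {w : List Γ} (h : (A.reduce w).length = w.length) :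
    A.reduce w = w := by
  induction w with
  | nil => rfl
  | cons c w ih =>
    have h1 := A.length_reduce_le w
    have h2 := A.length_push_le c (A.reduce w)
    change (A.push c (A.reduce w)).length = w.length + 1 at h
    have h3 := ih (by omega)
    change A.push c (A.reduce w) = c :: w
    rw [h3] at h ⊢
    unfold push at h ⊢
    split_ifs at h ⊢ with hf
    · have := List.length_erase_le (a := A.inv c) (l := w)
      omega
    · rfl

/-! #### Words in groups -/

section Groups

variable {G : Type*} [Group G]

variable {A} {π : Γ → G}

theorem Relations.wordValue_erase (hπ : A.Relations π) {c : Γ} {l : List Γ} (h : A.Front c l) :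
    π c * wordValue π (l.erase c) = wordValue π l := by
  induction l with
  | nil => exact h.elim
  | cons a l ih =>
    by_cases hac : a = c
    · subst hac
      rw [List.erase_cons_head, wordValue_cons]
    · obtain ⟨hac', h⟩ := h.resolve_left hac
      rw [List.erase_cons_tail (by simpa using hac), wordValue_cons, wordValue_cons, ← mul_assoc,
        ← hπ.comm hac', mul_assoc, ih h]

theorem Relations.wordValue_push (hπ : A.Relations π) (c : Γ) (l : List Γ) :
    wordValue π (A.push c l) = π c * wordValue π l := by
  unfold push
  split_ifs with h
  · rw [← hπ.wordValue_erase h, ← mul_assoc, hπ.mul_inv, one_mul]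
  · exact wordValue_cons c l

theorem Relations.wordValue_reduce (hπ : A.Relations π) (w : List Γ) :
    wordValue π (A.reduce w) = wordValue π w := by
  induction w with
  | nil => rfl
  | cons c w ih =>
    change wordValue π (A.push c (A.reduce w)) = _
    rw [hπ.wordValue_push, ih, wordValue_cons]

end Groups

/-! #### The numbers game -/

open Classical in
/-- Firing the letter `b` in the numbers game. -/
noncomputable def fire (b : Γ) (f : Γ → ℤ) : Γ → ℤ := fun d =>
  if d = b then - f b else if A.Comm d b then f d else f d + 2 * f b

theorem fire_self (b : Γ) (f : Γ → ℤ) : A.fire b f b = - f b := by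
  simp [fire]

theorem fire_of_comm {b d : Γ} (h : A.Comm d b) (f : Γ → ℤ) : A.fire b f d = f d := by
  simp [fire, A.ne_of_comm h, h]

theorem fire_of_not_comm {b d : Γ} (h : d ≠ b) (h' : ¬ A.Comm d b) (f : Γ → ℤ) :
    A.fire b f d = f d + 2 * f b := by
  simp [fire, h, h']

theorem fire_fire (b : Γ) (f : Γ → ℤ) : A.fire b (A.fire b f) = f := by
  funext d
  by_cases h : d = b
  · subst h
    simp [fire_self]
  · by_cases h' : A.Comm d b
    · simp [A.fire_of_comm h']
    · simp [A.fire_of_not_comm h h', fire_self]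

theorem fire_of_eq_zero {b : Γ} {f : Γ → ℤ} (h : f b = 0) : A.fire b f = f := by
  funext d
  simp only [fire, h]
  split_ifs with h'
  · simp [h', h]
  · rfl
  · simp

theorem fire_comm {a b : Γ} (h : A.Comm a b) (f : Γ → ℤ) :
    A.fire a (A.fire b f) = A.fire b (A.fire a f) := by
  have hab := A.ne_of_comm h
  have h' := A.symm h
  funext d
  simp only [fire, h, h', hab, hab.symm, if_false, if_true]
  by_cases hda : d = a
  · subst hda
    simp [hab, h]
  · by_cases hdb : d = b
    · subst hdb
      simp [hda, h']
    · simp only [hda, hdb, if_false]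
      split_ifs <;> ring

/-- The action of the letter `c` on vectors. -/
noncomputable def act (c : Γ) (f : Γ → ℤ) : Γ → ℤ :=
  if A.inv c = c then A.fire c f else A.fire c (A.fire (A.inv c) f)

theorem act_act_inv (c : Γ) (f : Γ → ℤ) : A.act c (A.act (A.inv c) f) = f := by
  unfold act
  by_cases h : A.inv c = c
  · simp [h, fire_fire]
  · have h' : ¬ A.inv (A.inv c) = A.inv c := by rwa [A.inv_inv, eq_comm]
    rw [if_neg h, if_neg h', A.inv_inv, fire_fire, fire_fire]

theorem act_comm {a b : Γ} (h : A.Comm a b) (f : Γ → ℤ) :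
    A.act a (A.act b f) = A.act b (A.act a f) := by
  have h1 := A.inv_left h
  have h2 := A.inv_right h
  have h3 := A.inv_left h2
  unfold act
  split_ifs <;> simp only [A.fire_comm h, A.fire_comm h1, A.fire_comm h2, A.fire_comm h3]

/-- The action of the letter `c` as a permutation. -/
noncomputable def perm (c : Γ) : Equiv.Perm (Γ → ℤ) where
  toFun := A.act c
  invFun := A.act (A.inv c)
  left_inv f := by simpa only [A.inv_inv] using A.act_act_inv (A.inv c) f
  right_inv := A.act_act_inv c

theorem relations_perm : A.Relations A.perm where
  mul_inv a := Equiv.ext fun f => A.act_act_inv a f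
  comm h := Equiv.ext fun f => A.act_comm h f

/-- The vector `f` has at least the value `ε` at the letters in `D`, which dominate their
neighbours, and at most the value `-ε` at all others. -/
def Descending (ε : ℤ) (D : Γ → Prop) (f : Γ → ℤ) : Prop :=
  ∀ d, (D d → ε ≤ f d ∧ ∀ b, b ≠ d → ¬ A.Comm b d → f b ≤ - f d) ∧ (¬ D d → f d ≤ - ε)

/-- If `d` in `D` does not commute with `c`, domination gives `f c ≤ - f d`, so the new entry at `d`
is at most `- f d ≤ - ε` and `d` leaves `D`. Domination is part of the invariant for this reason. -/
theorem Descending.fire {A : CommAlphabet Γ} {ε : ℤ} (hε : 0 ≤ ε) {D : Γ → Prop} {f : Γ → ℤ}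
    (h : A.Descending ε D f) {c : Γ} (hc : ¬ D c) :
    A.Descending ε (fun d => d = c ∨ D d ∧ A.Comm d c) (A.fire c f) := by
  have hfc := (h c).2 hc
  intro d
  constructor
  · rintro (rfl | ⟨hd, hdc⟩)
    · rw [fire_self]
      refine ⟨by omega, fun b hb hbd => ?_⟩
      rw [A.fire_of_not_comm hb hbd]
      by_cases hDb : D b
      · have := ((h b).1 hDb).2 d hb.symm fun h => hbd (A.symm h)
        omega
      · have := (h b).2 hDb
        omega
    · rw [A.fire_of_comm hdc]
      refine ⟨((h d).1 hd).1, fun b hb hbd => ?_⟩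
      have hfb := ((h d).1 hd).2 b hb hbd
      have hbc : b ≠ c := fun e => hbd (e ▸ A.symm hdc)
      by_cases hbc' : A.Comm b c
      · rwa [A.fire_of_comm hbc']
      · rw [A.fire_of_not_comm hbc hbc']
        omega
  · intro hd
    push Not at hd
    obtain ⟨hdc, hd⟩ := hd
    by_cases hdc' : A.Comm d c
    · rw [A.fire_of_comm hdc']
      exact (h d).2 fun hD => hd hD hdc'
    · rw [A.fire_of_not_comm hdc hdc']
      by_cases hD : D d
      · have := ((h d).1 hD).2 c (Ne.symm hdc) fun h => hdc' (A.symm h)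
        omega
      · have := (h d).2 hD
        omega

/-- A negative entry at `c` becomes positive. If the entry is zero, a positive entry at `d` could
change only if `d` did not commute with `c`; but `d` lies in `D` and would then force a negative
entry at `c`. -/
theorem Descending.exists_pos_fire {A : CommAlphabet Γ} {D : Γ → Prop} {f : Γ → ℤ}
    (h : A.Descending 0 D f) {c : Γ} (hc : ¬ D c) (hpos : (∃ d, 0 < f d) ∨ f c < 0) :
    ∃ d, 0 < A.fire c f d := by
  by_cases hfc : f c < 0
  · exact ⟨c, by rw [fire_self]; omega⟩
  · obtain ⟨d, hd⟩ := hpos.resolve_right hfc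
    have h0 := (h c).2 hc
    have hdc : d ≠ c := by
      rintro rfl
      omega
    by_cases hdc' : A.Comm d c
    · exact ⟨d, by rwa [A.fire_of_comm hdc']⟩
    · have hD : D d := by
        by_contra hD
        have := (h d).2 hD
        omega
      have := ((h d).1 hD).2 c hdc.symm fun h => hdc' (A.symm h)
      omega

theorem Descending.act {A : CommAlphabet Γ} {ε : ℤ} (hε : 0 ≤ ε) {D : Γ → Prop} {f : Γ → ℤ}
    (h : A.Descending ε D f) {c : Γ} (hc : ¬ D (A.inv c)) :
    A.Descending ε (fun d => d = c ∨ D d ∧ A.Comm d c) (A.act c f) := by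
  unfold CommAlphabet.act
  split_ifs with hcc
  · rw [hcc] at hc
    exact h.fire hε hc
  · have h1 := (h.fire hε hc).fire hε (c := c)
      (by rintro (h | ⟨-, h⟩)
          · exact hcc h.symm
          · exact A.not_comm_inv c h)
    -- The first firing puts the inverse of `c` into the set; the second removes it again, as it
    -- does not commute with `c`.
    convert h1 using 3 with d
    constructor
    · rintro ⟨h, h'⟩
      exact ⟨Or.inr ⟨h, A.inv_right h'⟩, h'⟩
    · rintro ⟨rfl | ⟨h, -⟩, h'⟩
      · exact absurd (A.symm h') (A.not_comm_inv c)
      · exact ⟨h, h'⟩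

theorem Descending.exists_pos_act {A : CommAlphabet Γ} {D : Γ → Prop} {f : Γ → ℤ}
    (h : A.Descending 0 D f) {c : Γ} (hc : ¬ D (A.inv c))
    (hpos : (∃ d, 0 < f d) ∨ f (A.inv c) < 0) : ∃ d, 0 < A.act c f d := by
  unfold CommAlphabet.act
  split_ifs with hcc
  · rw [hcc] at hc hpos
    exact h.exists_pos_fire hc hpos
  · refine (h.fire le_rfl hc).exists_pos_fire ?_ (Or.inl (h.exists_pos_fire hc hpos))
    rintro (h | ⟨-, h⟩)
    · exact hcc h.symm
    · exact A.not_comm_inv c h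

/-- Being reduced says precisely that each new letter meets the hypothesis of `Descending.act`. With
`ε = 1` signs detect front letters; `ε = 0` is needed for the vectors `linkVec`, which have zero
entries. -/
theorem Reduced.descending {A : CommAlphabet Γ} {ε : ℤ} (hε : 0 ≤ ε) {f : Γ → ℤ}
    (hf : ∀ d, f d ≤ - ε) {l : List Γ} (hl : A.Reduced l) :
    A.Descending ε (fun d => A.Front d l) (wordValue A.perm l f) := by
  induction l with
  | nil => exact fun d => ⟨fun h => h.elim, fun _ => hf d⟩
  | cons c l ih =>
    have e : (fun d => A.Front d (c :: l)) = fun d => d = c ∨ A.Front d l ∧ A.Comm d c := by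
      funext d
      refine propext ⟨?_, ?_⟩
      · rintro (h | ⟨h, h'⟩)
        exacts [Or.inl h.symm, Or.inr ⟨h', A.symm h⟩]
      · rintro (h | ⟨h, h'⟩)
        exacts [Or.inl h.symm, Or.inr ⟨A.symm h', h⟩]
    rw [wordValue_cons, e]
    exact (ih hl.2).act hε hl.1

theorem Reduced.front_iff {A : CommAlphabet Γ} {l : List Γ} (hl : A.Reduced l) (c : Γ) :
    A.Front c l ↔ 0 < wordValue A.perm l (fun _ => -1) c := by
  have h := hl.descending (ε := 1) zero_le_one (f := fun _ => -1) (fun _ => le_rfl) c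
  constructor
  · intro hc
    have := (h.1 hc).1
    omega
  · intro hc
    by_contra hc'
    have := h.2 hc'
    omega

/-! #### Reduced words are geodesic -/

section Geodesics

variable {A} {G : Type*} [Group G] {π : Γ → G}

/-- The letters `π` satisfy the relations of `A`, and no more relations than the action on vectors
does. -/
structure Faithful (A : CommAlphabet Γ) (π : Γ → G) : Prop extends A.Relations π where
  perm_eq : ∀ {u v : List Γ}, wordValue π u = wordValue π v →
    wordValue A.perm u = wordValue A.perm v

theorem Faithful.front_iff (hπ : A.Faithful π) {l l' : List Γ} (hl : A.Reduced l)
    (hl' : A.Reduced l') (h : wordValue π l = wordValue π l') (c : Γ) :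
    A.Front c l ↔ A.Front c l' := by
  rw [hl.front_iff, hl'.front_iff, hπ.perm_eq h]

/-- The first letter of one word can be moved to the front of the other, since the group element
determines the front letters; it is cancelled from both words. -/
theorem Faithful.length_eq (hπ : A.Faithful π) {l l' : List Γ} (hl : A.Reduced l)
    (hl' : A.Reduced l') (h : wordValue π l = wordValue π l') : l.length = l'.length := by
  induction l generalizing l' with
  | nil =>
    cases l' with
    | nil => rfl
    | cons c l' => exact ((hπ.front_iff hl hl' h c).2 (Or.inl rfl)).elim
  | cons c l ih =>
    have hc : A.Front c l' := (hπ.front_iff hl hl' h c).1 (Or.inl rfl)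
    have := ih hl.2 (hl'.erase hc) (by
      rw [← hπ.wordValue_erase hc, wordValue_cons] at h
      exact mul_left_cancel h)
    rw [List.length_cons, this, List.length_erase_of_mem hc.mem]
    have := List.length_pos_of_mem hc.mem
    omega

theorem Faithful.isGeodesicWord (hπ : A.Faithful π) {l : List Γ} (hl : A.Reduced l) :
    IsGeodesicWord π (wordValue π l) l := by
  refine ⟨rfl, fun v hv => ?_⟩
  rw [hπ.length_eq hl (A.reduced_reduce v) (by rw [hπ.wordValue_reduce, hv])]
  exact A.length_reduce_le v

theorem Faithful.reduced_of_isGeodesicWord (hπ : A.Faithful π) {g : G} {l : List Γ}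
    (hl : IsGeodesicWord π g l) : A.Reduced l := by
  have h := hl.2 (A.reduce l) (by rw [hπ.wordValue_reduce, hl.1])
  rw [← A.reduced_of_length_reduce (le_antisymm (A.length_reduce_le l) h)]
  exact A.reduced_reduce l

end Geodesics

end CommAlphabet

namespace CommAlphabet

section Greedy

variable {Γ : Type*} [LinearOrder Γ]

/-- The word `v` is obtained from `u` by always taking the least letter that can be moved to the
front. -/
inductive Greedy (A : CommAlphabet Γ) : List Γ → List Γ → Prop
  | nil : Greedy A [] []
  | cons {a : Γ} {u v : List Γ} (ha : A.Front a u) (hmin : ∀ b < a, ¬ A.Front b u)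
      (h : Greedy A (u.erase a) v) : Greedy A u (a :: v)

variable {A : CommAlphabet Γ} {G : Type*} [Group G] {π : Γ → G}

/-- Any reduced competitor begins with a front letter of `u`, which is at least the greedy choice
`a`; in the case of equality both words are shortened by `a`. -/
theorem Faithful.greedy_aux (hπ : A.Faithful π) {u v : List Γ} (h : A.Greedy u v)
    (hu : A.Reduced u) : wordValue π v = wordValue π u ∧ v.length = u.length ∧
      ∀ v', A.Reduced v' → wordValue π v' = wordValue π u → v ≤ v' := by
  induction h with
  | nil =>
    refine ⟨rfl, rfl, fun v' hv' h => ?_⟩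
    have := hπ.length_eq hv' hu h
    rw [List.length_eq_zero_iff.1 this]
  | @cons a u v ha hmin h ih =>
    obtain ⟨h1, h2, h3⟩ := ih (hu.erase ha)
    have hlen := List.length_pos_of_mem ha.mem
    refine ⟨?_, ?_, fun v' hv' hval => ?_⟩
    · rw [wordValue_cons, h1, hπ.wordValue_erase ha]
    · rw [List.length_cons, h2, List.length_erase_of_mem ha.mem]
      omega
    · have hl := hπ.length_eq hv' hu hval
      cases v' with
      | nil => simp at hl; omega
      | cons c v' =>
        have hc : A.Front c u := (hπ.front_iff hv' hu hval c).1 (Or.inl rfl)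
        rcases lt_trichotomy c a with hca | rfl | hca
        · exact absurd hc (hmin c hca)
        · refine List.cons_le_cons _ (h3 v' hv'.2 ?_)
          rw [← hπ.wordValue_erase ha, wordValue_cons] at hval
          exact mul_left_cancel hval
        · exact le_of_lt (List.Lex.rel hca : (a :: v) < c :: v')

/-- Greedy rearrangement of a reduced word gives the shortlex normal form. -/
theorem Faithful.isShortlexNormalForm (hπ : A.Faithful π) {u v : List Γ} (h : A.Greedy u v)
    (hu : A.Reduced u) : IsShortlexNormalForm π (wordValue π u) v := by
  obtain ⟨h1, h2, h3⟩ := hπ.greedy_aux h hu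
  refine ⟨⟨h1, fun v' hv' => ?_⟩, fun v' hv' => h3 v' (hπ.reduced_of_isGeodesicWord hv') hv'.1⟩
  rw [h2]
  exact (hπ.isGeodesicWord hu).2 v' hv'

end Greedy

/-! #### Hyperplanes -/

variable {Γ : Type*} (A : CommAlphabet Γ)

open Classical in
/-- The vector whose stabilizer is generated by the letters that commute with `c`. -/
noncomputable def linkVec (c : Γ) : Γ → ℤ := fun b => if A.Comm b c then 0 else -1

theorem linkVec_inv (c : Γ) : A.linkVec (A.inv c) = A.linkVec c := by
  funext b
  by_cases h : A.Comm b c <;> simp [linkVec, A.comm_inv_iff, h]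

theorem linkVec_nonpos (c d : Γ) : A.linkVec c d ≤ 0 := by
  unfold linkVec
  split_ifs <;> simp

/-- The vector that represents the coset of `g` modulo the subgroup generated by the letters that
commute with `c`. -/
noncomputable def cosetVec (c : Γ) (g : Equiv.Perm (Γ → ℤ)) : Γ → ℤ := g⁻¹ (A.linkVec c)

theorem cosetVec_mul_eq_iff {c : Γ} {u g : Equiv.Perm (Γ → ℤ)} :
    A.cosetVec c (u * g) = A.cosetVec c g ↔ u (A.linkVec c) = A.linkVec c := by
  simp only [cosetVec, mul_inv_rev, Equiv.Perm.mul_apply, EmbeddingLike.apply_eq_iff_eq]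
  rw [Equiv.Perm.inv_eq_iff_eq, eq_comm]

theorem cosetVec_inv (c : Γ) (g : Equiv.Perm (Γ → ℤ)) :
    A.cosetVec (A.inv c) g = A.cosetVec c g := by
  rw [cosetVec, linkVec_inv, cosetVec]

variable [DecidableEq Γ]

theorem act_linkVec {c d : Γ} (h : A.Comm d c) : A.act d (A.linkVec c) = A.linkVec c := by
  have h1 : A.linkVec c d = 0 := by simp [linkVec, h]
  have h2 : A.linkVec c (A.inv d) = 0 := by simp [linkVec, A.inv_left h]
  unfold act
  split_ifs
  · exact A.fire_of_eq_zero h1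
  · rw [A.fire_of_eq_zero h2, A.fire_of_eq_zero h1]

theorem wordValue_linkVec {c : Γ} {l : List Γ} (h : ∀ a ∈ l, A.Comm a c) :
    wordValue A.perm l (A.linkVec c) = A.linkVec c := by
  induction l with
  | nil => rfl
  | cons a l ih =>
    rw [wordValue_cons, Equiv.Perm.mul_apply, ih fun b hb => h b (List.mem_cons_of_mem _ hb)]
    exact A.act_linkVec (h a List.mem_cons_self)

/-- Read from the right, the letters that commute with `c` fix `linkVec c`. The first other letter
creates a positive entry, and some positive entry persists from then on, whereas `linkVec c` has
none. -/
theorem Reduced.comm_of_linkVec {A : CommAlphabet Γ} {c : Γ} {l : List Γ} (hl : A.Reduced l)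
    (h : wordValue A.perm l (A.linkVec c) = A.linkVec c) : ∀ a ∈ l, A.Comm a c := by
  have key : (∀ a ∈ l, A.Comm a c) ∨ ∃ d, 0 < wordValue A.perm l (A.linkVec c) d := by
    clear h
    induction l with
    | nil => exact Or.inl (by simp)
    | cons a l ih =>
      have hdesc := hl.2.descending le_rfl (f := A.linkVec c) (fun d => by
        simpa using A.linkVec_nonpos c d)
      have hcons : wordValue A.perm (a :: l) (A.linkVec c) =
          A.act a (wordValue A.perm l (A.linkVec c)) := by
        rw [wordValue_cons]
        rfl
      rw [hcons]
      rcases ih hl.2 with h | h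
      · by_cases hac : A.Comm a c
        · exact Or.inl (by simpa [hac] using h)
        · refine Or.inr (hdesc.exists_pos_act hl.1 (Or.inr ?_))
          have : ¬ A.Comm (A.inv a) c := fun h' => hac (by
            simpa only [A.inv_inv] using A.inv_left h')
          rw [A.wordValue_linkVec h]
          simp [linkVec, this]
      · exact Or.inr (hdesc.exists_pos_act hl.1 (Or.inl h))
  refine key.resolve_right ?_
  rintro ⟨d, hd⟩
  rw [h] at hd
  exact absurd hd (A.linkVec_nonpos c d).not_gt

/-- The hyperplane between `g` and `c * g`. -/
noncomputable def hyp (c : Γ) (g : Equiv.Perm (Γ → ℤ)) : Sym2 Γ × Sym2 (Γ → ℤ) :=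
  (s(c, A.inv c), s(A.cosetVec c g, A.cosetVec c (A.perm c * g)))

theorem cosetVec_mul_of_comm {c d : Γ} (h : A.Comm d c) (g : Equiv.Perm (Γ → ℤ)) :
    A.cosetVec c (A.perm d * g) = A.cosetVec c g := by
  have : A.perm d (A.linkVec c) = A.linkVec c := A.act_linkVec h
  simp only [cosetVec, mul_inv_rev, Equiv.Perm.mul_apply]
  rw [Equiv.Perm.inv_eq_iff_eq.2 this.symm]

/-- Opposite edges of a commutation square cross the same hyperplane. -/
theorem hyp_mul_of_comm {c d : Γ} (h : A.Comm d c) (g : Equiv.Perm (Γ → ℤ)) :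
    A.hyp c (A.perm d * g) = A.hyp c g := by
  rw [hyp, hyp, A.cosetVec_mul_of_comm h, ← mul_assoc, ← A.relations_perm.comm h, mul_assoc,
    A.cosetVec_mul_of_comm h]

/-- The same edge in the opposite direction; this is why the pairs are unordered. -/
theorem hyp_inv_mul (c : Γ) (g : Equiv.Perm (Γ → ℤ)) :
    A.hyp c (A.perm (A.inv c) * g) = A.hyp (A.inv c) g := by
  rw [hyp, hyp, ← mul_assoc, A.relations_perm.mul_inv, one_mul, A.inv_inv, A.cosetVec_inv,
    A.cosetVec_inv, Sym2.eq_swap, Sym2.eq_swap (a := A.cosetVec c g)]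

/-- The letters of a word together with the hyperplanes that the word crosses. -/
noncomputable def crossings : List Γ → List (Γ × Sym2 Γ × Sym2 (Γ → ℤ))
  | [] => []
  | c :: l => (c, A.hyp c (wordValue A.perm l)) :: crossings l

theorem map_fst_crossings (l : List Γ) : (A.crossings l).map Prod.fst = l := by
  induction l with
  | nil => rfl
  | cons c l ih => rw [crossings, List.map_cons, ih]

-- The letters before the cancelling occurrence commute with it. So moving it changes none of their
-- hyperplanes, and it is the first letter on its hyperplane.
open Classical in
theorem crossings_erase {c : Γ} {l : List Γ} (h : A.Front (A.inv c) l) :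
    (∃ y ∈ A.crossings l, y.2 = A.hyp c (wordValue A.perm l)) ∧
      (A.crossings l).eraseP (fun y => y.2 = A.hyp c (wordValue A.perm l)) =
        A.crossings (l.erase (A.inv c)) := by
  induction l with
  | nil => exact h.elim
  | cons d l ih =>
    by_cases hd : d = A.inv c
    · subst hd
      have e : A.hyp (A.inv c) (wordValue A.perm l) =
          A.hyp c (wordValue A.perm (A.inv c :: l)) := by
        rw [wordValue_cons, hyp_inv_mul]
      rw [crossings]
      refine ⟨⟨_, List.mem_cons_self, e⟩, ?_⟩
      rw [List.eraseP_cons_of_pos (by simpa using e), List.erase_cons_head]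
    · obtain ⟨hdc, h⟩ := h.resolve_left hd
      obtain ⟨⟨y, hy, hy'⟩, ih⟩ := ih h
      have e : A.hyp c (wordValue A.perm (d :: l)) = A.hyp c (wordValue A.perm l) := by
        rw [wordValue_cons, A.hyp_mul_of_comm (A.comm_inv_iff.1 hdc)]
      rw [crossings, e]
      refine ⟨⟨y, List.mem_cons_of_mem _ hy, hy'⟩, ?_⟩
      -- Commuting letters are distinguished by the letter pair stored in the hyperplane.
      have hne : A.hyp d (wordValue A.perm l) ≠ A.hyp c (wordValue A.perm l) := by
        intro h
        have h := congrArg Prod.fst h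
        simp only [hyp, Sym2.eq_iff] at h
        rcases h with ⟨h, -⟩ | ⟨h, -⟩
        · exact A.not_comm_inv c (h ▸ hdc)
        · exact hd h
      rw [List.eraseP_cons_of_neg (by simpa using hne), ih,
        List.erase_cons_tail (by simpa using hd), crossings, ← A.relations_perm.wordValue_erase h,
        A.hyp_mul_of_comm (A.symm hdc)]

theorem exists_of_mem_crossings {l : List Γ} {y : Γ × Sym2 Γ × Sym2 (Γ → ℤ)}
    (hy : y ∈ A.crossings l) :
    ∃ u d v, l = u ++ d :: v ∧ y = (d, A.hyp d (wordValue A.perm v)) := by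
  induction l with
  | nil => simp [crossings] at hy
  | cons c l ih =>
    rcases List.mem_cons.1 hy with rfl | hy
    · exact ⟨[], c, l, rfl, rfl⟩
    · obtain ⟨u, d, v, rfl, h⟩ := ih hy
      exact ⟨c :: u, d, v, rfl, h⟩

/-- The converse of `crossings_erase`. The word is split at the letter `d` that crosses the
hyperplane; equal cosets turn into words that fix `linkVec d`, and `comm_of_linkVec` tells which
letters these contain. -/
theorem Reduced.front_of_mem_crossings {A : CommAlphabet Γ} {c : Γ} {l : List Γ}
    (hl : A.Reduced l) {y : Γ × Sym2 Γ × Sym2 (Γ → ℤ)} (hy : y ∈ A.crossings l)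
    (h : y.2 = A.hyp c (wordValue A.perm l)) : A.Front (A.inv c) l := by
  obtain ⟨u, d, v, rfl, rfl⟩ := A.exists_of_mem_crossings hy
  have hud : A.Reduced (u ++ [d]) := by
    rw [List.append_cons] at hl
    exact hl.of_append
  have hu : A.Reduced u := hud.of_append
  have hval : wordValue A.perm (u ++ d :: v) =
      wordValue A.perm u * (A.perm d * wordValue A.perm v) := by
    rw [wordValue_append, wordValue_cons]
  rw [hval] at h
  have h1 := congrArg Prod.fst h
  have h2 := congrArg Prod.snd h
  simp only [hyp, Sym2.eq_iff] at h1 h2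
  have hcd : c = d ∨ c = A.inv d := by
    rcases h1 with ⟨h, -⟩ | ⟨-, h⟩
    · exact Or.inl h.symm
    · exact Or.inr h.symm
  have hcos : ∀ g, A.cosetVec c g = A.cosetVec d g := by
    intro g
    rcases hcd with rfl | rfl
    · rfl
    · exact A.cosetVec_inv d g
  rw [hcos, hcos] at h2
  rcases h2 with ⟨h2, -⟩ | ⟨h2, h3⟩
  -- With the sides matched in this order, `d` itself would have to commute with `d`.
  · have : (wordValue A.perm (u ++ [d])) (A.linkVec d) = A.linkVec d := by
      rw [← A.cosetVec_mul_eq_iff (g := wordValue A.perm v), h2, wordValue_append, wordValue_cons,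
        wordValue_nil, mul_one, mul_assoc]
    exact absurd (hud.comm_of_linkVec this d (by simp)) (A.irrefl d)
  · have hcomm := hu.comm_of_linkVec (A.cosetVec_mul_eq_iff.1 h3.symm)
    have hfront := A.front_append_cons hcomm v
    rcases hcd with rfl | rfl
    · by_cases hinv : A.inv c = c
      · rwa [hinv]
      · exfalso
        -- Here `c` would cross its hyperplane twice in the same direction. Moving `u` out of the
        -- way shows that `c * c` fixes `linkVec c`, which is impossible for the reduced word `[c,
        -- c]`.
        have h4 : A.cosetVec c (A.perm c * A.perm c * wordValue A.perm v) =
            A.cosetVec c (wordValue A.perm v) := by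
          rw [h2, ← mul_assoc, A.relations_perm.wordValue_comm hcomm, mul_assoc,
            mul_assoc, A.cosetVec_mul_eq_iff.2 (A.cosetVec_mul_eq_iff.1 h3.symm)]
        have h5 := A.cosetVec_mul_eq_iff.1 h4
        have hred : A.Reduced [c, c] := by
          refine ⟨?_, fun h => h, trivial⟩
          rintro (h | ⟨-, h⟩)
          · exact hinv h.symm
          · exact h
        refine A.irrefl c (hred.comm_of_linkVec (c := c) ?_ c (by simp))
        simpa [wordValue] using h5
    · rwa [A.inv_inv]

open Classical in
/-- Adding an element to a list, or removing an element of the list with the same key. -/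
noncomputable def _root_.List.toggle {α β : Type*} (key : α → β) (x : α) (l : List α) : List α :=
  if ∃ y ∈ l, key y = key x then l.eraseP fun y => key y = key x else x :: l

theorem crossings_push {c : Γ} {l : List Γ} (hl : A.Reduced l) :
    A.crossings (A.push c l) =
      List.toggle Prod.snd (c, A.hyp c (wordValue A.perm l)) (A.crossings l) := by
  unfold push List.toggle
  by_cases h : A.Front (A.inv c) l
  · obtain ⟨h1, h2⟩ := A.crossings_erase h
    rw [if_pos h, if_pos h1]
    convert h2.symm
  · rw [if_neg h, if_neg, crossings]
    rintro ⟨y, hy, hy'⟩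
    exact h (hl.front_of_mem_crossings hy hy')

theorem crossings_reduce (w : List Γ) :
    A.crossings (A.reduce w) = (A.crossings w).foldr (List.toggle Prod.snd) [] := by
  induction w with
  | nil => rfl
  | cons c w ih =>
    rw [crossings, List.foldr_cons, ← ih, ← A.relations_perm.wordValue_reduce w,
      ← A.crossings_push (A.reduced_reduce w)]
    rfl

end CommAlphabet

/-! ### Toggling the elements of a list -/

section Toggle

open Classical

variable {α β γ : Type*}

theorem List.toggle_map (key : β → γ) (f : α → β) (x : α) (l : List α) :
    List.toggle key (f x) (l.map f) = (List.toggle (key ∘ f) x l).map f := by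
  unfold List.toggle
  have : (∃ y ∈ l.map f, key y = key (f x)) ↔ ∃ y ∈ l, (key ∘ f) y = (key ∘ f) x := by simp
  by_cases h : ∃ y ∈ l, (key ∘ f) y = (key ∘ f) x
  · rw [if_pos h, if_pos (this.2 h), List.eraseP_map]
    rfl
  · rw [if_neg h, if_neg (mt this.1 h), List.map_cons]

theorem List.foldr_toggle_map (key : β → γ) (f : α → β) (l : List α) :
    (l.map f).foldr (List.toggle key) [] = (l.foldr (List.toggle (key ∘ f)) []).map f := by
  induction l with
  | nil => rfl
  | cons x l ih => rw [List.map_cons, List.foldr_cons, ih, List.toggle_map, List.foldr_cons]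

theorem List.eraseP_eq_filter_of_pairwise {key : α → β} {l : List α}
    (hl : l.Pairwise fun x y => key x ≠ key y) (b : β) :
    l.eraseP (fun y => key y = b) = l.filter fun y => key y ≠ b := by
  induction l with
  | nil => rfl
  | cons x l ih =>
    rw [List.pairwise_cons] at hl
    by_cases hx : key x = b
    · rw [List.eraseP_cons_of_pos (by simpa using hx), List.filter_cons_of_neg (by simpa using hx),
        List.filter_eq_self.2]
      intro y hy
      have := hl.1 y hy
      rw [hx] at this
      simpa using this.symm
    · rw [List.eraseP_cons_of_neg (by simpa using hx), List.filter_cons_of_pos (by simpa using hx),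
        ih hl.2]

theorem List.pairwise_foldr_toggle (key : α → β) (l : List α) :
    (l.foldr (List.toggle key) []).Pairwise fun x y => key x ≠ key y := by
  induction l with
  | nil => exact List.Pairwise.nil
  | cons x l ih =>
    rw [List.foldr_cons, List.toggle]
    split_ifs with h
    · exact ih.sublist List.eraseP_sublist
    · push Not at h
      exact List.Pairwise.cons (fun y hy => (h y hy).symm) ih

/-- Each element with key `b` switches the presence of this key. The keys in the list stay distinct,
so one removal makes the key disappear. -/
theorem List.exists_mem_foldr_toggle (key : α → β) (l : List α) (b : β) :
    (∃ y ∈ l.foldr (List.toggle key) [], key y = b) ↔ Odd (l.countP fun y => key y = b) := by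
  induction l with
  | nil => simp
  | cons x l ih =>
    rw [List.foldr_cons, List.toggle, List.countP_cons]
    by_cases h : ∃ y ∈ l.foldr (List.toggle key) [], key y = key x
    · rw [if_pos h, List.eraseP_eq_filter_of_pairwise (List.pairwise_foldr_toggle key l)]
      by_cases hx : key x = b
      · subst hx
        have := ih.1 h
        simp [Nat.odd_add_one, this]
      · simp only [hx, decide_false, Bool.false_eq_true, if_false, add_zero, ← ih,
          List.mem_filter, decide_eq_true_eq, ne_eq]
        constructor
        · rintro ⟨y, hy, e⟩
          exact ⟨y, hy.1, e⟩
        · rintro ⟨y, hy, e⟩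
          exact ⟨y, ⟨hy, fun e' => hx (e'.symm.trans e)⟩, e⟩
    · rw [if_neg h]
      by_cases hx : key x = b
      · subst hx
        have := (not_congr ih).1 h
        simp [Nat.odd_add_one, this]
      · simp [hx, ← ih]

/-- Among the positions from `k` to `n - 1`, an odd number has the same key as `i`, and `i` is the
first one of them. -/
def Alive (h : ℕ → β) (n k i : ℕ) : Prop :=
  Even (Nat.count (fun j => i < j ∧ h j = h i) n) ∧ ∀ j, k ≤ j → j < i → h j ≠ h i

theorem count_eq_countP_range' (h : ℕ → β) (k m : ℕ) :
    Nat.count (fun j => k < j ∧ h j = h k) (k + 1 + m) =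
      (List.range' (k + 1) m).countP fun j => h j = h k := by
  induction m with
  | zero =>
    rw [Nat.count_iff_forall_not.2]
    · rfl
    · rintro j hj ⟨hj', -⟩
      omega
  | succ m ih =>
    rw [← add_assoc, Nat.count_succ, ih, List.range'_concat, List.countP_append]
    simp [show k < k + 1 + m by omega]

/-- The fold runs from right to left. Position `i` is inserted if an even number of later positions
has its key, and it is deleted by the next position with this key further left, if there is one. -/
theorem foldr_toggle_range' (h : ℕ → β) (k m : ℕ) :
    (List.range' k m).foldr (List.toggle h) [] = (List.range' k m).filter (Alive h (k + m) k) := by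
  induction m generalizing k with
  | zero => rfl
  | succ m ih =>
    have e : k + (m + 1) = k + 1 + m := by ring
    rw [List.range'_succ, List.foldr_cons, List.toggle]
    have hex := List.exists_mem_foldr_toggle h (List.range' (k + 1) m) (h k)
    rw [← count_eq_countP_range'] at hex
    have hk : Alive h (k + (m + 1)) k k ↔
        ¬ ∃ y ∈ (List.range' (k + 1) m).foldr (List.toggle h) [], h y = h k := by
      rw [hex, Nat.not_odd_iff_even, e]
      exact and_iff_left fun j hj hj' => by omega
    have hal : ∀ i ∈ List.range' (k + 1) m, Alive h (k + (m + 1)) k i ↔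
        Alive h (k + 1 + m) (k + 1) i ∧ h i ≠ h k := by
      intro i hi
      rw [List.mem_range'_1] at hi
      rw [Alive, Alive, e, and_assoc]
      refine and_congr_right fun _ => ⟨fun H => ⟨fun j hj => H j (by omega),
        (H k le_rfl (by omega)).symm⟩, fun H j hj hji => ?_⟩
      rcases hj.eq_or_lt with rfl | hj
      · exact H.2.symm
      · exact H.1 j hj hji
    split_ifs with hc
    · rw [List.filter_cons_of_neg (by simpa using fun H => hk.1 H hc),
        List.eraseP_eq_filter_of_pairwise (List.pairwise_foldr_toggle h _), ih, List.filter_filter]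
      refine List.filter_congr fun i hi => ?_
      rw [← Bool.decide_and, decide_eq_decide, hal i hi, and_comm]
    · rw [List.filter_cons_of_pos (by simpa using hk.2 hc), ih]
      congr 1
      refine List.filter_congr fun i hi => ?_
      rw [decide_eq_decide, hal i hi]
      refine (and_iff_left_of_imp fun H hik => ?_).symm
      rw [ih] at hc
      exact hc ⟨i, List.mem_filter.2 ⟨hi, by simpa using H⟩, hik⟩

end Toggle

/-! ### The positions of a word that survive reduction -/

namespace CommAlphabet

variable {Γ : Type*} (A : CommAlphabet Γ) [DecidableEq Γ]

/-- The hyperplane that the word `w` crosses at the position `i`; the letter `a` is a default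
value. -/
noncomputable def hypAt (w : List Γ) (a : Γ) (i : ℕ) : Sym2 Γ × Sym2 (Γ → ℤ) :=
  A.hyp (w.getD i a) (wordValue A.perm (w.drop (i + 1)))

theorem crossings_eq_map (w : List Γ) (a : Γ) :
    A.crossings w = (List.range w.length).map fun i => (w.getD i a, A.hypAt w a i) := by
  induction w with
  | nil => rfl
  | cons c w ih =>
    rw [crossings, ih, List.length_cons, List.range_succ_eq_map, List.map_cons, List.map_map]
    rfl

open Classical in
/-- The reduced word consists of the letters at the positions that remain alive. -/
theorem reduce_eq_map_filter (w : List Γ) (a : Γ) :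
    A.reduce w = ((List.range w.length).filter (Alive (A.hypAt w a) w.length 0)).map
      fun i => w.getD i a := by
  have h := A.crossings_reduce w
  rw [A.crossings_eq_map w a, List.foldr_toggle_map, List.range_eq_range'] at h
  have e : (Prod.snd ∘ fun i => (w.getD i a, A.hypAt w a i)) = A.hypAt w a := rfl
  rw [e, foldr_toggle_range', zero_add] at h
  have := congrArg (List.map Prod.fst) h
  rw [map_fst_crossings, List.map_map] at this
  rw [this, List.range_eq_range']
  rfl

end CommAlphabet

/-! ### Recognizing integers by their residues -/

theorem Nat.two_pow_le_centralBinom (t : ℕ) : 2 ^ t ≤ t.centralBinom := by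
  induction t with
  | zero => simp
  | succ t ih =>
    have h := Nat.succ_mul_centralBinom_succ t
    have h1 : (t + 1) * 2 ^ (t + 1) ≤ 2 * (2 * t + 1) * t.centralBinom := by
      calc (t + 1) * 2 ^ (t + 1) = 2 * (t + 1) * 2 ^ t := by ring
        _ ≤ 2 * (2 * t + 1) * t.centralBinom := Nat.mul_le_mul (by omega) ih
    rw [← h] at h1
    exact Nat.le_of_mul_le_mul_left h1 t.succ_pos

/-- Every prime power dividing the central binomial coefficient of `t` is at most `2 * t`, so the
coefficient divides `x`; but it is at least `2 ^ t`. -/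
theorem Nat.eq_zero_of_forall_dvd {x t : ℕ} (hx : x < 2 ^ t)
    (h : ∀ m, 2 ≤ m → m ≤ 2 * t → m ∣ x) : x = 0 := by
  refine Nat.eq_zero_of_dvd_of_lt ?_ (hx.trans_le t.two_pow_le_centralBinom)
  refine (Nat.dvd_iff_prime_pow_dvd_dvd _ _).2 fun p k hp hpk => ?_
  rcases Nat.eq_zero_or_pos k with rfl | hk
  · simp
  refine h _ ((hp.two_le).trans (Nat.le_self_pow hk.ne' p)) ?_
  have h1 : k ≤ t.centralBinom.factorization p :=
    (hp.pow_dvd_iff_le_factorization t.centralBinom_ne_zero).1 hpk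
  calc p ^ k ≤ p ^ (t.centralBinom.factorization p) := Nat.pow_le_pow_right hp.pos h1
    _ ≤ 2 * t := by
      have ht : 0 < t := by
        rcases Nat.eq_zero_or_pos t with rfl | ht
        · simp at h1; omega
        · exact ht
      exact Nat.pow_factorization_choose_le (by omega)

theorem Int.eq_of_forall_natCast_zmod_eq {x y : ℤ} {t : ℕ} (h : |x - y| < 2 ^ t)
    (hm : ∀ m : ℕ, 2 ≤ m → m ≤ 2 * t → (x : ZMod m) = y) : x = y := by
  have : (x - y).natAbs = 0 := by
    refine Nat.eq_zero_of_forall_dvd (t := t) ?_ fun m h2 hmt => ?_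
    · zify
      exact h
    · have := hm m h2 hmt
      rw [ZMod.intCast_eq_intCast_iff_dvd_sub] at this
      rw [← Int.natCast_dvd, ← dvd_neg, neg_sub]
      exact this
  omega

/-! ### Subtraction modulo a number -/

/-- Simultaneous increase of two residues modulo `m`, unless the second one is zero. -/
def subModStep (m : ℕ) (s : Bool → ℕ) (b : Bool) : ℕ :=
  if s true = 0 then s b else if s b + 1 = m then 0 else s b + 1

/-- The residue of `x - y` modulo `m`, if `m ≤ T`. -/
def subMod (T m x y : ℕ) : ℕ := (subModStep m)^[T] (fun b => bif b then y else x) false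

/-- Increasing both residues together keeps their difference. Once the second wraps around to zero,
the first one is the difference. -/
theorem subMod_spec {T m x y : ℕ} (hT : m ≤ T) (hx : x < m) (hy : y < m) :
    subMod T m x y < m ∧ (subMod T m x y : ZMod m) = x - y := by
  have key : ∀ t, let s := (subModStep m)^[t] (fun b => bif b then y else x)
      (∀ b, s b < m) ∧ ((s false : ZMod m) - s true = x - y) ∧ (s true = 0 ∨ s true = y + t) := by
    intro t
    induction t with
    | zero => exact ⟨by rintro (_ | _) <;> assumption, rfl, Or.inr rfl⟩
    | succ t ih =>
      rw [Function.iterate_succ_apply']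
      generalize (subModStep m)^[t] (fun b => bif b then y else x) = s at ih
      obtain ⟨h1, h2, h3⟩ := ih
      by_cases h0 : s true = 0
      · have e : subModStep m s = s := funext fun b => by simp [subModStep, h0]
        rw [e]
        exact ⟨h1, h2, Or.inl h0⟩
      · have hlt : ∀ b, subModStep m s b < m := fun b => by
          have := h1 b
          simp only [subModStep, h0, if_false]
          split_ifs <;> omega
        have hc : ∀ b, (subModStep m s b : ZMod m) = s b + 1 := fun b => by
          simp only [subModStep, h0, if_false]
          split_ifs with h
          · have := congrArg (Nat.cast (R := ZMod m)) h
            simpa using this.symm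
          · simp
        refine ⟨hlt, by rw [hc, hc, ← h2]; ring, ?_⟩
        simp only [subModStep, h0, if_false]
        split_ifs
        · exact Or.inl rfl
        · right
          have := h3.resolve_left h0
          omega
  obtain ⟨h1, h2, h3⟩ := key T
  -- Without a wrap-around the second residue would be `y + T ≥ m`.
  have h0 := h3.resolve_right (by have := h1 true; omega)
  refine ⟨h1 false, ?_⟩
  rw [← h2, h0]
  simp [subMod]

section NumberFunctions

variable {Γ : Type*} {P : Type*} [Finite P]

theorem LogFun.subMod {m x y : List Γ → (P → ℕ) → ℕ} (hm : LogFun m) (hx : LogFun x)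
    (hy : LogFun y) (K c : ℕ) :
    LogFun fun w v => subMod (K * w.length + c) (m w v) (x w v) (y w v) := by
  have h0 := LogFun.iterate_linear (Γ := Γ) (P := Fin 3) (Q := Bool)
    (init := fun _ v b => bif b then v 2 else v 1)
    (step := fun _ v b => if v (.inr true) = 0 then v (.inr b) else
      if v (.inr b) + 1 = v (.inl 0) then 0 else v (.inr b) + 1)
    (by rintro (_ | _) <;> exact LogFun.proj _)
    (fun b => LogFun.ite (LogPred.eq (LogFun.proj _) LogFun.zero) (LogFun.proj _)
      (LogFun.ite (LogPred.eq (LogFun.proj _).succ (LogFun.proj _)) LogFun.zero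
        (LogFun.proj _).succ)) K c false
  exact h0.comp (h := fun w v => ![m w v, x w v, y w v]) (by
    intro q
    fin_cases q <;> assumption)

theorem LogFun.letterElim [Finite Γ] {f g₀ : List Γ → (P → ℕ) → ℕ}
    {g : Γ → List Γ → (P → ℕ) → ℕ} (hf : LogFun f) (hg₀ : LogFun g₀) (hg : ∀ a, LogFun (g a)) :
    LogFun fun w v => (w[f w v]?).elim (g₀ w v) fun a => g a w v := by
  classical
  have := Fintype.ofFinite Γ
  have key : ∀ l : List Γ, LogFun fun w v => if ∃ a ∈ l, w[f w v]? = some a then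
      (w[f w v]?).elim (g₀ w v) fun a => g a w v else g₀ w v := by
    intro l
    induction l with
    | nil => exact hg₀.congr (by simp)
    | cons a l ih =>
      refine (LogFun.ite (LogPred.letter hf a) (hg a) ih).congr fun w v => ?_
      by_cases h : w[f w v]? = some a
      · simp [h]
      · simp [h]
  refine (key Finset.univ.toList).congr fun w v => ?_
  cases h : w[f w v]? <;> simp

end NumberFunctions

namespace CommAlphabet

variable {Γ : Type*} (A : CommAlphabet Γ) [DecidableEq Γ]

/-- Inversion reverses the word, so coset vectors are computed in one pass over the input from left
to right. -/
theorem wordValue_perm_inv (l : List Γ) (f : Γ → ℤ) :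
    (wordValue A.perm l)⁻¹ f = l.foldl (fun f a => A.act (A.inv a) f) f := by
  induction l generalizing f with
  | nil => rfl
  | cons a l ih =>
    rw [wordValue_cons, mul_inv_rev, Equiv.Perm.mul_apply, ih]
    rfl

/-! #### The growth of the vectors -/

theorem abs_fire_le {B : ℤ} {f : Γ → ℤ} (h : ∀ d, |f d| ≤ B) (b d : Γ) : |A.fire b f d| ≤ 3 * B := by
  have h1 := abs_le.1 (h b)
  have h2 := abs_le.1 (h d)
  unfold fire
  rw [abs_le]
  split_ifs <;> constructor <;> linarith

theorem abs_act_le {B : ℤ} {f : Γ → ℤ} (h : ∀ d, |f d| ≤ B) (c d : Γ) : |A.act c f d| ≤ 9 * B := by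
  have h0 := (abs_nonneg _).trans (h d)
  unfold act
  split_ifs
  · exact (A.abs_fire_le h c d).trans (by linarith)
  · exact (A.abs_fire_le (A.abs_fire_le h _) c d).trans (by linarith)

theorem abs_foldl_act_le (l : List Γ) {B : ℤ} {f : Γ → ℤ} (h : ∀ d, |f d| ≤ B) (d : Γ) :
    |l.foldl (fun f a => A.act (A.inv a) f) f d| ≤ 9 ^ l.length * B := by
  induction l generalizing f B with
  | nil => simpa using h d
  | cons a l ih =>
    refine (ih (f := A.act (A.inv a) f) (A.abs_act_le h _)).trans_eq ?_
    rw [List.length_cons]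
    ring

theorem abs_cosetVec_le (c : Γ) (l : List Γ) (d : Γ) :
    |A.cosetVec c (wordValue A.perm l) d| ≤ 9 ^ l.length := by
  rw [cosetVec, wordValue_perm_inv]
  refine (A.abs_foldl_act_le l (B := 1) (fun b => ?_) d).trans_eq (mul_one _)
  unfold linkVec
  split_ifs <;> simp

theorem cosetVec_eq_iff_forall_zmod {n : ℕ} (c : Γ) {l l' : List Γ} (hl : l.length ≤ n)
    (hl' : l'.length ≤ n) :
    A.cosetVec c (wordValue A.perm l) = A.cosetVec c (wordValue A.perm l') ↔
      ∀ t < 8 * n + 8, ∀ b, (A.cosetVec c (wordValue A.perm l) b : ZMod (t + 2)) =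
        A.cosetVec c (wordValue A.perm l') b := by
  refine ⟨fun h t _ b => by rw [h], fun h => funext fun b => ?_⟩
  -- The difference is at most `2 * 9 ^ n < 16 * 16 ^ n = 2 ^ (4 * n + 4)`.
  refine Int.eq_of_forall_natCast_zmod_eq (t := 4 * n + 4) ?_ fun m h2 hm => ?_
  · have h9 : ∀ {k}, k ≤ n → (9 : ℤ) ^ k ≤ 9 ^ n := fun h => pow_le_pow_right₀ (by norm_num) h
    have h1 := (A.abs_cosetVec_le c l b).trans (h9 hl)
    have h2 := (A.abs_cosetVec_le c l' b).trans (h9 hl')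
    have h3 : (9 : ℤ) ^ n ≤ 16 ^ n := pow_le_pow_left₀ (by norm_num) (by norm_num) n
    have h4 : (2 : ℤ) ^ (4 * n + 4) = 16 * 16 ^ n := by
      rw [pow_add, pow_mul]
      norm_num
      ring
    have h5 := abs_sub (A.cosetVec c (wordValue A.perm l) b) (A.cosetVec c (wordValue A.perm l') b)
    have h6 : (0 : ℤ) < 16 ^ n := by positivity
    rw [h4]
    linarith
  · obtain ⟨t, rfl⟩ := Nat.exists_eq_add_of_le' h2
    exact h t (by omega) b

/-! #### The vectors modulo a number -/

open Classical in
/-- The action `fire` on residues modulo `m`. -/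
noncomputable def fireMod (T m : ℕ) (b : Γ) (f : Γ → ℕ) (d : Γ) : ℕ :=
  if d = b then subMod T m 0 (f b) else if A.Comm d b then f d else
    subMod T m (subMod T m (f d) (subMod T m 0 (f b))) (subMod T m 0 (f b))

/-- The action `act` on residues modulo `m`. -/
noncomputable def actMod (T m : ℕ) (c : Γ) (f : Γ → ℕ) : Γ → ℕ :=
  if A.inv c = c then A.fireMod T m c f else A.fireMod T m c (A.fireMod T m (A.inv c) f)

/-- The entries of `f` are the residues modulo `m` of the entries of `F`. -/
def IsResidue (m : ℕ) (F : Γ → ℤ) (f : Γ → ℕ) : Prop := ∀ b, f b < m ∧ (f b : ZMod m) = F b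

-- With subtraction as the only operation, `f d + 2 * f b` is obtained by subtracting `- f b` twice.
variable {A} in
theorem IsResidue.fire {T m : ℕ} (hT : m ≤ T) {F : Γ → ℤ} {f : Γ → ℕ} (h : IsResidue m F f) (b : Γ) :
    IsResidue m (A.fire b F) (A.fireMod T m b f) := by
  intro d
  obtain ⟨h1, h2⟩ := subMod_spec hT ((Nat.zero_le _).trans_lt (h b).1) (h b).1
  obtain ⟨h3, h4⟩ := subMod_spec hT (h d).1 h1
  obtain ⟨h5, h6⟩ := subMod_spec hT h3 h1
  unfold fireMod CommAlphabet.fire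
  split_ifs
  · exact ⟨h1, by rw [h2, (h b).2]; simp⟩
  · exact h d
  · refine ⟨h5, ?_⟩
    rw [h6, h4, h2, (h b).2, (h d).2]
    push_cast
    ring

variable {A} in
theorem IsResidue.act {T m : ℕ} (hT : m ≤ T) {F : Γ → ℤ} {f : Γ → ℕ} (h : IsResidue m F f) (c : Γ) :
    IsResidue m (A.act c F) (A.actMod T m c f) := by
  unfold CommAlphabet.act actMod
  split_ifs
  · exact h.fire hT c
  · exact (h.fire hT _).fire hT c

open Classical in
/-- The initial state in the computation of `cosetVec`; the component `none` is a position in the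
word. -/
noncomputable def vecInit (T : ℕ) (c : Γ) (m i : ℕ) : Option Γ → ℕ
  | none => i
  | some b => if A.Comm b c then 0 else subMod T m 0 1

/-- A step in the computation of `cosetVec`. -/
noncomputable def vecStep (T : ℕ) (w : List Γ) (m : ℕ) (s : Option Γ → ℕ) : Option Γ → ℕ
  | none => s none + 1
  | some b => (w[s none]?).elim (s (some b)) fun a => A.actMod T m (A.inv a) (s ∘ some) b

/-- The residues modulo `m` of the vector `cosetVec` of a final segment of the word `w`. -/
noncomputable def vecMod (w : List Γ) (c : Γ) (m i : ℕ) (b : Γ) : ℕ :=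
  (A.vecStep (8 * w.length + 9) w m)^[w.length] (A.vecInit (8 * w.length + 9) c m i) (some b)

/-- After `t` steps the first `t` letters of the final segment have acted. Beyond the end of the
word a step changes only the position, so `w.length` steps are right for every `i`. -/
theorem isResidue_vecMod (w : List Γ) (c : Γ) {m : ℕ} (h2 : 2 ≤ m) (hm : m ≤ 8 * w.length + 9)
    (i : ℕ) :
    IsResidue m (A.cosetVec c (wordValue A.perm (w.drop i))) (A.vecMod w c m i) := by
  have key : ∀ t s, (A.vecStep (8 * w.length + 9) w m)^[t] (A.vecInit (8 * w.length + 9) c m i) = s →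
      s none = i + t ∧ IsResidue m (((w.drop i).take t).foldl (fun f a => A.act (A.inv a) f)
        (A.linkVec c)) (s ∘ some) := by
    intro t
    induction t with
    | zero =>
      rintro _ rfl
      refine ⟨rfl, fun b => ?_⟩
      obtain ⟨h3, h4⟩ := subMod_spec hm (x := 0) (y := 1) (by omega) (by omega)
      by_cases hb : A.Comm b c
      · simp only [Function.iterate_zero, id, Function.comp_apply, vecInit, hb, if_true,
          List.take_zero, List.foldl_nil, linkVec]
        exact ⟨by omega, by simp⟩
      · simp only [Function.iterate_zero, id, Function.comp_apply, vecInit, hb, if_false,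
          List.take_zero, List.foldl_nil, linkVec]
        exact ⟨h3, by rw [h4]; simp⟩
    | succ t ih =>
      rintro _ rfl
      rw [Function.iterate_succ_apply']
      obtain ⟨h3, h4⟩ := ih _ rfl
      generalize (A.vecStep (8 * w.length + 9) w m)^[t] (A.vecInit (8 * w.length + 9) c m i) = s
        at h3 h4 ⊢
      refine ⟨congrArg (· + 1) h3, ?_⟩
      have e : A.vecStep (8 * w.length + 9) w m s ∘ some = (w[i + t]?).elim (s ∘ some) fun a =>
          A.actMod (8 * w.length + 9) m (A.inv a) (s ∘ some) := by
        funext b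
        simp only [Function.comp_apply, vecStep, h3]
        cases w[i + t]? <;> rfl
      rw [e, List.take_add_one, List.foldl_append, List.getElem?_drop]
      cases w[i + t]? with
      | none => exact h4
      | some a => exact h4.act hm _
  obtain ⟨-, h⟩ := key w.length _ rfl
  rw [List.take_of_length_le (by simp)] at h
  rw [cosetVec, wordValue_perm_inv]
  exact h

theorem cosetVec_drop_eq_iff (w : List Γ) (c : Γ) (i j : ℕ) :
    A.cosetVec c (wordValue A.perm (w.drop i)) = A.cosetVec c (wordValue A.perm (w.drop j)) ↔
      ∀ t < 8 * w.length + 8, ∀ b, A.vecMod w c (t + 2) i b = A.vecMod w c (t + 2) j b := by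
  rw [A.cosetVec_eq_iff_forall_zmod (n := w.length) c (by simp) (by simp)]
  refine forall₂_congr fun t ht => forall_congr' fun b => ?_
  obtain ⟨h1, h2⟩ := A.isResidue_vecMod w c (m := t + 2) (by omega) (by omega) i b
  obtain ⟨h3, h4⟩ := A.isResidue_vecMod w c (m := t + 2) (by omega) (by omega) j b
  rw [← h2, ← h4, ZMod.natCast_eq_natCast_iff, Nat.ModEq, Nat.mod_eq_of_lt h1, Nat.mod_eq_of_lt h3]

/-! ### Comparing coset vectors in logarithmic space -/

section LogFun

variable {P : Type*} [Finite P]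

theorem logFun_fireMod {m : List Γ → (P → ℕ) → ℕ} {f : Γ → List Γ → (P → ℕ) → ℕ} (hm : LogFun m)
    (hf : ∀ b, LogFun (f b)) (K k : ℕ) (b d : Γ) :
    LogFun fun w v => A.fireMod (K * w.length + k) (m w v) b (fun d => f d w v) d := by
  have hneg := LogFun.subMod hm LogFun.zero (hf b) K k
  unfold fireMod
  split_ifs
  · exact hneg
  · exact hf d
  · exact LogFun.subMod hm (LogFun.subMod hm (hf d) hneg K k) hneg K k

theorem logFun_actMod {m : List Γ → (P → ℕ) → ℕ} {f : Γ → List Γ → (P → ℕ) → ℕ} (hm : LogFun m)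
    (hf : ∀ b, LogFun (f b)) (K k : ℕ) (c d : Γ) :
    LogFun fun w v => A.actMod (K * w.length + k) (m w v) c (fun d => f d w v) d := by
  unfold actMod
  split_ifs
  · exact A.logFun_fireMod hm hf K k c d
  · exact A.logFun_fireMod hm (fun b => A.logFun_fireMod hm hf K k _ b) K k c d

variable [Finite Γ]

theorem logFun_vecMod {m i : List Γ → (P → ℕ) → ℕ} (hm : LogFun m) (hi : LogFun i) (c b : Γ) :
    LogFun fun w v => A.vecMod w c (m w v) (i w v) b := by
  have hinit : ∀ q, LogFun fun (w : List Γ) (v : Bool → ℕ) =>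
      A.vecInit (8 * w.length + 9) c (v false) (v true) q := by
    rintro (_ | b)
    · exact LogFun.proj true
    · by_cases h : A.Comm b c
      · simpa only [vecInit, h, if_true] using LogFun.zero
      · simpa only [vecInit, h, if_false] using
          LogFun.subMod (LogFun.proj false) LogFun.zero LogFun.one 8 9
  have hstep : ∀ q, LogFun fun (w : List Γ) (v : Bool ⊕ Option Γ → ℕ) =>
      A.vecStep (8 * w.length + 9) w (v (.inl false)) (v ∘ Sum.inr) q := by
    rintro (_ | b)
    · exact (LogFun.proj (Sum.inr none)).succ
    · have hact : ∀ a, LogFun fun (w : List Γ) (v : Bool ⊕ Option Γ → ℕ) =>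
          A.actMod (8 * w.length + 9) (v (.inl false)) (A.inv a) (fun d => v (.inr (some d))) b :=
        fun a => A.logFun_actMod (m := fun _ v => v (Sum.inl false))
          (f := fun b _ v => v (Sum.inr (some b))) (LogFun.proj _) (fun b => LogFun.proj _) 8 9 _ b
      exact LogFun.letterElim (LogFun.proj (Sum.inr none)) (LogFun.proj (Sum.inr (some b))) hact
  have h0 := LogFun.iterate_linear hinit hstep 1 0 (some b)
  refine (h0.comp (h := fun w v b => bif b then i w v else m w v) (by
    rintro (_ | _) <;> assumption)).congr fun w v => ?_
  rw [one_mul, add_zero]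
  rfl

theorem logPred_cosetVec_eq {f g : List Γ → (P → ℕ) → ℕ} (hf : LogFun f) (hg : LogFun g) (c : Γ) :
    LogPred fun w v => A.cosetVec c (wordValue A.perm (w.drop (f w v))) =
      A.cosetVec c (wordValue A.perm (w.drop (g w v))) := by
  have hl : ∀ {h : List Γ → (P → ℕ) → ℕ}, LogFun h →
      LogFun fun w (v : P ⊕ Unit → ℕ) => h w (v ∘ Sum.inl) := fun hh =>
    hh.comp (h := fun _ v => v ∘ Sum.inl) fun i => LogFun.proj _
  refine (LogPred.forall_lt (p := fun w v t => ∀ b, A.vecMod w c (t + 2) (f w v) b =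
    A.vecMod w c (t + 2) (g w v) b) (LogPred.forall_finite fun b => LogPred.eq
      (A.logFun_vecMod (LogFun.proj _).succ.succ (hl hf) c b)
      (A.logFun_vecMod (LogFun.proj _).succ.succ (hl hg) c b)) 8 8).congr fun w v => ?_
  exact (A.cosetVec_drop_eq_iff w c _ _).symm

end LogFun

end CommAlphabet

/-! ### Computing shortlex normal forms -/

theorem LogFun.liftParam {Γ P : Type*} [Finite P] {f : List Γ → (P → ℕ) → ℕ} (hf : LogFun f)
    (Q : Type*) [Finite Q] : LogFun fun w (v : P ⊕ Q → ℕ) => f w (v ∘ Sum.inl) :=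
  hf.comp (h := fun _ v => v ∘ Sum.inl) fun i => LogFun.proj (Sum.inl i)

theorem Nat.count_congr_of_lt {p q : ℕ → Prop} {_ : DecidablePred p}
    {_ : DecidablePred q} {n : ℕ}
    (h : ∀ j < n, p j ↔ q j) : Nat.count p n = Nat.count q n := by
  induction n with
  | zero => simp
  | succ n ih =>
    rw [Nat.count_succ, Nat.count_succ, ih fun j hj => h j (hj.trans n.lt_succ_self)]
    simp only [h n n.lt_succ_self]

namespace CommAlphabet

/-! ### Deciding which positions survive -/

section Alive

variable {Γ : Type*} (A : CommAlphabet Γ) [DecidableEq Γ]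

theorem hypAt_eq_of_getElem? {w : List Γ} {a c : Γ} {i : ℕ} (h : w[i]? = some c) :
    A.hypAt w a i = (s(c, A.inv c), s(A.cosetVec c (wordValue A.perm (w.drop (i + 1))),
      A.cosetVec c (wordValue A.perm (w.drop i)))) := by
  obtain ⟨hi, hc⟩ := List.getElem?_eq_some_iff.1 h
  have h1 : w.drop i = c :: w.drop (i + 1) := by rw [List.drop_eq_getElem_cons hi, hc]
  rw [hypAt, List.getD_eq_getElem?_getD, h, h1, wordValue_cons]
  rfl

/-- Up to a test on the two letters, hyperplanes are compared through coset vectors of final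
segments of the input, which `logPred_cosetVec_eq` can decide. -/
theorem hypAt_eq_hypAt_iff {w : List Γ} {a c d : Γ} {i j : ℕ} (hi : w[i]? = some c)
    (hj : w[j]? = some d) : A.hypAt w a i = A.hypAt w a j ↔ (d = c ∨ d = A.inv c) ∧
      (A.cosetVec c (wordValue A.perm (w.drop (i + 1))) =
          A.cosetVec c (wordValue A.perm (w.drop (j + 1))) ∧
        A.cosetVec c (wordValue A.perm (w.drop i)) = A.cosetVec c (wordValue A.perm (w.drop j)) ∨
      A.cosetVec c (wordValue A.perm (w.drop (i + 1))) =
          A.cosetVec c (wordValue A.perm (w.drop j)) ∧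
        A.cosetVec c (wordValue A.perm (w.drop i)) =
          A.cosetVec c (wordValue A.perm (w.drop (j + 1)))) := by
  rw [A.hypAt_eq_of_getElem? hi, A.hypAt_eq_of_getElem? hj, Prod.mk.injEq]
  have h1 : s(c, A.inv c) = s(d, A.inv d) ↔ d = c ∨ d = A.inv c := by
    rw [Sym2.eq_iff]
    constructor
    · rintro (⟨h, -⟩ | ⟨-, h⟩)
      exacts [Or.inl h.symm, Or.inr h.symm]
    · rintro (rfl | rfl)
      exacts [Or.inl ⟨rfl, rfl⟩, Or.inr ⟨(A.inv_inv c).symm, rfl⟩]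
  rw [h1]
  refine and_congr_right fun h => ?_
  have h2 : A.cosetVec d = A.cosetVec c := by
    rcases h with rfl | rfl
    · rfl
    · exact funext fun g => A.cosetVec_inv c g
  rw [h2, Sym2.eq_iff]

variable {P : Type*} [Finite P] [Finite Γ]

theorem logPred_hypAt_eq (a : Γ) {f g : List Γ → (P → ℕ) → ℕ} (hf : LogFun f) (hg : LogFun g) :
    LogPred fun w v => f w v < w.length ∧ g w v < w.length ∧
      A.hypAt w a (f w v) = A.hypAt w a (g w v) := by
  refine (LogPred.exists_finite fun c => LogPred.exists_finite fun d =>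
    (LogPred.letter hf c).and ((LogPred.letter hg d).and ((LogPred.const (d = c ∨ d = A.inv c)).and
      (((A.logPred_cosetVec_eq hf.succ hg.succ c).and (A.logPred_cosetVec_eq hf hg c)).or
        ((A.logPred_cosetVec_eq hf.succ hg c).and
          (A.logPred_cosetVec_eq hf hg.succ c)))))).congr fun w v => ?_
  constructor
  · rintro ⟨c, d, hi, hj, h⟩
    exact ⟨(List.getElem?_eq_some_iff.1 hi).1, (List.getElem?_eq_some_iff.1 hj).1,
      (A.hypAt_eq_hypAt_iff hi hj).2 h⟩
  · rintro ⟨hi, hj, h⟩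
    exact ⟨_, _, List.getElem?_eq_getElem hi, List.getElem?_eq_getElem hj,
      (A.hypAt_eq_hypAt_iff (List.getElem?_eq_getElem hi) (List.getElem?_eq_getElem hj)).1 h⟩

open Classical in
theorem logPred_alive (a : Γ) {f : List Γ → (P → ℕ) → ℕ} (hf : LogFun f) :
    LogPred fun w v => f w v < w.length ∧ Alive (A.hypAt w a) w.length 0 (f w v) := by
  have hj : LogFun fun (_ : List Γ) (v : P ⊕ Unit → ℕ) => v (.inr ()) := LogFun.proj _
  have hf' := hf.liftParam Unit
  have h1 := LogPred.even_count (p := fun w v j => (f w v < 1 * w.length + 0 ∧ f w v < j) ∧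
    j < w.length ∧ f w v < w.length ∧ A.hypAt w a j = A.hypAt w a (f w v))
    ((LogPred.lt hf' hj 1 0).and (A.logPred_hypAt_eq a hj hf')) 1 0
  have h2 := LogPred.forall_lt (p := fun w v j => (j < 1 * w.length + 0 ∧ j < f w v) →
    ¬ (j < w.length ∧ f w v < w.length ∧ A.hypAt w a j = A.hypAt w a (f w v)))
    ((LogPred.lt hj hf' 1 0).imp (A.logPred_hypAt_eq a hj hf').not) 1 0
  refine ((LogPred.lt_length hf).and (h1.and h2)).congr fun w v => and_congr_right fun hi => ?_
  simp only [one_mul, add_zero]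
  unfold Alive
  refine and_congr ?_ ⟨fun h j _ hj e => h j (hj.trans hi) ⟨hj.trans hi, hj⟩ ⟨hj.trans hi, hi, e⟩,
    fun h j _ hj e => h j (Nat.zero_le j) hj.2 e.2.2⟩
  refine iff_of_eq (congrArg Even (Nat.count_congr_of_lt fun j hj => ?_))
  exact ⟨fun h => ⟨h.1.2, h.2.2.2⟩, fun h => ⟨⟨hi, h.1⟩, hj, hi, h.2⟩⟩

end Alive

/-! ### Greedy output with one threshold per letter -/

section Output

variable {Γ : Type*} (A : CommAlphabet Γ)

theorem exists_front {l : List Γ} (hl : l ≠ []) : ∃ a, A.Front a l := by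
  obtain ⟨a, l, rfl⟩ := List.exists_cons_of_ne_nil hl
  exact ⟨a, Or.inl rfl⟩

theorem front_map_iff {x : ℕ → Γ} {a : Γ} {L : List ℕ} (hL : L.Pairwise (· < ·)) :
    A.Front a (L.map x) ↔ ∃ p ∈ L, x p = a ∧ ∀ q ∈ L, q < p → A.Comm (x q) a := by
  induction L with
  | nil => simp [Front]
  | cons q L ih =>
    rw [List.pairwise_cons] at hL
    rw [List.map_cons, Front, ih hL.2]
    constructor
    · rintro (h | ⟨h, p, hp, hpa, hc⟩)
      · refine ⟨q, List.mem_cons_self, h, fun r hr hrq => ?_⟩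
        rcases List.mem_cons.1 hr with rfl | hr
        · exact absurd hrq (lt_irrefl _)
        · exact absurd hrq (hL.1 r hr).not_gt
      · refine ⟨p, List.mem_cons_of_mem _ hp, hpa, fun r hr hrp => ?_⟩
        rcases List.mem_cons.1 hr with rfl | hr
        exacts [h, hc r hr hrp]
    · rintro ⟨p, hp, hpa, hc⟩
      rcases List.mem_cons.1 hp with rfl | hp
      · exact Or.inl hpa
      · exact Or.inr ⟨hc q List.mem_cons_self (hL.1 p hp), p, hp, hpa,
          fun r hr => hc r (List.mem_cons_of_mem _ hr)⟩

/-- The position `p` in the word `x` of length `n` belongs to `alive`, and has not been used, where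
`θ` gives for each letter a bound for the positions used so far. -/
def Remaining (x : ℕ → Γ) (n : ℕ) (alive : ℕ → Prop) (θ : Γ → ℕ) (p : ℕ) : Prop :=
  p < n ∧ alive p ∧ θ (x p) ≤ p

/-- The position `p` is the first remaining position with the letter `a`, and this letter can be
moved to the front. -/
def FrontAt (x : ℕ → Γ) (n : ℕ) (alive : ℕ → Prop) (θ : Γ → ℕ) (a : Γ) (p : ℕ) : Prop :=
  Remaining x n alive θ p ∧ x p = a ∧ ∀ q < n, q < p → Remaining x n alive θ q → A.Comm (x q) a

open Classical in
/-- The word of the remaining letters. -/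
noncomputable def remainingWord (x : ℕ → Γ) (n : ℕ) (alive : ℕ → Prop) (θ : Γ → ℕ) : List Γ :=
  ((List.range n).filter (Remaining x n alive θ)).map x

variable {x : ℕ → Γ} {n : ℕ} {alive : ℕ → Prop} {θ : Γ → ℕ}

theorem front_remainingWord_iff {a : Γ} : A.Front a (remainingWord x n alive θ) ↔
    ∃ p < n, A.FrontAt x n alive θ a p := by
  classical
  rw [remainingWord, A.front_map_iff (List.pairwise_lt_range.filter _)]
  simp only [List.mem_filter, List.mem_range, decide_eq_true_eq]
  constructor
  · rintro ⟨p, ⟨hp, hr⟩, hpa, h⟩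
    exact ⟨p, hp, hr, hpa, fun q hq hqp hqr => h q ⟨hq, hqr⟩ hqp⟩
  · rintro ⟨p, hp, hr, hpa, h⟩
    exact ⟨p, ⟨hp, hr⟩, hpa, fun q hq hqp => h q hq.1 hqp hq.2⟩

variable [LinearOrder Γ]

/-- The letter `a` is the least letter that can be moved to the front. -/
def LeastFront (a : Γ) (l : List Γ) : Prop := A.Front a l ∧ ∀ b < a, ¬ A.Front b l

variable {A} in
theorem LeastFront.eq {a b : Γ} {l : List Γ} (ha : A.LeastFront a l) (hb : A.LeastFront b l) :
    a = b :=
  le_antisymm (not_lt.1 fun h => ha.2 b h hb.1) (not_lt.1 fun h => hb.2 a h ha.1)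

theorem exists_leastFront [Finite Γ] {l : List Γ} (hl : l ≠ []) : ∃ a, A.LeastFront a l := by
  obtain ⟨a, ha, hmin⟩ := (wellFounded_lt (α := Γ)).has_min {a | A.Front a l} (A.exists_front hl)
  exact ⟨a, ha, fun b hb h => hmin b h hb⟩

-- In each round the filter emits exactly the least front letter, which is unique, or nothing once
-- the word is used up; surplus rounds therefore do no harm.
open Classical in
theorem greedy_flatMap [Finite Γ] {σ : Type*} {U : σ → List Γ} {step : σ → σ}
    (h0 : ∀ s, U s = [] → U (step s) = [])
    (h1 : ∀ s a, A.LeastFront a (U s) → U (step s) = (U s).erase a) {l : List Γ} (hl : l.Nodup)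
    (hl' : ∀ a, a ∈ l) (k : ℕ) (s : σ) (hk : (U s).length ≤ k) :
    A.Greedy (U s) ((List.range k).flatMap fun t =>
      l.filter fun a => A.LeastFront a (U (step^[t] s))) := by
  induction k generalizing s with
  | zero =>
    rw [List.length_eq_zero_iff.1 (Nat.le_zero.1 hk)]
    exact .nil
  | succ k ih =>
    have e : ((List.range (k + 1)).flatMap fun t =>
        l.filter fun a => A.LeastFront a (U (step^[t] s))) =
        (l.filter fun a => A.LeastFront a (U s)) ++ (List.range k).flatMap fun t =>
          l.filter fun a => A.LeastFront a (U (step^[t] (step s))) := by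
      rw [List.range_succ_eq_map, List.flatMap_cons, List.flatMap_map]
      rfl
    rw [e]
    by_cases hU : U s = []
    · have h2 : (l.filter fun a => A.LeastFront a (U s)) = [] :=
        List.filter_eq_nil_iff.2 fun a _ h => by
          have := (of_decide_eq_true h).1
          rw [hU] at this
          exact this
      have h3 := ih (step s) (by rw [h0 s hU]; exact Nat.zero_le _)
      rw [h0 s hU] at h3
      rw [h2, hU]
      exact h3
    · obtain ⟨a, ha⟩ := A.exists_leastFront hU
      have h2 : (l.filter fun a => A.LeastFront a (U s)) = [a] := by
        have : (l.filter fun b => A.LeastFront b (U s)) = l.filter (· == a) :=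
          List.filter_congr fun b _ => by
            rw [beq_eq_decide, decide_eq_decide]
            exact ⟨fun h => h.eq ha, fun h => h ▸ ha⟩
        rw [this, List.filter_beq, List.count_eq_one_of_mem hl (hl' a)]
        rfl
      have h3 := ih (step s) (by
        rw [h1 s a ha, List.length_erase_of_mem ha.1.mem]
        omega)
      rw [h1 s a ha] at h3
      rw [h2]
      exact .cons ha.1 ha.2 h3

theorem erase_map {x : ℕ → Γ} {L : List ℕ} (hL : L.Pairwise (· < ·)) {p : ℕ} (hp : p ∈ L)
    (h : ∀ q ∈ L, q < p → x q ≠ x p) :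
    (L.map x).erase (x p) = (L.filter fun q => q ≠ p).map x := by
  induction L with
  | nil => simp at hp
  | cons q L ih =>
    rw [List.pairwise_cons] at hL
    by_cases hqp : q = p
    · subst hqp
      rw [List.map_cons, List.erase_cons_head, List.filter_cons_of_neg (by simp),
        List.filter_eq_self.2]
      intro r hr
      simpa using (hL.1 r hr).ne'
    · have hp' : p ∈ L := (List.mem_cons.1 hp).resolve_left (Ne.symm hqp)
      rw [List.map_cons, List.erase_cons_tail (by
          simpa using h q List.mem_cons_self (hL.1 p hp')),
        ih hL.2 hp' fun r hr => h r (List.mem_cons_of_mem _ hr),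
        List.filter_cons_of_pos (by simpa using hqp), List.map_cons]

/-- A letter does not commute with itself, so no remaining position before `p` carries the letter
`a`. Raising the threshold of `a` to `p + 1` thus removes `p` and nothing else. -/
theorem remainingWord_erase {a : Γ} {p : ℕ} (hp : A.FrontAt x n alive θ a p) {θ' : Γ → ℕ}
    (h1 : θ' a = p + 1) (h2 : ∀ b ≠ a, θ' b = θ b) :
    remainingWord x n alive θ' = (remainingWord x n alive θ).erase a := by
  classical
  obtain ⟨hr, rfl, hc⟩ := hp
  rw [remainingWord, remainingWord, erase_map (List.pairwise_lt_range.filter _)]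
  · rw [List.filter_filter]
    congr 1
    refine List.filter_congr fun q hq => ?_
    rw [← Bool.decide_and, decide_eq_decide, List.mem_range] at *
    unfold Remaining
    by_cases hqp : x q = x p
    · rw [hqp, h1]
      have h3 : q < p → alive q → θ (x p) ≤ q → False := fun h h' h'' =>
        A.irrefl (x p) (hqp ▸ hc q hq h ⟨hq, h', by rwa [hqp]⟩)
      have h4 := hr.2.2
      constructor
      · rintro ⟨-, h5, h6⟩
        exact ⟨by omega, hq, h5, by omega⟩
      · rintro ⟨h5, -, h6, h7⟩
        refine ⟨hq, h6, ?_⟩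
        by_contra h8
        exact h3 (by omega) h6 h7
    · rw [h2 _ hqp]
      exact ⟨fun h => ⟨fun e => hqp (e ▸ rfl), h⟩, fun h => h.2⟩
  · exact List.mem_filter.2 ⟨List.mem_range.2 hr.1, by simpa using hr⟩
  · intro q hq hqp e
    rw [List.mem_filter, List.mem_range, decide_eq_true_eq] at hq
    exact A.irrefl (x p) (e ▸ hc q hq.1 hqp hq.2)

open Classical in
/-- The removal of the least letter that can be moved to the front. -/
noncomputable def outputStep (x : ℕ → Γ) (n : ℕ) (alive : ℕ → Prop) (θ : Γ → ℕ) (a : Γ) : ℕ :=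
  if A.LeastFront a (remainingWord x n alive θ) then leastBelow (A.FrontAt x n alive θ a) n + 1
  else θ a

theorem remainingWord_outputStep {a : Γ} (ha : A.LeastFront a (remainingWord x n alive θ)) :
    remainingWord x n alive (A.outputStep x n alive θ) =
      (remainingWord x n alive θ).erase a := by
  obtain ⟨p, hp, hpf⟩ := A.front_remainingWord_iff.1 ha.1
  obtain ⟨hle, -, h⟩ := leastBelow_spec (A.FrontAt x n alive θ a) n
  have hne : leastBelow (A.FrontAt x n alive θ a) n ≠ n := fun h => leastBelow_eq_iff.1 h p hp hpf
  refine A.remainingWord_erase (h (by omega)) (if_pos ha) fun b hb => if_neg fun h => hb (h.eq ha)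

theorem remainingWord_outputStep_of_nil (h : remainingWord x n alive θ = []) :
    remainingWord x n alive (A.outputStep x n alive θ) = [] := by
  have : A.outputStep x n alive θ = θ := funext fun a => if_neg fun ha => by
    have := ha.1
    rw [h] at this
    exact this
  rw [this, h]

end Output

/-! ### The normal form as a logspace iteration -/

section Computation

variable {Γ : Type*} [LinearOrder Γ] [Finite Γ] (A : CommAlphabet Γ)

section

variable {P : Type*} [Finite P]

theorem logPred_remaining (a : Γ) {θ : Γ → List Γ → (P → ℕ) → ℕ} {f : List Γ → (P → ℕ) → ℕ}
    (hθ : ∀ b, LogFun (θ b)) (hf : LogFun f) :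
    LogPred fun w v => Remaining (fun i => w.getD i a) w.length
      (Alive (A.hypAt w a) w.length 0) (fun b => θ b w v) (f w v) := by
  refine ((A.logPred_alive a hf).and (LogPred.exists_finite fun b => (LogPred.letter hf b).and
    (LogPred.lt hf (hθ b) 1 0).not)).congr fun w v => ?_
  simp only [Remaining, one_mul, add_zero, and_assoc]
  refine and_congr_right fun hi => and_congr_right fun _ => ?_
  simp [List.getD_eq_getElem?_getD, hi]

theorem logPred_frontAt (a b : Γ) {θ : Γ → List Γ → (P → ℕ) → ℕ} {f : List Γ → (P → ℕ) → ℕ}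
    (hθ : ∀ b, LogFun (θ b)) (hf : LogFun f) :
    LogPred fun w v => A.FrontAt (fun i => w.getD i a) w.length
      (Alive (A.hypAt w a) w.length 0) (fun b => θ b w v) b (f w v) := by
  have hj : LogFun fun (_ : List Γ) (v : P ⊕ Unit → ℕ) => v (.inr ()) := LogFun.proj _
  have hf' := hf.liftParam Unit
  have hq := LogPred.forall_lt (p := fun w v q => (q < 1 * w.length + 0 ∧ q < f w v) →
    Remaining (fun i => w.getD i a) w.length (Alive (A.hypAt w a) w.length 0)
      (fun b => θ b w v) q → ∃ c, w[q]? = some c ∧ A.Comm c b)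
    ((LogPred.lt hj hf' 1 0).imp ((A.logPred_remaining a (fun b => (hθ b).liftParam Unit) hj).imp
      (LogPred.exists_finite fun c => (LogPred.letter hj c).and (LogPred.const (A.Comm c b))))) 1 0
  refine ((A.logPred_remaining a hθ hf).and ((LogPred.letter hf b).and hq)).congr fun w v => ?_
  unfold FrontAt
  refine and_congr_right fun hr => ?_
  have hi := hr.1
  simp only [one_mul, add_zero]
  refine and_congr ?_ (forall₂_congr fun q hq => ?_)
  · simp [List.getD_eq_getElem?_getD, List.getElem?_eq_getElem hi]
  · simp [List.getD_eq_getElem?_getD, hq]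

theorem logPred_leastFront (a b : Γ) {θ : Γ → List Γ → (P → ℕ) → ℕ} (hθ : ∀ b, LogFun (θ b)) :
    LogPred fun w v => A.LeastFront b (remainingWord (fun i => w.getD i a) w.length
      (Alive (A.hypAt w a) w.length 0) (fun b => θ b w v)) := by
  have hfront : ∀ c, LogPred fun w v => A.Front c (remainingWord (fun i => w.getD i a) w.length
      (Alive (A.hypAt w a) w.length 0) (fun b => θ b w v)) := fun c =>
    (LogPred.exists_lt (p := fun w v p => A.FrontAt (fun i => w.getD i a) w.length
      (Alive (A.hypAt w a) w.length 0) (fun b => θ b w v) c p)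
      (A.logPred_frontAt a c (fun b => (hθ b).liftParam Unit) (LogFun.proj _)) 1 0).congr
      fun w v => by rw [front_remainingWord_iff, one_mul, add_zero]
  exact (hfront b).and (LogPred.forall_finite fun c => (LogPred.const (c < b)).imp (hfront c).not)

end

/-- Shortlex normal forms can be computed in logspace for letters that satisfy just the relations
that belong to `A`. -/
theorem Faithful.shortlexInLogspace {A : CommAlphabet Γ} {G : Type*} [Group G] {π : Γ → G}
    (hπ : A.Faithful π) : ShortlexInLogspace π := by
  classical
  suffices h : ∃ f : List Γ → List Γ, LogspaceComputable f ∧ ∀ w, A.Greedy (A.reduce w) (f w) by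
    obtain ⟨f, hf, h⟩ := h
    refine ⟨f, hf, fun w => ?_⟩
    have := hπ.isShortlexNormalForm (h w) (A.reduced_reduce w)
    rwa [hπ.wordValue_reduce] at this
  -- The positionwise description needs a default letter, so the empty alphabet is treated apart.
  rcases isEmpty_or_nonempty Γ with hΓ | ⟨⟨a⟩⟩
  · refine ⟨_, logspaceComputable_of_iterate (Q := Empty) [] (init := fun _ q => q.elim)
      (step := fun _ _ q => q.elim) (em := fun _ _ _ => False) (fun q => q.elim) (fun q => q.elim)
      (fun _ => LogPred.const False), fun w => ?_⟩
    cases w with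
    | nil => exact .nil
    | cons b _ => exact hΓ.elim b
  · have := Fintype.ofFinite Γ
    let U : List Γ → (Γ → ℕ) → List Γ := fun w θ => remainingWord (fun i => w.getD i a) w.length
      (Alive (A.hypAt w a) w.length 0) θ
    refine ⟨_, logspaceComputable_of_iterate (Q := Γ) Finset.univ.toList (init := fun _ _ => 0)
      (step := fun w θ => A.outputStep (fun i => w.getD i a) w.length
        (Alive (A.hypAt w a) w.length 0) θ)
      (em := fun b w θ => A.LeastFront b (U w θ)) (fun _ => LogFun.zero) (fun b => ?_)
      (fun b => A.logPred_leastFront a b fun c => LogFun.proj c), fun w => ?_⟩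
    · refine LogFun.ite (A.logPred_leastFront a b fun c => LogFun.proj c) ?_ (LogFun.proj b)
      have h := LogFun.leastBelow (P := Γ) (p := fun w θ p => A.FrontAt (fun i => w.getD i a) w.length
        (Alive (A.hypAt w a) w.length 0) θ b p)
        (A.logPred_frontAt a b (fun c => LogFun.proj (Sum.inl c)) (LogFun.proj _)) 1 0
      exact h.succ.congr fun w v => by rw [one_mul, add_zero]
    · have e : A.reduce w = U w fun _ => 0 := by
        rw [A.reduce_eq_map_filter w a]
        refine congrArg (List.map _) (List.filter_congr fun i hi => ?_)
        rw [List.mem_range] at hi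
        rw [decide_eq_decide, Remaining]
        exact ⟨fun h => ⟨hi, h, Nat.zero_le i⟩, fun h => h.2.1⟩
      rw [e]
      refine A.greedy_flatMap (U := U w) (fun s => A.remainingWord_outputStep_of_nil)
        (fun s b => A.remainingWord_outputStep) (Finset.nodup_toList _) (by simp) _ _ ?_
      rw [← e]
      exact A.length_reduce_le w

end Computation

end CommAlphabet

/-! ### Graph groups and right-angled Coxeter groups -/

theorem map_wordValue {Γ G H : Type*} [Monoid G] [Monoid H] (φ : G →* H) (π : Γ → G) (u : List Γ) :
    φ (wordValue π u) = wordValue (φ ∘ π) u := by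
  rw [wordValue, wordValue, map_list_prod, List.map_map]

theorem CommAlphabet.Faithful.of_hom {Γ : Type*} [DecidableEq Γ] {A : CommAlphabet Γ} {G : Type*}
    [Group G] {π : Γ → G} (hπ : A.Relations π) (φ : G →* Equiv.Perm (Γ → ℤ))
    (hφ : ∀ a, φ (π a) = A.perm a) : A.Faithful π where
  toRelations := hπ
  perm_eq {u v} h := by
    have e : φ ∘ π = A.perm := funext hφ
    rw [← e, ← map_wordValue, ← map_wordValue, h]

/-- The letters of a graph group. -/
def GraphGroup.commAlphabet {S : Type*} (I : SimpleGraph S) : CommAlphabet (S × Bool) where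
  inv x := (x.1, !x.2)
  inv_inv x := by simp
  Comm x y := I.Adj x.1 y.1
  symm h := h.symm
  irrefl _ := I.irrefl
  inv_left h := h

theorem GraphGroup.commute_of {S : Type*} {I : SimpleGraph S} {a b : S} (h : I.Adj a b) :
    Commute (PresentedGroup.of a : GraphGroup I) (PresentedGroup.of b) := by
  have h1 : (PresentedGroup.mk (graphGroupRels I)) (FreeGroup.of a * FreeGroup.of b *
      (FreeGroup.of a)⁻¹ * (FreeGroup.of b)⁻¹) = 1 :=
    PresentedGroup.one_of_mem ⟨a, b, h, rfl⟩
  simp only [map_mul, map_inv] at h1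
  rw [mul_inv_eq_one, mul_inv_eq_iff_eq_mul] at h1
  exact h1

theorem GraphGroup.relations_letter {S : Type*} (I : SimpleGraph S) :
    (GraphGroup.commAlphabet I).Relations (GraphGroup.letter I) where
  mul_inv := by
    rintro ⟨a, b⟩
    cases b <;> simp [GraphGroup.letter, GraphGroup.commAlphabet]
  comm := by
    rintro ⟨a, b⟩ ⟨c, d⟩ h
    have h' : Commute (PresentedGroup.of a : GraphGroup I) (PresentedGroup.of c) :=
      GraphGroup.commute_of h
    change Commute _ _
    cases b <;> cases d <;> simp only [GraphGroup.letter, if_true, if_false, Bool.false_eq_true]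
    exacts [h'.inv_inv, h'.inv_left, h'.inv_right, h']

/-- The permutations satisfy the commutation relations, so the universal property of the
presentation extends them to the group; inverse letters then go to inverse permutations
automatically. -/
theorem GraphGroup.faithful_letter {S : Type*} [DecidableEq (S × Bool)] (I : SimpleGraph S) :
    (GraphGroup.commAlphabet I).Faithful (GraphGroup.letter I) := by
  set A := GraphGroup.commAlphabet I with hA
  have hrel : ∀ r ∈ graphGroupRels I, FreeGroup.lift (fun a => A.perm (a, true)) r = 1 := by
    rintro _ ⟨a, b, h, rfl⟩
    have := A.relations_perm.comm (a := (a, true)) (b := (b, true)) h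
    simp [this]
  refine .of_hom (GraphGroup.relations_letter I) (PresentedGroup.toGroup hrel) ?_
  rintro ⟨a, b⟩
  cases b
  · simp only [GraphGroup.letter, if_false, Bool.false_eq_true, map_inv, PresentedGroup.toGroup.of]
    exact inv_eq_of_mul_eq_one_right (A.relations_perm.mul_inv (a, true))
  · simp [GraphGroup.letter]

/-- The letters of a right-angled Coxeter group. -/
def CoxeterMatrix.commAlphabet {S : Type*} (M : CoxeterMatrix S) : CommAlphabet S where
  inv a := a
  inv_inv _ := rfl
  Comm a b := M a b = 2
  symm {a b} h := (M.symmetric b a).trans h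
  irrefl a h := by simp at h
  inv_left h := h

theorem CoxeterMatrix.relations_simple {S : Type*} (M : CoxeterMatrix S) :
    M.commAlphabet.Relations M.simple where
  mul_inv a := M.toCoxeterSystem.simple_mul_simple_self a
  comm {a b} h := by
    have h1 := M.toCoxeterSystem.simple_mul_simple_pow a b
    have h2 : M a b = 2 := h
    rw [h2, pow_two, M.toCoxeterSystem_simple] at h1
    have ha := M.toCoxeterSystem.inv_simple a
    have hb := M.toCoxeterSystem.inv_simple b
    rw [M.toCoxeterSystem_simple] at ha hb
    rw [eq_inv_of_mul_eq_one_left h1, mul_inv_rev, ha, hb]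

/-- An entry `0` imposes no relation, `1` occurs only on the diagonal, and `2` means commutation, so
the relations of the action suffice for lifting. -/
theorem CoxeterMatrix.IsRightAngled.faithful_simple {S : Type*} [DecidableEq S]
    {M : CoxeterMatrix S} (hM : M.IsRightAngled) : M.commAlphabet.Faithful M.simple := by
  set A := M.commAlphabet with hA
  have hsq : ∀ a, A.perm a * A.perm a = 1 := A.relations_perm.mul_inv
  have hlift : M.IsLiftable A.perm := by
    intro a b
    rcases hM a b with h | h | h
    · rw [h, pow_zero]
    · have : a = b := by
        by_contra hab
        exact M.off_diagonal a b hab h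
      rw [h, pow_one, this, hsq]
    · have hc := A.relations_perm.comm (a := a) (b := b) h
      rw [h, pow_two, mul_assoc, ← mul_assoc (A.perm b), ← hc, mul_assoc, hsq, mul_one, hsq]
  exact .of_hom M.relations_simple (M.toCoxeterSystem.lift ⟨A.perm, hlift⟩) fun a =>
    M.toCoxeterSystem.lift_apply_simple hlift a

theorem mainTheorem1 {S : Type*} [Finite S] :
    (∀ (I : SimpleGraph S) [LinearOrder (S × Bool)], ShortlexInLogspace (GraphGroup.letter I)) ∧
      (∀ (M : CoxeterMatrix S), M.IsRightAngled →
        ∀ [LinearOrder S], ShortlexInLogspace M.simple) :=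
  ⟨fun I _ => (GraphGroup.faithful_letter I).shortlexInLogspace,
    fun _ hM _ => hM.faithful_simple.shortlexInLogspace⟩
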